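/- **Setting.** Let $K_0\subset\mathbb R^n$ be compact, $\varphi_0\in C^\infty(\mathbb R^n;\mathbb R)$, and $B_0,B_1\in C^\infty(\mathbb R^n;\mathbb R)$ with supports in $K_0$. We consider the Schrödinger equation $-i\varepsilon u_t-\frac{\varepsilon^2}{2}\Delta u+Vu=0$, $u(0)=B_0e^{i\varphi_0/\varepsilon}$, where $V$ is smooth and $V$ and all its derivatives are bounded; or the wave equation $u_{tt}-c^2\Delta u=0$, $u(0)=B_0e^{i\varphi_0/\varepsilon}$, $u_t(0)=\varepsilon^{-1}B_1e^{i\varphi_0/\varepsilon}$, where $c$ is smooth, $c$ and all its derivatives are bounded, $\inf c>0$ and $\inf|\nabla\varphi_0|>0$. *Beams.* For a mode with central ray $x(t,z)$, ray direction $p(t,z)$, phase coefficients $\phi_\beta(t,z)$ and amplitude coefficients $a_{j,\beta}(t,z)$ ($t\ge0$, $z\in\mathbb R^n$, $\phi_{e_i}=p_i$, $M_{il}=\phi_{e_i+e_l}$) put $$\Phi_k(t,y,z)=\phi_0+y\cdot p+\tfrac12 y\cdot My+\sum_{3\le|\beta|\le k+1}\tfrac1{\beta!}\phi_\beta y^\beta,\qquad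 A_k(t,y,z)=\sum_{j=0}^{\lceil k/2\rceil-1}\varepsilon^j\sum_{|\beta|\le k-2j-1}\tfrac1{\beta!}a_{j,\beta}y^\beta ,$$ $v_k(t,y,z)=A_k(t,y-x(t,z),z)\,e^{i\Phi_k(t,y-x(t,z),z)/\varepsilon}$, and $$u_k(t,y)=(2\pi\varepsilon)^{-n/2}\int_{K_0}\sum_{\text{modes}}v_k(t,y,z)\,\varrho_\eta(y-x(t,z))\,dz .$$ There is one mode for the Schrödinger equation and there are two, marked $\pm$, for the wave equation. Here $\varrho_\eta\in C^\infty(\mathbb R^n)$, $\varrho_\eta\ge0$, is a cutoff of radius $0<\eta\le\infty$: $\varrho_\eta(y)=1$ for $|y|\le\eta$ and $\varrho_\eta(y)=0$ for $|y|\ge2\eta$ ($\varrho_\eta\equiv1$ if $\eta=\infty$). *Coefficients.* Write $\Phi=\sum_\beta\phi_\beta y^\beta/\beta!$, $a_j=\sum_\beta a_{j,\beta}y^\beta/\beta!$ (formal power series in $y$), $a_{-1}=0$, and $d_t=\partial_t-\partial_tx\cdot\nabla_y$; $V$ and $c$ in formal equations denote the Taylor series of $y\mapsto V(x+y)$ and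 $y\mapsto c(x+y)$. In all cases $x(0,z)=z$, $p(0,z)=\nabla\varphi_0(z)$, $\phi_0(0,z)=\varphi_0(z)$, $M(0,z)=D^2\varphi_0(z)+i\,\mathrm{Id}$, $\phi_\beta(0,z)=\partial^\beta\varphi_0(z)$ for $|\beta|\ge3$. For the Schrödinger equation, $\partial_tx=p$, $\partial_tp=-\nabla V(x)$, $\partial_t\phi_0=\frac12|p|^2-V(x)$, $\partial_tM=-M^2-D^2V(x)$, and for $|\beta|\ge3$ $$\partial_t\phi_\beta=-\tfrac12\sum_{l=1}^n\ \sum_{\gamma\le\beta,\ 1\le|\gamma|\le|\beta|-1}\tfrac{\beta!}{(\beta-\gamma)!\gamma!}\phi_{\beta-\gamma+e_l}\phi_{\gamma+e_l}-\partial^\beta V(x);$$ the amplitudes satisfy $d_ta_j+\nabla a_j\cdot\nabla\Phi+\frac12a_j\Delta\Phi=\frac i2\Delta a_{j-1}$ coefficientwise, with $a_{0,\beta}(0,z)=\partial^\beta B_0(z)$ and $a_{j,\beta}(0,z)=0$ for $j>0$. For the wave equation, $\partial_tx^\pm=\pm c(x^\pm)p^\pm/|p^\pm|$, $\partial_tp^\pm=\mp|p^\pm|\nabla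 c(x^\pm)$, $\partial_t\phi_0^\pm=0$, $\partial_tM^\pm=\mp(E+B^TM^\pm+M^\pm B+M^\pm CM^\pm)$ with $E=|p^\pm|D^2c(x^\pm)$, $B=p^\pm\otimes\nabla c(x^\pm)/|p^\pm|$, $C=\frac{c(x^\pm)}{|p^\pm|}\mathrm{Id}-\frac{c(x^\pm)}{|p^\pm|^3}p^\pm\otimes p^\pm$; the remaining coefficients are given coefficientwise by the eikonal equation $(d_t\Phi^\pm)^2=c^2\,\nabla\Phi^\pm\cdot\nabla\Phi^\pm$ and the transport equations $$2\,d_t\Phi^\pm\,d_ta_j^\pm+a_j^\pm\,d_t^2\Phi^\pm-c^2\bigl(2\nabla a_j^\pm\cdot\nabla\Phi^\pm+a_j^\pm\Delta\Phi^\pm\bigr)=i\bigl(d_t^2a_{j-1}^\pm-c^2\Delta a_{j-1}^\pm\bigr),$$ with, at $t=0$ and in terms of the Taylor series of $B_0,B_1$ at $z$, $a_0^\pm=\frac12\bigl(B_0+B_1/(i\,d_t\Phi^\pm)\bigr)$ and $a_{j+1}^\pm=-\frac12(d_ta_j^++d_ta_j^-)/(i\,d_t\Phi^\pm)$. *Oscillatory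 integrals.* For a phase $\Phi$, ray $x$, multi-index $\alpha$ and continuous $g(t,y,z,\varepsilon)$ let $$\mathcal I^\alpha_{\Phi,x,g}(t,y)=\varepsilon^{-\frac{n+|\alpha|}2}\int_{K_0}g(t,y,z,\varepsilon)(y-x(t,z))^\alpha e^{i\Phi(t,y-x(t,z),z)/\varepsilon}\varrho_\eta(y-x(t,z))\,dz .$$ *Properties.* Let $T,d>0$ and $K_d=\{z:\operatorname{dist}(z,K_0)\le d\}$. For a triple $(\Phi,x,g)$: - (P1) $x\in C^\infty([0,T]\times\mathbb R^n)$; (P2) $\Phi\in C^\infty([0,T]\times\mathbb R^n\times\mathbb R^n)$. - (P3) $\nabla_y\Phi(t,0,z)$ is real and, for some $C>0$, $|\nabla_y\Phi(t,0,z)-\nabla_y\Phi(t,0,z')|+|x(t,z)-x(t,z')|\ge C|z-z'|$, for all $t\in[0,T]$, $z,z'\in K_d$. - (P4) For some $w_4>0$, $\operatorname{Im}\Phi(t,y,z)\ge w_4|y|^2$ for all $t\in[0,T]$, $z\in K_d$, $|y|\le2\eta$ (all $y$ if $\eta=\infty$). - (P6) For all $t\ge0$, $z\in\mathbb R^n$: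 $\Phi(t,0,z)$ and $\nabla_y\Phi(t,0,z)$ are real, $x$ and $\Phi(t,0,\cdot)$ are differentiable in $z$, and $(D_zx(t,z))^T\nabla_y\Phi(t,0,z)=\nabla_z\Phi(t,0,z)$. - (P7) $g$ is bounded on $[0,T]\times\mathbb R^n\times K_d\times(0,\infty)$; $\operatorname{supp}g(t,y,\cdot,\varepsilon)\subset K_0$ for all $t\in[0,T]$, $y\in\mathbb R^n$, $\varepsilon>0$; and there are $D_7,w_7>0$ with $|g(t,y,z,\varepsilon)e^{i\Phi(t,y-x(t,z),z)/\varepsilon}\varrho_\eta(y-x(t,z))|\le D_7e^{-w_7|y-x(t,z)|^2/\varepsilon}$ for all $t\in[0,T]$, $z\in K_d$, $\varepsilon>0$, $y\in\mathbb R^n$. - (P8) There are $D_8,w_8>0$ and integers $q,\ell\ge0$ with $q\ge2\ell$ such that, for all $t\in[0,T]$, $z,z_0\in K_d$, $\varepsilon>0$ and $y_0=x(t,z_0)$, $$\bigl|(g(t,y_0,z,\varepsilon)-g(t,y_0,z_0,\varepsilon))e^{i\Phi(t,y_0-x(t,z),z)/\varepsilon}\varrho_\eta(y_0-x(t,z))\bigr|\le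 D_8|z-z_0|\Bigl(1+\frac{|z-z_0|^q}{\varepsilon^\ell}\Bigr)e^{-w_8|y_0-x(t,z)|^2/\varepsilon}.$$ The width $\eta$ is called *admissible* for $K_d$, $T$ and a beam phase $\Phi$ if (P4) holds. **Theorem.** Let $k\ge1$, $p\ge0$, and let $u_k$, $u_{k+p}$ be the Gaussian beam superpositions of orders $k$ and $k+p$, with the same cutoff $\varrho_\eta$, for the Schrödinger equation or for the wave equation. There are a finite $J$, exponents $\ell_j\in\{0,\frac12,1,\frac32,\dots\}$, multi-indices $\beta_j$, functions $g_j(t,y,z,\varepsilon)$ continuous on $[0,\infty)\times\mathbb R^n\times\mathbb R^n\times(0,\infty)$, and pairs $(\Psi_j,x_j)$, each one of $(\Phi_k,x),(\Phi_{k+p},x)$ in the Schrödinger case and one of $(\Phi_k^\pm,x^\pm),(\Phi_{k+p}^\pm,x^\pm)$ in the wave case, such that $$u_{k+p}(t,y)-u_k(t,y)=\varepsilon^{\frac k2}\sum_{j=0}^J\varepsilon^{\ell_j}\,\mathcal I^{\beta_j}_{\Psi_j,x_j,g_j}(t,y)\qquad\text{for all }t\ge0,\ y\in\mathbb R^n,\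 \varepsilon>0,$$ and $|\beta_j|$ has the same parity as $k$ whenever $\ell_j=0$. Moreover, for all $T,d>0$ such that $\eta$ is admissible for $K_d$, $T$ and all the phases of orders $k$ and $k+p$ ($\Phi_k,\Phi_{k+p}$, respectively $\Phi_k^\pm,\Phi_{k+p}^\pm$), every triple $(\Psi_j,x_j,g_j)$ has the properties (P1)–(P4) and (P6)–(P8). -/

import Mathlib

open Set MeasureTheory
open scoped ContDiff ENNReal

noncomputable section

namespace GaussianBeam

/-! ### Multi-indices, partial derivatives and Taylor series -/

/-- Points of `ℝⁿ`, with the Euclidean norm. -/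
abbrev Pt (n : ℕ) := EuclideanSpace ℝ (Fin n)

/-- Multi-indices; `|β|` is `β.degree`. -/
abbrev MIdx (n : ℕ) := Fin n →₀ ℕ

/-- The multi-index `e_i`. -/
abbrev e {n : ℕ} (i : Fin n) : MIdx n := Finsupp.single i 1

/-- `β! = β₁! ⋯ βₙ!`. -/
def mfact {n : ℕ} (β : MIdx n) : ℕ := ∏ i, (β i).factorial

/-- The monomial `y^β`. -/
def mpow {n : ℕ} (y : Pt n) (β : MIdx n) : ℝ := ∏ i, y i ^ β i

/-- The finite set of multi-indices `β` with `|β| = m`. -/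
def ofDegree (n m : ℕ) : Finset (MIdx n) := Finset.univ.finsuppAntidiag m

/-- The partial derivative `∂f/∂y_i`. -/
def pd {n : ℕ} {F : Type*} [NormedAddCommGroup F] [NormedSpace ℝ F] (i : Fin n)
    (f : Pt n → F) : Pt n → F :=
  fun y => fderiv ℝ f y (EuclideanSpace.single i 1)

/-- `∂^β f = ∂₁^{β₁} ⋯ ∂ₙ^{βₙ} f`. -/
def mderiv {n : ℕ} {F : Type*} [NormedAddCommGroup F] [NormedSpace ℝ F] (β : MIdx n)
    (f : Pt n → F) : Pt n → F :=
  (List.finRange n).foldr (fun i g => (pd i)^[β i] g) f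

/-- Formal power series in `y = (y₁, …, yₙ)`. -/
abbrev Series (n : ℕ) := MvPowerSeries (Fin n) ℂ

/-- The formal power series `∑_β c_β y^β / β!`. -/
def series {n : ℕ} (c : MIdx n → ℂ) : Series n := fun β => c β / (mfact β : ℂ)

/-- The Taylor series of `y ↦ f (x + y)` at `y = 0`. -/
def taylor {n : ℕ} (f : Pt n → ℝ) (x : Pt n) : Series n :=
  series fun β => ((mderiv β f x : ℝ) : ℂ)

/-- The formal Laplacian. -/
def lap {n : ℕ} (S : Series n) : Series n :=
  ∑ i, MvPowerSeries.pderiv ℂ i (MvPowerSeries.pderiv ℂ i S)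

/-- The formal product `∇S · ∇R`. -/
def gradDot {n : ℕ} (S R : Series n) : Series n :=
  ∑ i, MvPowerSeries.pderiv ℂ i S * MvPowerSeries.pderiv ℂ i R

/-- The coefficientwise time derivative of a power series. Time derivatives are those on `[0, ∞)`,
one-sided at `0`. -/
def coeffDeriv {n : ℕ} (S : ℝ → Series n) (t : ℝ) : Series n :=
  fun β => derivWithin (fun s => MvPowerSeries.coeff β (S s)) (Ici 0) t

/-- If `S t` is a power series in `y - x t`, this is its time derivative with the space point kept
fixed, again as a power series in `y - x t`: it is `∂_t S - ∂_t x · ∇_y S`, where `∂_t` acts on the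
coefficients. -/
def dt {n : ℕ} (x : ℝ → Pt n) (S : ℝ → Series n) (t : ℝ) : Series n :=
  coeffDeriv S t -
    ∑ i, ((derivWithin (fun s => x s i) (Ici 0) t : ℝ) : ℂ) • MvPowerSeries.pderiv ℂ i (S t)

/-! ### Beams and superpositions -/

/-- The coefficient functions of the beams of one mode: central ray `x (t, z)`, ray direction
`p (t, z)`, phase coefficients `φ_β (t, z)` and amplitude coefficients `a_{j,β} (t, z)`, where `z`
is the starting point of the ray. The phase coefficients with `|β| ≤ 2` are `φ_0`, `p` and `M`. -/
structure Coeffs (n : ℕ) where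
  x : ℝ → Pt n → Pt n
  p : ℝ → Pt n → Pt n
  φ : MIdx n → ℝ → Pt n → ℂ
  a : ℕ → MIdx n → ℝ → Pt n → ℂ

namespace Coeffs

variable {n : ℕ} (b : Coeffs n)

/-- The second order phase coefficients, `M_{il} = φ_{e_i + e_l}`. -/
def M (t : ℝ) (z : Pt n) : Matrix (Fin n) (Fin n) ℂ :=
  Matrix.of fun i l => b.φ (e i + e l) t z

/-- The phase `Φ_k (t, y, z)`. -/
def phase (k : ℕ) (t : ℝ) (y z : Pt n) : ℂ :=
  b.φ 0 t z + ∑ i, (y i : ℂ) * (b.p t z i : ℂ) +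
    1 / 2 * ∑ i, ∑ l, (y i : ℂ) * b.M t z i l * (y l : ℂ) +
    ∑ m ∈ Finset.Icc 3 (k + 1), ∑ β ∈ ofDegree n m,
      1 / (mfact β : ℂ) * b.φ β t z * (mpow y β : ℂ)

/-- The amplitude `A_k (t, y, z)`: the sum over `0 ≤ j ≤ ⌈k/2⌉ - 1` and `0 ≤ |β| ≤ k - 2j - 1` of
`ε^j a_{j,β} y^β / β!`. -/
def amplitude (k : ℕ) (ε : ℝ) (t : ℝ) (y z : Pt n) : ℂ :=
  ∑ j ∈ Finset.range ((k + 1) / 2), (ε : ℂ) ^ j *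
    ∑ m ∈ Finset.range (k - 2 * j), ∑ β ∈ ofDegree n m,
      1 / (mfact β : ℂ) * b.a j β t z * (mpow y β : ℂ)

/-- The beam `v_k (t, y, z)` of order `k`. -/
def beam (k : ℕ) (ε : ℝ) (t : ℝ) (y z : Pt n) : ℂ :=
  b.amplitude k ε t (y - b.x t z) z *
    Complex.exp (Complex.I * b.phase k t (y - b.x t z) z / ε)

/-- The full formal phase `∑_β φ_β y^β / β!` of the ray from `z`. -/
def phaseSeries (z : Pt n) (t : ℝ) : Series n := series fun β => b.φ β t z

/-- The full formal amplitude `a_j = ∑_β a_{j,β} y^β / β!` of the ray from `z`. -/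
def ampSeries (j : ℕ) (z : Pt n) (t : ℝ) : Series n := series fun β => b.a j β t z

/-- The formal amplitude `a_{j-1}`, with `a_{-1} = 0`. -/
def prevAmpSeries : ℕ → Pt n → ℝ → Series n
  | 0 => fun _ _ => 0
  | j + 1 => b.ampSeries j

end Coeffs

/-- The Gaussian beam superposition `u_k (t, y)` of finitely many modes. -/
def superposition {n : ℕ} {ι : Type*} [Fintype ι] (b : ι → Coeffs n) (K₀ : Set (Pt n))
    (ρ : Pt n → ℝ) (k : ℕ) (ε : ℝ) (t : ℝ) (y : Pt n) : ℂ :=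
  (((1 / (2 * Real.pi * ε)) ^ ((n : ℝ) / 2) : ℝ) : ℂ) *
    ∫ z in K₀, ∑ s, (b s).beam k ε t y z * (ρ (y - (b s).x t z) : ℂ)

/-- `ρ` is a cutoff function of radius `η ∈ (0, ∞]`. For `η = ∞` this says `ρ = 1`. -/
structure IsCutoff {n : ℕ} (η : ℝ≥0∞) (ρ : Pt n → ℝ) : Prop where
  smooth : ContDiff ℝ ∞ ρ
  nonneg : ∀ y, 0 ≤ ρ y
  eq_one : ∀ y, ‖y‖ₑ ≤ η → ρ y = 1
  eq_zero : ∀ y, 2 * η ≤ ‖y‖ₑ → ρ y = 0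

/-- `f ∈ C^∞_b (ℝⁿ)`: smooth, with all derivatives (including `f` itself) bounded. -/
def SmoothBounded {n : ℕ} (f : Pt n → ℝ) : Prop :=
  ContDiff ℝ ∞ f ∧ ∀ m : ℕ, ∃ C : ℝ, ∀ y, ‖iteratedFDeriv ℝ m f y‖ ≤ C

/-! ### Equations for the coefficients -/

/-- The initial values of the ray and of the phase coefficients, for initial phase `φ₀`, and the
identification of the first order phase coefficients with the ray direction `p`. -/
structure PhaseInit {n : ℕ} (φ₀ : Pt n → ℝ) (b : Coeffs n) : Prop where
  first_order : ∀ z, ∀ t ≥ 0, ∀ i, b.φ (e i) t z = (b.p t z i : ℂ)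
  x_zero : ∀ z, b.x 0 z = z
  p_zero : ∀ z, b.p 0 z = gradient φ₀ z
  phi0_zero : ∀ z, b.φ 0 0 z = (φ₀ z : ℂ)
  M_zero : ∀ z i l, b.M 0 z i l =
    ((pd i (pd l φ₀) z : ℝ) : ℂ) + if i = l then Complex.I else 0
  phi_zero : ∀ z β, 3 ≤ β.degree → b.φ β 0 z = ((mderiv β φ₀ z : ℝ) : ℂ)

/-- `b` consists of the beam coefficients of the Schrödinger equation
`-iε u_t - (ε²/2) Δu + V u = 0`, `u(0, y) = B₀ e^{iφ₀/ε}`. -/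
structure IsSchrodinger {n : ℕ} (V φ₀ B₀ : Pt n → ℝ) (b : Coeffs n) : Prop where
  phase_init : PhaseInit φ₀ b
  ray : ∀ z, ∀ t ≥ 0, HasDerivWithinAt (fun s => b.x s z) (b.p t z) (Ici 0) t
  direction : ∀ z, ∀ t ≥ 0,
    HasDerivWithinAt (fun s => b.p s z) (-gradient V (b.x t z)) (Ici 0) t
  phi0 : ∀ z, ∀ t ≥ 0, HasDerivWithinAt (fun s => b.φ 0 s z)
    ((‖b.p t z‖ ^ 2 / 2 - V (b.x t z) : ℝ) : ℂ) (Ici 0) t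
  hessian : ∀ z, ∀ t ≥ 0, ∀ i l, HasDerivWithinAt (fun s => b.M s z i l)
    (-(b.M t z * b.M t z) i l - ((pd i (pd l V) (b.x t z) : ℝ) : ℂ)) (Ici 0) t
  phi : ∀ z, ∀ t ≥ 0, ∀ β, 3 ≤ β.degree → HasDerivWithinAt (fun s => b.φ β s z)
    (-(1 / 2) * ∑ l, ∑ γ ∈ (Finset.Iic β).filter
        (fun γ => 1 ≤ γ.degree ∧ γ.degree ≤ β.degree - 1),
        (mfact β : ℂ) / ((mfact (β - γ) : ℂ) * (mfact γ : ℂ)) *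
          b.φ (β - γ + e l) t z * b.φ (γ + e l) t z -
      ((mderiv β V (b.x t z) : ℝ) : ℂ)) (Ici 0) t
  amp_diff : ∀ z j β, DifferentiableOn ℝ (fun t => b.a j β t z) (Ici 0)
  /-- The transport equations `∂_t a_j + ∇a_j · ∇Φ + (1/2) a_j ΔΦ = (i/2) Δa_{j-1}`, to all orders
  on the central ray. Comparing coefficients gives the linear system for the `a_{j,β}`, which
  starts with `∂_t a_0 = -(1/2) Tr(M) a_0`. -/
  transport : ∀ z, ∀ t ≥ 0, ∀ j,
    dt (fun s => b.x s z) (b.ampSeries j z) t +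
      gradDot (b.ampSeries j z t) (b.phaseSeries z t) +
      (1 / 2 : ℂ) • (b.ampSeries j z t * lap (b.phaseSeries z t)) =
    (Complex.I / 2) • lap (b.prevAmpSeries j z t)
  amp_zero : ∀ z j β, b.a j β 0 z = if j = 0 then ((mderiv β B₀ z : ℝ) : ℂ) else 0

/-- The formal time derivative `d_t Φ` of the phase at fixed space point. -/
def Coeffs.dtPhase {n : ℕ} (b : Coeffs n) (z : Pt n) (t : ℝ) : Series n :=
  dt (fun s => b.x s z) (b.phaseSeries z) t

/-- The formal time derivative `d_t a_j` of the amplitude at fixed space point. -/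
def Coeffs.dtAmp {n : ℕ} (b : Coeffs n) (j : ℕ) (z : Pt n) (t : ℝ) : Series n :=
  dt (fun s => b.x s z) (b.ampSeries j z) t

/-- The matrix `E = |p| D²c(x)` of the Riccati equation for the wave equation. -/
def riccatiE {n : ℕ} (c : Pt n → ℝ) (x p : Pt n) : Matrix (Fin n) (Fin n) ℂ :=
  Matrix.of fun i l => ((‖p‖ * pd i (pd l c) x : ℝ) : ℂ)

/-- The matrix `B = p ⊗ ∇c(x) / |p|` of the Riccati equation for the wave equation. -/
def riccatiB {n : ℕ} (c : Pt n → ℝ) (x p : Pt n) : Matrix (Fin n) (Fin n) ℂ :=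
  Matrix.of fun i l => ((p i * gradient c x l / ‖p‖ : ℝ) : ℂ)

/-- The matrix `C = (c(x)/|p|) Id - (c(x)/|p|³) p ⊗ p` of the Riccati equation for the wave
equation. -/
def riccatiC {n : ℕ} (c : Pt n → ℝ) (x p : Pt n) : Matrix (Fin n) (Fin n) ℂ :=
  Matrix.of fun i l =>
    (((if i = l then c x / ‖p‖ else 0) - c x / ‖p‖ ^ 3 * (p i * p l) : ℝ) : ℂ)

/-- `b` consists of coefficients of the mode with sign `σ = ±1` of the wave equation
`u_tt - c² Δu = 0`, with initial phase `φ₀`; the initial amplitudes, which couple the two modes,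
are not prescribed here. -/
structure IsWaveMode {n : ℕ} (c φ₀ : Pt n → ℝ) (σ : ℝ) (b : Coeffs n) : Prop where
  phase_init : PhaseInit φ₀ b
  ray : ∀ z, ∀ t ≥ 0, HasDerivWithinAt (fun s => b.x s z)
    ((σ * c (b.x t z) / ‖b.p t z‖) • b.p t z) (Ici 0) t
  direction : ∀ z, ∀ t ≥ 0, HasDerivWithinAt (fun s => b.p s z)
    (-(σ * ‖b.p t z‖) • gradient c (b.x t z)) (Ici 0) t
  phi0 : ∀ z, ∀ t ≥ 0, HasDerivWithinAt (fun s => b.φ 0 s z) 0 (Ici 0) t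
  hessian : ∀ z, ∀ t ≥ 0, ∀ i l, HasDerivWithinAt (fun s => b.M s z i l)
    (-(σ : ℂ) * (riccatiE c (b.x t z) (b.p t z)
      + (riccatiB c (b.x t z) (b.p t z)).transpose * b.M t z
      + b.M t z * riccatiB c (b.x t z) (b.p t z)
      + b.M t z * riccatiC c (b.x t z) (b.p t z) * b.M t z) i l) (Ici 0) t
  phi_diff : ∀ z β, ContDiffOn ℝ 2 (fun t => b.φ β t z) (Ici 0)
  amp_diff : ∀ z j β, ContDiffOn ℝ 2 (fun t => b.a j β t z) (Ici 0)
  /-- The eikonal equation `Φ_t² = c² ∇Φ · ∇Φ`, to all orders on the central ray. The constant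
  term `-σ c |p|` of `Φ_t`, given by the equations above, selects the branch
  `Φ_t = -σ c (∇Φ · ∇Φ)^{1/2}`. -/
  eikonal : ∀ z, ∀ t ≥ 0, b.dtPhase z t ^ 2 =
    taylor c (b.x t z) ^ 2 * gradDot (b.phaseSeries z t) (b.phaseSeries z t)
  /-- The transport equations
  `2 Φ_t ∂_t a_j + Φ_tt a_j - c² (2 ∇a_j · ∇Φ + a_j ΔΦ) = i (∂_tt a_{j-1} - c² Δa_{j-1})`,
  to all orders on the central ray. Comparing coefficients gives the linear system for the
  `a_{j,β}`. -/
  transport : ∀ z, ∀ t ≥ 0, ∀ j,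
    2 * b.dtPhase z t * b.dtAmp j z t
      + dt (fun s => b.x s z) (b.dtPhase z) t * b.ampSeries j z t
      - taylor c (b.x t z) ^ 2 * (2 * gradDot (b.ampSeries j z t) (b.phaseSeries z t)
        + b.ampSeries j z t * lap (b.phaseSeries z t)) =
    Complex.I • (dt (fun s => b.x s z) (dt (fun s => b.x s z) (b.prevAmpSeries j z)) t
      - taylor c (b.x t z) ^ 2 * lap (b.prevAmpSeries j z t))

/-- The initial amplitudes of one of the two modes `b` of the wave equation with initial data
`u(0, y) = B₀ e^{iφ₀/ε}`, `u_t(0, y) = ε⁻¹ B₁ e^{iφ₀/ε}`; the two modes are `bp` and `bm`. The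
inverse is that of a formal power series with nonzero constant term. -/
structure WaveAmpInit {n : ℕ} (B₀ B₁ : Pt n → ℝ) (bp bm b : Coeffs n) : Prop where
  zero : ∀ z, b.ampSeries 0 z 0 =
    (1 / 2 : ℂ) • (taylor B₀ z + taylor B₁ z * (Complex.I • b.dtPhase z 0)⁻¹)
  succ : ∀ z j, b.ampSeries (j + 1) z 0 =
    -(1 / 2 : ℂ) • ((bp.dtAmp j z 0 + bm.dtAmp j z 0) * (Complex.I • b.dtPhase z 0)⁻¹)

/-- `bp` and `bm` consist of the beam coefficients of the forward and the backward mode of the wave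
equation. -/
structure IsWave {n : ℕ} (c φ₀ B₀ B₁ : Pt n → ℝ) (bp bm : Coeffs n) : Prop where
  plus : IsWaveMode c φ₀ 1 bp
  minus : IsWaveMode c φ₀ (-1) bm
  amp_plus : WaveAmpInit B₀ B₁ bp bm bp
  amp_minus : WaveAmpInit B₀ B₁ bp bm bm

/-! ### Oscillatory integrals and their properties -/

/-- The oscillatory integral `I^α_{Φ,x,g} (t, y)`. -/
def oscInt {n : ℕ} (K₀ : Set (Pt n)) (ρ : Pt n → ℝ) (α : MIdx n) (Φ : ℝ → Pt n → Pt n → ℂ)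
    (x : ℝ → Pt n → Pt n) (g : ℝ → Pt n → Pt n → ℝ → ℂ) (ε t : ℝ) (y : Pt n) : ℂ :=
  ((ε ^ (-((n : ℝ) + (α.degree : ℝ)) / 2) : ℝ) : ℂ) *
    ∫ z in K₀, g t y z ε * (mpow (y - x t z) α : ℂ) *
      Complex.exp (Complex.I * Φ t (y - x t z) z / ε) * (ρ (y - x t z) : ℂ)

/-- The gradient `∇_y Φ (t, 0, z)`. -/
def gradPhase {n : ℕ} (Φ : ℝ → Pt n → Pt n → ℂ) (t : ℝ) (z : Pt n) : EuclideanSpace ℂ (Fin n) :=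
  WithLp.toLp 2 fun i => pd i (fun y => Φ t y z) 0

def P1 {n : ℕ} (T : ℝ) (x : ℝ → Pt n → Pt n) : Prop :=
  ContDiffOn ℝ ∞ (fun q : ℝ × Pt n => x q.1 q.2) (Icc 0 T ×ˢ univ)

def P2 {n : ℕ} (T : ℝ) (Φ : ℝ → Pt n → Pt n → ℂ) : Prop :=
  ContDiffOn ℝ ∞ (fun q : ℝ × Pt n × Pt n => Φ q.1 q.2.1 q.2.2) (Icc 0 T ×ˢ univ)

def P3 {n : ℕ} (T : ℝ) (K : Set (Pt n)) (Φ : ℝ → Pt n → Pt n → ℂ) (x : ℝ → Pt n → Pt n) : Prop :=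
  (∀ t ∈ Icc 0 T, ∀ z ∈ K, ∀ i, (gradPhase Φ t z i).im = 0) ∧
  ∃ C > 0, ∀ t ∈ Icc 0 T, ∀ z ∈ K, ∀ z' ∈ K,
    C * ‖z - z'‖ ≤ ‖gradPhase Φ t z - gradPhase Φ t z'‖ + ‖x t z - x t z'‖

def P4 {n : ℕ} (T : ℝ) (K : Set (Pt n)) (η : ℝ≥0∞) (Φ : ℝ → Pt n → Pt n → ℂ) : Prop :=
  ∃ w > 0, ∀ t ∈ Icc 0 T, ∀ z ∈ K, ∀ y, ‖y‖ₑ ≤ 2 * η → w * ‖y‖ ^ 2 ≤ (Φ t y z).im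

/-- The cutoff width `η` is admissible for `K`, `T` and the beam phase `Φ`: it is so small that
`Im Φ` is bounded below by a multiple of `|y|²` where `|y| ≤ 2η`. This passes to smaller `η`, and
it is the only one of the properties of beam phases and rays in which `η` occurs. -/
def Admissible {n : ℕ} (K : Set (Pt n)) (T : ℝ) (Φ : ℝ → Pt n → Pt n → ℂ) (η : ℝ≥0∞) : Prop :=
  P4 T K η Φ

/-- `Φ (t, 0, z)` and `∇_y Φ (t, 0, z)` are real and `J^T ∇_y Φ (t, 0, z) = ∇_z Φ (t, 0, z)` with
`J = D_z x`; the derivatives with respect to `z` exist. -/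
def P6 {n : ℕ} (Φ : ℝ → Pt n → Pt n → ℂ) (x : ℝ → Pt n → Pt n) : Prop :=
  ∀ t ≥ 0, ∀ z, (Φ t 0 z).im = 0 ∧ (∀ i, (gradPhase Φ t z i).im = 0) ∧
    DifferentiableAt ℝ (fun z' => x t z') z ∧ DifferentiableAt ℝ (fun z' => Φ t 0 z') z ∧
    ∀ l, ∑ i, ((pd l (fun z' => x t z') z i : ℝ) : ℂ) * gradPhase Φ t z i =
      pd l (fun z' => Φ t 0 z') z

def P7 {n : ℕ} (T : ℝ) (K₀ K : Set (Pt n)) (ρ : Pt n → ℝ) (Φ : ℝ → Pt n → Pt n → ℂ)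
    (x : ℝ → Pt n → Pt n) (g : ℝ → Pt n → Pt n → ℝ → ℂ) : Prop :=
  (∃ C : ℝ, ∀ t ∈ Icc 0 T, ∀ y, ∀ z ∈ K, ∀ ε > 0, ‖g t y z ε‖ ≤ C) ∧
  (∀ t ∈ Icc 0 T, ∀ y, ∀ ε > 0, tsupport (fun z => g t y z ε) ⊆ K₀) ∧
  ∃ D > 0, ∃ w > 0, ∀ t ∈ Icc 0 T, ∀ z ∈ K, ∀ ε > 0, ∀ y,
    ‖g t y z ε * Complex.exp (Complex.I * Φ t (y - x t z) z / (ε : ℂ)) * (ρ (y - x t z) : ℂ)‖ ≤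
      D * Real.exp (-w * ‖y - x t z‖ ^ 2 / ε)

def P8 {n : ℕ} (T : ℝ) (K : Set (Pt n)) (ρ : Pt n → ℝ) (Φ : ℝ → Pt n → Pt n → ℂ)
    (x : ℝ → Pt n → Pt n) (g : ℝ → Pt n → Pt n → ℝ → ℂ) : Prop :=
  ∃ D > 0, ∃ w > 0, ∃ q l : ℕ, 2 * l ≤ q ∧
    ∀ t ∈ Icc 0 T, ∀ z ∈ K, ∀ z₀ ∈ K, ∀ ε > 0, ∀ y₀, y₀ = x t z₀ →
      ‖(g t y₀ z ε - g t y₀ z₀ ε) * Complex.exp (Complex.I * Φ t (y₀ - x t z) z / (ε : ℂ)) *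
          (ρ (y₀ - x t z) : ℂ)‖ ≤
        D * ‖z - z₀‖ * (1 + ‖z - z₀‖ ^ q / ε ^ l) * Real.exp (-w * ‖y₀ - x t z‖ ^ 2 / ε)

/-- The representation of `u_{k+p} - u_k` by oscillatory integrals, for superpositions of the modes
`b`. The `j`-th integral uses the phase of order `m j ∈ {k, k + p}` and the ray of the mode `s j`.
The set `K_d` is `Metric.cthickening d K₀`. -/
def DiffRep {n : ℕ} {ι : Type} [Fintype ι] (b : ι → Coeffs n) (K₀ : Set (Pt n)) (η : ℝ≥0∞)
    (ρ : Pt n → ℝ) (k p : ℕ) : Prop :=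
  ∃ (J : ℕ) (s : Fin (J + 1) → ι) (m : Fin (J + 1) → ℕ) (ℓ : Fin (J + 1) → ℝ)
    (β : Fin (J + 1) → MIdx n) (g : Fin (J + 1) → ℝ → Pt n → Pt n → ℝ → ℂ),
    (∀ j, m j = k ∨ m j = k + p) ∧
    (∀ j, 0 ≤ ℓ j ∧ ∃ N : ℕ, ℓ j = (N : ℝ) / 2) ∧
    (∀ j, ℓ j = 0 → (Even (β j).degree ↔ Even k)) ∧
    (∀ j, ContinuousOn
      (fun r : ℝ × Pt n × Pt n × ℝ => g j r.1 r.2.1 r.2.2.1 r.2.2.2)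
      (Ici 0 ×ˢ univ ×ˢ univ ×ˢ Ioi 0)) ∧
    (∀ ε > 0, ∀ t ≥ 0, ∀ y,
      superposition b K₀ ρ (k + p) ε t y - superposition b K₀ ρ k ε t y =
        ((ε ^ ((k : ℝ) / 2) : ℝ) : ℂ) * ∑ j, ((ε ^ ℓ j : ℝ) : ℂ) *
          oscInt K₀ ρ (β j) ((b (s j)).phase (m j)) (b (s j)).x (g j) ε t y) ∧
    ∀ T > 0, ∀ d > 0,
      (∀ i, Admissible (Metric.cthickening d K₀) T ((b i).phase k) η ∧
        Admissible (Metric.cthickening d K₀) T ((b i).phase (k + p)) η) →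
      ∀ j,
        P1 T (b (s j)).x ∧
        P2 T ((b (s j)).phase (m j)) ∧
        P3 T (Metric.cthickening d K₀) ((b (s j)).phase (m j)) (b (s j)).x ∧
        P4 T (Metric.cthickening d K₀) η ((b (s j)).phase (m j)) ∧
        P6 ((b (s j)).phase (m j)) (b (s j)).x ∧
        P7 T K₀ (Metric.cthickening d K₀) ρ ((b (s j)).phase (m j)) (b (s j)).x (g j) ∧
        P8 T (Metric.cthickening d K₀) ρ ((b (s j)).phase (m j)) (b (s j)).x (g j)

end GaussianBeam

end

/-! The representation comes from subtracting beams ray by ray. Write `Φ_{k+p} = Φ_k + R`, where `R`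
(`Coeffs.phaseRest`) contains only monomials of degree at least `k + 2`, and put `w = iR/ε`. Then
`A_{k+p} e^{iΦ_{k+p}/ε} - A_k e^{iΦ_k/ε} = (A_{k+p} - A_k) e^{iΦ_{k+p}/ε} + A_k (e^w - 1)
e^{iΦ_k/ε}`. In both parts a monomial `y^β` with a factor `ε^r` is worth `ε^{r + |β|/2}` after the
normalization of the oscillatory integrals. The terms `ε^j y^β` of `A_{k+p} - A_k` have `2j + |β| ≥
k`, and `R/ε` has terms with `|β| - 2 ≥ k`, so `ε^{k/2}` comes out in front with a remaining
exponent `N/2`, `N ≥ 0`. Since `2r + |β| = k + N`, the case `N = 0` forces the parity of `|β|`.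

The delicate point is the factor `(e^w - 1)/w`, which is unbounded, while (P7) asks for a bounded
`g`. It is split as `h₁(w) + h₂(w) e^w` with `h₁, h₂` bounded (`expWeight_add`). The first piece is
carried by `e^{iΦ_k/ε}`, and the second by `e^w e^{iΦ_k/ε} = e^{iΦ_{k+p}/ε}`; this is why both
phases occur. Because `h₁, h₂` are Lipschitz at `0` and `R` is cubic, `g` at `y₀ = x(t,z₀)` differs
from its value at `z = z₀` by `O(|z - z₀| + |z - z₀|³/ε)`, which is (P8) with `q = 2`, `ℓ = 1`
(`p8_oscWeight`). Admissibility of the cutoff width supplies the Gaussian decay.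

The remaining analysis shows that the coefficients are smooth in `(t, z)` and that the amplitudes
vanish for `z` outside `K₀` (`IsRegularMode`). The equations only prescribe them ray by ray, so
smoothness in `z` is derived from smooth dependence of solutions of differential equations on
parameters (`IsSolutionFamily.contDiffOn`). The formal equations become finite systems degree by
degree: on the ray the terms that would involve coefficients of the next degree cancel, precisely
because the ray moves with the group velocity (`IsTransport`, `IsEikonal`).

The lower bound in (P3) expresses that the Hamiltonian flow is injective with a quantitative bound,
by a backward Grönwall estimate. The relation in (P6) holds at `t = 0` and is conserved along rays.
-/

noncomputable section

namespace GaussianBeam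

open Filter Topology

/-! ### Linear differential equations -/

section LinearODE

variable {X : Type*} [NormedAddCommGroup X] [NormedSpace ℝ X]

/-- The Picard map of the linear equation `w' = G + A w`, `w(0) = w₀`, on `[0, T]`. -/
def linearPicard {T : ℝ} (hT : 0 ≤ T) (A : ℝ → X →L[ℝ] X) (G : ℝ → X) (hA : Continuous A)
    (hG : Continuous G) (w₀ : X) (v : C(Icc (0 : ℝ) T, X)) : C(Icc (0 : ℝ) T, X) where
  toFun t := w₀ + ∫ s in (0 : ℝ)..t, (G s + A s (v (projIcc 0 T hT s)))
  continuous_toFun := by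
    have hc : Continuous fun s => G s + A s (v (projIcc 0 T hT s)) :=
      hG.add (hA.clm_apply (v.continuous.comp continuous_projIcc))
    exact continuous_const.add ((intervalIntegral.continuous_primitive
      (fun a b => hc.intervalIntegrable a b) 0).comp continuous_subtype_val)

/-- Each application of the map integrates the previous bound once, and the `m` nested integrals
produce `1/m!`. Thus a high iterate contracts on all of `[0, T]`, without smallness of `T`. -/
lemma norm_iterate_linearPicard_sub_le {T : ℝ} (hT : 0 ≤ T) (A : ℝ → X →L[ℝ] X) (G : ℝ → X)
    (hA : Continuous A) (hG : Continuous G) (w₀ : X) {a : ℝ} (ha : ∀ t ∈ Icc 0 T, ‖A t‖ ≤ a)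
    (v w : C(Icc (0 : ℝ) T, X)) (m : ℕ) (t : Icc (0 : ℝ) T) :
    ‖((linearPicard hT A G hA hG w₀)^[m] v) t - ((linearPicard hT A G hA hG w₀)^[m] w) t‖ ≤
      (a * t) ^ m / m.factorial * ‖v - w‖ := by
  have ha0 : 0 ≤ a := (norm_nonneg _).trans (ha 0 ⟨le_rfl, hT⟩)
  induction m generalizing t with
  | zero => simpa using (v - w).norm_coe_le_norm t
  | succ m ih =>
    rw [Function.iterate_succ_apply', Function.iterate_succ_apply']
    set v' := (linearPicard hT A G hA hG w₀)^[m] v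
    set w' := (linearPicard hT A G hA hG w₀)^[m] w
    have hc : ∀ u : C(Icc (0 : ℝ) T, X), Continuous fun s => G s + A s (u (projIcc 0 T hT s)) :=
      fun u => hG.add (hA.clm_apply (u.continuous.comp continuous_projIcc))
    simp only [linearPicard, ContinuousMap.coe_mk, add_sub_add_left_eq_sub]
    rw [← intervalIntegral.integral_sub ((hc v').intervalIntegrable _ _)
      ((hc w').intervalIntegrable _ _)]
    have hb : ∀ᵐ s, s ∈ Set.Ioc (0 : ℝ) t →
        ‖G s + A s (v' (projIcc 0 T hT s)) - (G s + A s (w' (projIcc 0 T hT s)))‖ ≤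
          a * ((a * s) ^ m / m.factorial * ‖v - w‖) := by
      refine Eventually.of_forall fun s hs => ?_
      have hsT : s ∈ Icc 0 T := ⟨hs.1.le, hs.2.trans t.2.2⟩
      rw [add_sub_add_left_eq_sub, ← map_sub]
      refine ((A s).le_opNorm _).trans ?_
      refine mul_le_mul (ha s hsT) ?_ (norm_nonneg _) ha0
      have := ih (projIcc 0 T hT s)
      rwa [projIcc_of_mem hT hsT] at this ⊢
    refine (intervalIntegral.norm_integral_le_of_norm_le t.2.1 hb
      (by apply Continuous.intervalIntegrable; fun_prop)).trans (le_of_eq ?_)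
    have : ∀ s : ℝ, a * ((a * s) ^ m / m.factorial * ‖v - w‖) =
        (a ^ (m + 1) / m.factorial * ‖v - w‖) * s ^ m := fun s => by ring
    simp only [this, intervalIntegral.integral_const_mul, integral_pow, Nat.factorial_succ]
    push_cast
    field_simp
    ring

theorem exists_hasDerivWithinAt_linear_of_continuous [CompleteSpace X] {T : ℝ} (hT : 0 ≤ T) (A : ℝ → X →L[ℝ] X)
    (G : ℝ → X) (hA : Continuous A) (hG : Continuous G) (w₀ : X) :
    ∃ w : ℝ → X, w 0 = w₀ ∧
      ∀ t ∈ Icc 0 T, HasDerivWithinAt w (G t + A t (w t)) (Icc 0 T) t := by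
  obtain ⟨a, ha⟩ := isCompact_Icc.exists_bound_of_continuousOn (s := Icc 0 T) hA.continuousOn
  have ha0 : 0 ≤ a := (norm_nonneg _).trans (ha 0 ⟨le_rfl, hT⟩)
  set Γ := linearPicard hT A G hA hG w₀ with hΓ
  obtain ⟨m, hm⟩ : ∃ m : ℕ, (a * T) ^ m / m.factorial < 1 :=
    ((FloorSemiring.tendsto_pow_div_factorial_atTop (a * T)).eventually
      (gt_mem_nhds zero_lt_one)).exists
  have hq : 0 ≤ (a * T) ^ m / m.factorial := by positivity
  have hcon : ContractingWith ⟨(a * T) ^ m / m.factorial, hq⟩ Γ^[m] := by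
    refine ⟨by exact_mod_cast hm, LipschitzWith.of_dist_le_mul fun v w => ?_⟩
    change dist (Γ^[m] v) (Γ^[m] w) ≤ (a * T) ^ m / m.factorial * dist v w
    rw [dist_eq_norm, ContinuousMap.norm_le _ (mul_nonneg hq dist_nonneg)]
    intro t
    refine (norm_iterate_linearPicard_sub_le hT A G hA hG w₀ ha v w m t).trans ?_
    rw [dist_eq_norm]
    refine mul_le_mul_of_nonneg_right ?_ (norm_nonneg _)
    have := t.2.1
    have := t.2.2
    gcongr
  -- The fixed point of the contracting iterate is unique, so the Picard map itself fixes it.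
  have hfix := hcon.isFixedPt_fixedPoint_iterate
  set v := ContractingWith.fixedPoint (Γ^[m]) hcon
  have hc : Continuous fun s => G s + A s (v (projIcc 0 T hT s)) :=
    hG.add (hA.clm_apply (v.continuous.comp continuous_projIcc))
  refine ⟨fun t => w₀ + ∫ s in (0 : ℝ)..t, (G s + A s (v (projIcc 0 T hT s))), by simp,
    fun t ht => ?_⟩
  have h1 := (((hc.integral_hasStrictDerivAt 0 t).hasDerivAt).const_add w₀).hasDerivWithinAt
    (s := Icc 0 T)
  have h2 : v (projIcc 0 T hT t) = w₀ + ∫ s in (0 : ℝ)..t, (G s + A s (v (projIcc 0 T hT s))) := by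
    have := congrArg (fun u : C(Icc (0 : ℝ) T, X) => u ⟨t, ht⟩) hfix
    rw [projIcc_of_mem hT ht]
    exact this.symm
  rwa [h2] at h1

/-- Linear differential equations with continuous coefficients have solutions on the whole
interval. -/
theorem exists_hasDerivWithinAt_linear [CompleteSpace X] {T : ℝ} (hT : 0 ≤ T) (A : ℝ → X →L[ℝ] X)
    (G : ℝ → X) (hA : ContinuousOn A (Icc 0 T)) (hG : ContinuousOn G (Icc 0 T)) (w₀ : X) :
    ∃ w : ℝ → X, w 0 = w₀ ∧
      ∀ t ∈ Icc 0 T, HasDerivWithinAt w (G t + A t (w t)) (Icc 0 T) t := by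
  -- Extending the coefficients by their end values makes them continuous on the whole line.
  obtain ⟨w, hw, hw'⟩ := exists_hasDerivWithinAt_linear_of_continuous hT
    (IccExtend hT (domRestrict (Icc 0 T) A)) (IccExtend hT (domRestrict (Icc 0 T) G))
    (hA.domRestrict.Icc_extend') (hG.domRestrict.Icc_extend') w₀
  refine ⟨w, hw, fun t ht => ?_⟩
  have := hw' t ht
  rwa [IccExtend_of_mem hT _ ht, IccExtend_of_mem hT _ ht] at this

end LinearODE

/-! ### Smooth dependence of solutions on parameters -/

section Dependence

variable {Z E : Type} [NormedAddCommGroup Z] [NormedSpace ℝ Z]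
  [NormedAddCommGroup E] [NormedSpace ℝ E]

/-- A differential inequality that only needs to hold below the bound it yields. -/
lemma norm_le_of_norm_deriv_le {v v' : ℝ → E} {T δ L : ℝ} (hδ : 0 < δ) (hL : 0 ≤ L)
    (hv : ∀ t ∈ Icc 0 T, HasDerivWithinAt v (v' t) (Icc 0 T) t) (h0 : ‖v 0‖ ≤ δ)
    (hv' : ∀ t ∈ Icc 0 T, ‖v t‖ ≤ δ * Real.exp ((2 * L + 1) * T) → ‖v' t‖ ≤ L * (δ + ‖v t‖)) :
    ∀ t ∈ Icc 0 T, ‖v t‖ ≤ δ * Real.exp ((2 * L + 1) * T) := by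
  intro t ht
  have hB : ∀ x, HasDerivAt (fun s => δ * Real.exp ((2 * L + 1) * s))
      (δ * (Real.exp ((2 * L + 1) * x) * (2 * L + 1))) x := fun x => by
    have := (((hasDerivAt_id x).const_mul (2 * L + 1)).exp).const_mul δ
    simpa using this
  have hmono : ∀ x ∈ Icc 0 T, δ * Real.exp ((2 * L + 1) * x) ≤ δ * Real.exp ((2 * L + 1) * T) := by
    intro x hx
    have := hx.2
    gcongr
  -- The barrier `B(s) = δ e^{(2L+1)s}` must grow strictly faster than `‖v‖` at a contact point.
  -- There `‖v‖ = B ≥ δ`, so `L(δ + B) ≤ 2LB < (2L + 1)B`. Contacts occur below `B(T)`, hence the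
  -- conditional bound on `v'` is enough.
  refine (image_norm_le_of_norm_deriv_right_lt_deriv_boundary
    (fun x hx => (hv x hx).continuousWithinAt) (f' := v') (a := 0) (b := T)
    (fun x hx => (hv x (Ico_subset_Icc_self hx)).mono_of_mem_nhdsWithin (Icc_mem_nhdsGE_of_mem hx))
    (by simpa using h0) hB (fun x hx hx' => ?_) ht).trans (hmono t ht)
  have hxT := Ico_subset_Icc_self hx
  refine (hv' x hxT (hx'.le.trans (hmono x hxT))).trans_lt ?_
  rw [hx']
  have h1 : 1 ≤ Real.exp ((2 * L + 1) * x) := Real.one_le_exp (mul_nonneg (by linarith) hx.1)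
  have h2 : 0 < δ * Real.exp ((2 * L + 1) * x) := by positivity
  have h3 : δ ≤ δ * Real.exp ((2 * L + 1) * x) := le_mul_of_one_le_right hδ.le h1
  nlinarith

/-- Continuity gives a radius near each time; compactness of `[0, T]` makes it uniform, so that the
curve has a tube inside `V` on which `H` varies little. -/
lemma exists_uniform_radius {Q G : Type*} [PseudoMetricSpace Q] [PseudoMetricSpace G]
    {V : Set Q} (hV : IsOpen V) {H : ℝ × Q → G} (hH : ContinuousOn H (Ici 0 ×ˢ V)) {T : ℝ}
    {γ : ℝ → Q} (hγ : ContinuousOn γ (Icc 0 T)) (hγV : ∀ t ∈ Icc 0 T, γ t ∈ V) {ε : ℝ}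
    (hε : 0 < ε) :
    ∃ r > 0, ∀ t ∈ Icc 0 T, ∀ q, dist q (γ t) < r →
      q ∈ V ∧ dist (H (t, q)) (H (t, γ t)) < ε := by
  refine isCompact_Icc.induction_on (s := Icc 0 T)
    (p := fun s => ∃ r > 0, ∀ t ∈ s, ∀ q, dist q (γ t) < r →
      q ∈ V ∧ dist (H (t, q)) (H (t, γ t)) < ε) ⟨1, one_pos, by simp⟩
    (fun s s' hs ⟨r, hr, h⟩ => ⟨r, hr, fun t ht => h t (hs ht)⟩)
    (fun s s' ⟨r, hr, h⟩ ⟨r', hr', h'⟩ => ⟨min r r', lt_min hr hr', fun t ht q hq => ?_⟩)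
    (fun t₀ ht₀ => ?_)
  · rcases ht with ht | ht
    · exact h t ht q (hq.trans_le (min_le_left _ _))
    · exact h' t ht q (hq.trans_le (min_le_right _ _))
  · have hc := Metric.continuousWithinAt_iff.1 (hH (t₀, γ t₀) ⟨ht₀.1, hγV t₀ ht₀⟩) (ε / 2)
      (half_pos hε)
    obtain ⟨r₁, hr₁, h₁⟩ := hc
    obtain ⟨r₂, hr₂, h₂⟩ := Metric.isOpen_iff.1 hV _ (hγV t₀ ht₀)
    have hm : 0 < min r₁ r₂ / 2 := half_pos (lt_min hr₁ hr₂)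
    obtain ⟨r₃, hr₃, h₃⟩ := Metric.continuousWithinAt_iff.1 (hγ t₀ ht₀) _ hm
    refine ⟨Icc 0 T ∩ Metric.ball t₀ (min r₃ r₁), inter_mem self_mem_nhdsWithin
      (mem_nhdsWithin_of_mem_nhds (Metric.ball_mem_nhds _ (lt_min hr₃ hr₁))), _, hm, ?_⟩
    rintro t ⟨ht, htb⟩ q hq
    have htb' := lt_min_iff.1 (Metric.mem_ball.1 htb)
    have hγt := h₃ ht htb'.1
    have hq' : dist q (γ t₀) < min r₁ r₂ := by
      have := dist_triangle q (γ t) (γ t₀)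
      linarith
    have hγ' : dist (γ t) (γ t₀) < min r₁ r₂ := by linarith
    have hqV : q ∈ V := h₂ (Metric.mem_ball.2 (hq'.trans_le (min_le_right _ _)))
    have e₁ := h₁ (x := (t, q)) ⟨ht.1, hqV⟩
      (by rw [Prod.dist_eq]; exact max_lt htb'.2 (hq'.trans_le (min_le_left _ _)))
    have e₂ := h₁ (x := (t, γ t)) ⟨ht.1, hγV t ht⟩
      (by rw [Prod.dist_eq]; exact max_lt htb'.2 (hγ'.trans_le (min_le_left _ _)))
    refine ⟨hqV, ?_⟩
    have := dist_triangle_right (H (t, q)) (H (t, γ t)) (H (t₀, γ t₀))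
    linarith

/-- The derivative of a time dependent map on `V` with respect to the space variable. -/
def spaceFDeriv {Q : Type*} [NormedAddCommGroup Q] [NormedSpace ℝ Q] (F : ℝ × Q → E) (V : Set Q)
    (q : ℝ × Q) : Q →L[ℝ] E :=
  (fderivWithin ℝ F (Ici 0 ×ˢ V) q).comp (ContinuousLinearMap.inr ℝ ℝ Q)

section Space

variable {Q : Type*} [NormedAddCommGroup Q] [NormedSpace ℝ Q] {F : ℝ × Q → E} {V : Set Q}

lemma uniqueDiffOn_Ici_prod (hV : IsOpen V) : UniqueDiffOn ℝ (Ici (0 : ℝ) ×ˢ V) :=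
  (uniqueDiffOn_Ici 0).prod hV.uniqueDiffOn

lemma contDiffOn_spaceFDeriv (hV : IsOpen V) (hF : ContDiffOn ℝ ∞ F (Ici 0 ×ˢ V)) :
    ContDiffOn ℝ ∞ (spaceFDeriv F V) (Ici 0 ×ˢ V) :=
  (hF.fderivWithin (uniqueDiffOn_Ici_prod hV) (by simp)).clm_comp contDiffOn_const

lemma hasFDerivAt_spaceFDeriv (hV : IsOpen V) (hF : ContDiffOn ℝ ∞ F (Ici 0 ×ˢ V)) {t : ℝ}
    (ht : 0 ≤ t) {q : Q} (hq : q ∈ V) :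
    HasFDerivAt (fun q => F (t, q)) (spaceFDeriv F V (t, q)) q := by
  have h1 := (hF.differentiableOn (by simp) (t, q) ⟨ht, hq⟩).hasFDerivWithinAt
  have h2 : HasFDerivWithinAt (fun q : Q => (t, q)) (ContinuousLinearMap.inr ℝ ℝ Q) V q :=
    (hasFDerivAt_prodMk_right t q).hasFDerivWithinAt
  exact (h1.comp q h2 (fun q' hq' => ⟨ht, hq'⟩)).hasFDerivAt (hV.mem_nhds hq)

/-- Mean value inequality on the balls of the tube, on which the space derivative stays within `ε`
of its value at the centre. -/
lemma exists_uniform_linearization (hV : IsOpen V) (hF : ContDiffOn ℝ ∞ F (Ici 0 ×ˢ V))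
    {T : ℝ} {γ : ℝ → Q} (hγ : ContinuousOn γ (Icc 0 T)) (hγV : ∀ t ∈ Icc 0 T, γ t ∈ V) {ε : ℝ}
    (hε : 0 < ε) :
    ∃ r > 0, ∀ t ∈ Icc 0 T, ∀ q, ‖q - γ t‖ < r →
      ‖F (t, q) - F (t, γ t) - spaceFDeriv F V (t, γ t) (q - γ t)‖ ≤ ε * ‖q - γ t‖ := by
  obtain ⟨r, hr, h⟩ := exists_uniform_radius hV (contDiffOn_spaceFDeriv hV hF).continuousOn hγ hγV hε
  refine ⟨r, hr, fun t ht q hq => ?_⟩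
  refine (convex_ball (γ t) r).norm_image_sub_le_of_norm_hasFDerivWithin_le'
    (f := fun q => F (t, q)) (f' := fun q => spaceFDeriv F V (t, q))
    (fun x hx => (hasFDerivAt_spaceFDeriv hV hF ht.1 (h t ht x hx).1).hasFDerivWithinAt)
    (fun x hx => ?_) (Metric.mem_ball_self hr) (mem_ball_iff_norm.2 hq)
  rw [← dist_eq_norm]
  exact (h t ht x hx).2.le

end Space

variable {F : ℝ × Z × E → E} {U : Set E}

/-- The second solution is not assumed to stay in `U`, where alone the field is controlled. This is
harmless: the Grönwall bound only needs the derivative estimate as long as the bound itself holds,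
and for small `δ` the bound keeps the solution in the tube around `y₀`. -/
lemma exists_stability_bound (hU : IsOpen U) (hF : ContDiffOn ℝ ∞ F (Ici 0 ×ˢ (univ ×ˢ U)))
    {T : ℝ} {z₀ : Z} {y₀ : ℝ → E}
    (hy₀ : ∀ t ∈ Icc 0 T, HasDerivWithinAt y₀ (F (t, z₀, y₀ t)) (Icc 0 T) t)
    (hmem : ∀ t ∈ Icc 0 T, y₀ t ∈ U) :
    ∃ C > 0, ∃ r > 0, ∀ (ζ : Z) (y₁ : ℝ → E),
      (∀ t ∈ Icc 0 T, HasDerivWithinAt y₁ (F (t, ζ, y₁ t)) (Icc 0 T) t) →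
      ∀ δ, 0 < δ → δ ≤ r → ‖ζ - z₀‖ ≤ δ → ‖y₁ 0 - y₀ 0‖ ≤ δ →
        ∀ t ∈ Icc 0 T, ‖y₁ t - y₀ t‖ ≤ C * δ := by
  have hV : IsOpen ((univ : Set Z) ×ˢ U) := isOpen_univ.prod hU
  have hγ : ContinuousOn (fun t => (z₀, y₀ t)) (Icc 0 T) :=
    continuousOn_const.prodMk fun t ht => (hy₀ t ht).continuousWithinAt
  have hγV : ∀ t ∈ Icc 0 T, (z₀, y₀ t) ∈ (univ : Set Z) ×ˢ U := fun t ht => ⟨trivial, hmem t ht⟩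
  obtain ⟨r, hr, h⟩ := exists_uniform_linearization hV hF hγ hγV one_pos
  obtain ⟨L, hL⟩ := isCompact_Icc.exists_bound_of_continuousOn (s := Icc 0 T)
    (f := fun t => spaceFDeriv F (univ ×ˢ U) (t, z₀, y₀ t))
    ((contDiffOn_spaceFDeriv hV hF).continuousOn.comp (continuousOn_id.prodMk hγ)
      fun t ht => ⟨ht.1, hγV t ht⟩)
  set K := max L 0 + 1 with hK
  have hK0 : 0 ≤ K := by positivity
  have hLK : L + 1 ≤ K := by simp [hK]
  set C := Real.exp ((2 * K + 1) * T) with hC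
  have hC0 : 0 < C := Real.exp_pos _
  -- The first entry keeps the parameter in the tube of radius `r`; the second gives `C δ ≤ r / 2`,
  -- which keeps the solution there.
  refine ⟨C, hC0, min (r / 2) (r / (2 * C)), by positivity, ?_⟩
  intro ζ y₁ hy₁ δ hδ hδr hζ h0 t ht
  rw [mul_comm]
  refine norm_le_of_norm_deriv_le (v := fun t => y₁ t - y₀ t) hδ hK0
    (fun s hs => (hy₁ s hs).sub (hy₀ s hs)) h0 (fun s hs hsB => ?_) t ht
  have hq : ‖(ζ, y₁ s) - (z₀, y₀ s)‖ ≤ δ + ‖y₁ s - y₀ s‖ := by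
    rw [Prod.mk_sub_mk, Prod.norm_mk]
    exact max_le (by linarith [norm_nonneg (y₁ s - y₀ s)]) (by linarith)
  have hq' : ‖(ζ, y₁ s) - (z₀, y₀ s)‖ < r := by
    rw [Prod.mk_sub_mk, Prod.norm_mk]
    refine max_lt ?_ ?_
    · have := hδr.trans (min_le_left _ _)
      linarith
    · have h3 : δ * C ≤ r / 2 := by
        have := mul_le_mul_of_nonneg_right (hδr.trans (min_le_right _ _)) hC0.le
        rwa [div_mul_eq_mul_div, mul_div_mul_right _ _ hC0.ne'] at this
      exact (hsB.trans h3).trans_lt (half_lt_self hr)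
  have h1 := h s hs _ hq'
  have h2 : ‖spaceFDeriv F (univ ×ˢ U) (s, z₀, y₀ s) ((ζ, y₁ s) - (z₀, y₀ s))‖ ≤
      L * ‖(ζ, y₁ s) - (z₀, y₀ s)‖ :=
    (ContinuousLinearMap.le_opNorm _ _).trans
      (mul_le_mul_of_nonneg_right (hL s hs) (norm_nonneg _))
  calc ‖F (s, ζ, y₁ s) - F (s, z₀, y₀ s)‖
      ≤ 1 * ‖(ζ, y₁ s) - (z₀, y₀ s)‖ + L * ‖(ζ, y₁ s) - (z₀, y₀ s)‖ := by
        refine (norm_le_norm_sub_add _ _).trans (add_le_add h1 h2)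
    _ = (L + 1) * ‖(ζ, y₁ s) - (z₀, y₀ s)‖ := by ring
    _ ≤ K * (δ + ‖y₁ s - y₀ s‖) := mul_le_mul hLK hq (norm_nonneg _) hK0

/-- Uniqueness of solutions. -/
lemma eqOn_of_hasDerivWithinAt (hU : IsOpen U) (hF : ContDiffOn ℝ ∞ F (Ici 0 ×ˢ (univ ×ˢ U)))
    {z₀ : Z} {y₀ y₁ : ℝ → E}
    (hy₀ : ∀ t ≥ 0, HasDerivWithinAt y₀ (F (t, z₀, y₀ t)) (Ici 0) t)
    (hmem : ∀ t ≥ 0, y₀ t ∈ U)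
    (hy₁ : ∀ t ≥ 0, HasDerivWithinAt y₁ (F (t, z₀, y₁ t)) (Ici 0) t)
    (h0 : y₁ 0 = y₀ 0) : ∀ t ≥ 0, y₁ t = y₀ t := by
  intro T hT
  obtain ⟨C, hC, r, hr, h⟩ := exists_stability_bound hU hF (T := T) (z₀ := z₀) (y₀ := y₀)
    (fun t ht => (hy₀ t ht.1).mono Icc_subset_Ici_self) (fun t ht => hmem t ht.1)
  -- Parameter and initial value coincide, so the stability estimate applies with every small `δ`.
  have h1 : ∀ δ, 0 < δ → δ ≤ r → ‖y₁ T - y₀ T‖ ≤ C * δ := fun δ hδ hδr =>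
    h z₀ y₁ (fun t ht => (hy₁ t ht.1).mono Icc_subset_Ici_self) δ hδ hδr (by simpa using hδ.le)
      (by simpa [h0] using hδ.le) T ⟨hT, le_rfl⟩
  have h2 : ‖y₁ T - y₀ T‖ ≤ 0 := by
    refine le_of_forall_pos_le_add fun ε hε => ?_
    refine (h1 (min r (ε / C)) (by positivity) (min_le_left _ _)).trans ?_
    rw [zero_add]
    calc C * min r (ε / C) ≤ C * (ε / C) := by gcongr; exact min_le_right _ _
      _ = ε := by field_simp
  exact sub_eq_zero.1 (norm_le_zero_iff.1 h2)

/-- `y t z` solves `∂_t y = F (t, z, y)` for `t ≥ 0`, with values in the open set `U`, and depends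
smoothly on `z` at `t = 0`. -/
structure IsSolutionFamily (F : ℝ × Z × E → E) (U : Set E) (y : ℝ → Z → E) : Prop where
  isOpen : IsOpen U
  smooth : ContDiffOn ℝ ∞ F (Ici 0 ×ˢ (univ ×ˢ U))
  mem : ∀ t ≥ 0, ∀ z, y t z ∈ U
  deriv : ∀ z, ∀ t ≥ 0, HasDerivWithinAt (fun s => y s z) (F (t, z, y t z)) (Ici 0) t
  initial : ContDiff ℝ ∞ (y 0)

namespace IsSolutionFamily

variable {y : ℝ → Z → E}

lemma isOpen_space (h : IsSolutionFamily F U y) : IsOpen ((univ : Set Z) ×ˢ U) :=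
  isOpen_univ.prod h.isOpen

lemma exists_lipschitz (h : IsSolutionFamily F U y) (T : ℝ) (z₀ : Z) :
    ∃ C > 0, ∀ᶠ ζ in 𝓝 z₀, ∀ t ∈ Icc 0 T, ‖y t ζ - y t z₀‖ ≤ C * ‖ζ - z₀‖ := by
  obtain ⟨C, hC, r, hr, hs⟩ := exists_stability_bound h.isOpen h.smooth (T := T) (z₀ := z₀)
    (y₀ := fun t => y t z₀) (fun t ht => (h.deriv z₀ t ht.1).mono Icc_subset_Ici_self)
    (fun t ht => h.mem t ht.1 z₀)
  obtain ⟨K, s, hs', hK⟩ := (h.initial.contDiffAt (x := z₀)).of_le (m := 1) (by simp)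
    |>.exists_lipschitzOnWith
  -- With `D = K + 1`, the quantity `D ‖ζ - z₀‖` bounds both the change of the parameter and the
  -- change of the initial value.
  set D := (K : ℝ) + 1
  have hD : 0 < D := by positivity
  refine ⟨C * D, by positivity, ?_⟩
  filter_upwards [hs', Metric.ball_mem_nhds z₀ (div_pos hr hD)] with ζ hζ hζ' t ht
  rcases eq_or_ne ζ z₀ with rfl | hne
  · simp
  have hpos : 0 < ‖ζ - z₀‖ := norm_pos_iff.2 (sub_ne_zero.2 hne)
  rw [mul_assoc]
  refine hs ζ (fun t => y t ζ) (fun t ht => (h.deriv ζ t ht.1).mono Icc_subset_Ici_self)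
    (D * ‖ζ - z₀‖) (by positivity) ?_ ?_ ?_ t ht
  · rw [mem_ball_iff_norm, lt_div_iff₀ hD] at hζ'
    linarith
  · exact le_mul_of_one_le_left hpos.le (by simp [D])
  · have := hK.norm_sub_le hζ (mem_of_mem_nhds hs')
    simp only [D]
    nlinarith

/-- The variational equation. -/
lemma exists_variation [CompleteSpace E] (h : IsSolutionFamily F U y) {T : ℝ} (hT : 0 ≤ T)
    (z₀ : Z) :
    ∃ W : ℝ → Z →L[ℝ] E, ∀ t ∈ Icc 0 T, HasFDerivAt (y t) (W t) z₀ ∧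
      HasDerivWithinAt W ((spaceFDeriv F (univ ×ˢ U) (t, z₀, y t z₀)).comp
        ((ContinuousLinearMap.id ℝ Z).prod (W t))) (Icc 0 T) t := by
  have hV := h.isOpen_space
  have hγ : ContinuousOn (fun t => (z₀, y t z₀)) (Icc 0 T) :=
    continuousOn_const.prodMk fun t ht =>
      ((h.deriv z₀ t ht.1).mono Icc_subset_Ici_self).continuousWithinAt
  have hγV : ∀ t ∈ Icc 0 T, (z₀, y t z₀) ∈ (univ : Set Z) ×ˢ U := fun t ht =>
    ⟨trivial, h.mem t ht.1 z₀⟩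
  set A : ℝ → Z × E →L[ℝ] E := fun t => spaceFDeriv F (univ ×ˢ U) (t, z₀, y t z₀) with hA
  have hAc : ContinuousOn A (Icc 0 T) :=
    (contDiffOn_spaceFDeriv hV h.smooth).continuousOn.comp (continuousOn_id.prodMk hγ)
      fun t ht => ⟨ht.1, hγV t ht⟩
  -- The candidate for `D_z y` is the solution of the variational equation; splitting `A t` into its
  -- `z` and `y` parts gives the inhomogeneous linear form.
  obtain ⟨W, hW0, hW⟩ := exists_hasDerivWithinAt_linear hT
    (fun t => ContinuousLinearMap.compL ℝ Z E E ((A t).comp (ContinuousLinearMap.inr ℝ Z E)))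
    (fun t => (A t).comp (ContinuousLinearMap.inl ℝ Z E))
    ((ContinuousLinearMap.compL ℝ Z E E).continuous.comp_continuousOn
      (hAc.clm_comp continuousOn_const))
    (hAc.clm_comp continuousOn_const) (fderiv ℝ (y 0) z₀)
  have hW' : ∀ t ∈ Icc 0 T, HasDerivWithinAt W ((A t).comp
      ((ContinuousLinearMap.id ℝ Z).prod (W t))) (Icc 0 T) t := fun t ht => by
    have hs : (A t).comp ((ContinuousLinearMap.id ℝ Z).prod (W t)) =
        (A t).comp (ContinuousLinearMap.inl ℝ Z E) +
          ContinuousLinearMap.compL ℝ Z E E ((A t).comp (ContinuousLinearMap.inr ℝ Z E)) (W t) := by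
      ext ζ
      simp [← map_add]
    rw [hs]
    exact hW t ht
  refine ⟨W, fun t ht => ⟨?_, hW' t ht⟩⟩
  obtain ⟨L, hL⟩ := isCompact_Icc.exists_bound_of_continuousOn hAc
  obtain ⟨C, hC, hlip⟩ := h.exists_lipschitz T z₀
  set K := max L 0 + 1 with hK
  have hK0 : 0 ≤ K := by positivity
  have hLK : L ≤ K := by linarith [le_max_left L 0]
  have hK1 : 1 ≤ K := by linarith [le_max_right L 0]
  set M := Real.exp ((2 * K + 1) * T) with hM
  have hM0 : 0 < M := Real.exp_pos _
  rw [hasFDerivAt_iff_isLittleO, Asymptotics.isLittleO_iff]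
  intro ε hε
  have hε' : 0 < ε / M := by positivity
  -- The factor `M` is the growth allowed by the differential inequality, and `C + 1` bounds the
  -- distance of `(ζ, y s ζ)` from `(z₀, y s z₀)` in terms of `‖ζ - z₀‖`.
  obtain ⟨r, hr, hlin⟩ := exists_uniform_linearization hV h.smooth hγ hγV
    (ε := ε / M / (C + 1)) (by positivity)
  have h_initial := (hasFDerivAt_iff_isLittleO.1
    (h.initial.differentiable (by simp) z₀).hasFDerivAt).def hε'
  filter_upwards [h_initial, hlip, Metric.ball_mem_nhds z₀ (div_pos hr (by positivity : 0 < C + 1))]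
    with ζ hζ hζl hζb
  rcases eq_or_ne ζ z₀ with rfl | hne
  · simp
  have hpos : 0 < ‖ζ - z₀‖ := norm_pos_iff.2 (sub_ne_zero.2 hne)
  have hδ : 0 < ε / M * ‖ζ - z₀‖ := by positivity
  have hfin : ε / M * ‖ζ - z₀‖ * M = ε * ‖ζ - z₀‖ := by field_simp
  rw [← hfin]
  have hq : ∀ s ∈ Icc 0 T, ‖(ζ, y s ζ) - (z₀, y s z₀)‖ ≤ (C + 1) * ‖ζ - z₀‖ := by
    intro s hs
    rw [Prod.mk_sub_mk, Prod.norm_mk]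
    exact max_le (by nlinarith) (by linarith [hζl s hs])
  -- The Taylor remainder satisfies the linearized equation up to an error of size `(ε / M) ‖ζ -
  -- z₀‖`, and it is that small at time `0`.
  refine norm_le_of_norm_deriv_le (v := fun t => y t ζ - y t z₀ - W t (ζ - z₀)) hδ hK0
    (fun s hs => (((h.deriv ζ s hs.1).mono Icc_subset_Ici_self).sub
      ((h.deriv z₀ s hs.1).mono Icc_subset_Ici_self)).sub
        ((hW' s hs).clm_apply (hasDerivWithinAt_const s _ (ζ - z₀))))
    (by simpa [hW0] using hζ) (fun s hs _ => ?_) t ht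
  have hqr : ‖(ζ, y s ζ) - (z₀, y s z₀)‖ < r := by
    rw [mem_ball_iff_norm, lt_div_iff₀ (by positivity)] at hζb
    exact (hq s hs).trans_lt (by linarith)
  have h1 := hlin s hs _ hqr
  have h2 : ‖A s (0, y s ζ - y s z₀ - W s (ζ - z₀))‖ ≤ L * ‖y s ζ - y s z₀ - W s (ζ - z₀)‖ := by
    refine ((A s).le_opNorm _).trans (mul_le_mul (hL s hs) (by simp) (norm_nonneg _)
      ((norm_nonneg _).trans (hL s hs)))
  have heq : F (s, ζ, y s ζ) - F (s, z₀, y s z₀) -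
      (((A s).comp ((ContinuousLinearMap.id ℝ Z).prod (W s))) (ζ - z₀) + W s 0) =
      (F (s, ζ, y s ζ) - F (s, z₀, y s z₀) - A s ((ζ, y s ζ) - (z₀, y s z₀))) +
        A s (0, y s ζ - y s z₀ - W s (ζ - z₀)) := by
    have : (ζ, y s ζ) - (z₀, y s z₀) = (ζ - z₀, W s (ζ - z₀)) +
        (0, y s ζ - y s z₀ - W s (ζ - z₀)) := by simp
    rw [this, map_add]
    simp only [ContinuousLinearMap.comp_apply, ContinuousLinearMap.prod_apply,
      ContinuousLinearMap.id_apply, map_zero, add_zero]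
    abel
  rw [heq]
  have h3 : ε / M / (C + 1) * ‖(ζ, y s ζ) - (z₀, y s z₀)‖ ≤ ε / M * ‖ζ - z₀‖ := by
    calc ε / M / (C + 1) * ‖(ζ, y s ζ) - (z₀, y s z₀)‖
        ≤ ε / M / (C + 1) * ((C + 1) * ‖ζ - z₀‖) := by gcongr; exact hq s hs
      _ = ε / M * ‖ζ - z₀‖ := by field_simp
  calc _ ≤ ε / M * ‖ζ - z₀‖ + L * ‖y s ζ - y s z₀ - W s (ζ - z₀)‖ :=
        (norm_add_le _ _).trans (add_le_add (h1.trans h3) h2)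
    _ ≤ K * (ε / M * ‖ζ - z₀‖ + ‖y s ζ - y s z₀ - W s (ζ - z₀)‖) := by
        rw [mul_add]
        exact add_le_add (le_mul_of_one_le_left hδ.le hK1)
          (mul_le_mul_of_nonneg_right hLK (norm_nonneg _))

lemma differentiableAt [CompleteSpace E] (h : IsSolutionFamily F U y) {t : ℝ} (ht : 0 ≤ t)
    (z : Z) : DifferentiableAt ℝ (y t) z := by
  obtain ⟨W, hW⟩ := h.exists_variation ht z
  exact (hW t ⟨ht, le_rfl⟩).1.differentiableAt

lemma hasDerivWithinAt_fderiv [CompleteSpace E] (h : IsSolutionFamily F U y) {t : ℝ} (ht : 0 ≤ t)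
    (z : Z) : HasDerivWithinAt (fun s => fderiv ℝ (y s) z)
      ((spaceFDeriv F (univ ×ˢ U) (t, z, y t z)).comp
        ((ContinuousLinearMap.id ℝ Z).prod (fderiv ℝ (y t) z))) (Ici 0) t := by
  -- The interval is prolonged to `t + 1` so that it is a neighbourhood of `t` within `[0, ∞)`.
  obtain ⟨W, hW⟩ := h.exists_variation (by linarith : (0 : ℝ) ≤ t + 1) z
  have htm : t ∈ Icc 0 (t + 1) := ⟨ht, by linarith⟩
  have h1 : HasDerivWithinAt W _ (Ici 0) t := (hW t htm).2.mono_of_mem_nhdsWithin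
    (by
      rw [← Ici_inter_Iic]
      exact inter_mem_nhdsWithin _ (Iic_mem_nhds (by linarith)))
  rw [(hW t htm).1.fderiv]
  refine h1.congr_of_eventuallyEq ?_ (hW t htm).1.fderiv
  filter_upwards [self_mem_nhdsWithin, mem_nhdsWithin_of_mem_nhds
    (Iic_mem_nhds (by linarith : t < t + 1))] with s hs hs'
  exact (hW s ⟨hs, hs'⟩).1.fderiv

lemma continuousOn (h : IsSolutionFamily F U y) :
    ContinuousOn (fun q : ℝ × Z => y q.1 q.2) (Ici 0 ×ˢ univ) := by
  rintro ⟨t, z⟩ ⟨ht, -⟩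
  obtain ⟨C, hC, hlip⟩ := h.exists_lipschitz (t + 1) z
  have h1 : Tendsto (fun q : ℝ × Z => y q.1 z) (𝓝[Ici 0 ×ˢ univ] (t, z)) (𝓝 (y t z)) :=
    (h.deriv z t ht).continuousWithinAt.tendsto.comp
      (continuous_fst.continuousWithinAt.tendsto_nhdsWithin fun q hq => hq.1)
  have h2 : Tendsto (fun q : ℝ × Z => y q.1 q.2 - y q.1 z) (𝓝[Ici 0 ×ˢ univ] (t, z)) (𝓝 0) := by
    refine squeeze_zero_norm' (a := fun q : ℝ × Z => C * ‖q.2 - z‖) ?_ ?_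
    · have e1 : ∀ᶠ q : ℝ × Z in 𝓝[Ici 0 ×ˢ univ] (t, z), q.1 < t + 1 :=
        mem_nhdsWithin_of_mem_nhds (continuous_fst.continuousAt.eventually
          (gt_mem_nhds (by simp)))
      have e2 := Filter.Eventually.filter_mono (nhdsWithin_le_nhds (s := Ici (0 : ℝ) ×ˢ (univ : Set Z)))
        ((continuous_snd.tendsto (t, z)).eventually hlip)
      filter_upwards [e1, e2, self_mem_nhdsWithin] with q h1 h2 h3
      exact h2 q.1 ⟨h3.1, h1.le⟩
    · have : Continuous fun q : ℝ × Z => C * ‖q.2 - z‖ := by fun_prop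
      simpa using (this.tendsto (t, z)).mono_left nhdsWithin_le_nhds
  have h3 := h2.add h1
  simp only [sub_add_cancel, zero_add] at h3
  exact h3

/-- The increment is split into a move in time at fixed `ζ` and a move in the parameter at fixed
`t`. The time derivative `F (τ, ζ, y τ ζ)` is jointly continuous, so the mean value inequality
handles the first; the second is differentiability of `y t` at `z`. -/
lemma hasFDerivWithinAt [CompleteSpace E] (h : IsSolutionFamily F U y) {t : ℝ} (ht : 0 ≤ t)
    (z : Z) : HasFDerivWithinAt (fun q : ℝ × Z => y q.1 q.2)
      ((ContinuousLinearMap.toSpanSingleton ℝ (F (t, z, y t z))).coprod (fderiv ℝ (y t) z))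
      (Ici 0 ×ˢ univ) (t, z) := by
  have hc : ContinuousOn (fun q : ℝ × Z => F (q.1, q.2, y q.1 q.2)) (Ici 0 ×ˢ univ) :=
    h.smooth.continuousOn.comp
      (continuous_fst.continuousOn.prodMk (continuous_snd.continuousOn.prodMk h.continuousOn))
      fun q hq => ⟨hq.1, trivial, h.mem q.1 hq.1 q.2⟩
  rw [hasFDerivWithinAt_iff_isLittleO, Asymptotics.isLittleO_iff]
  intro ε hε
  have h1 := ((hasFDerivAt_iff_isLittleO.1 (h.differentiableAt ht z).hasFDerivAt).def
    (half_pos hε))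
  have h2 := Metric.continuousWithinAt_iff.1 (hc (t, z) ⟨ht, trivial⟩) (ε / 2) (half_pos hε)
  obtain ⟨r, hr, h2⟩ := h2
  have e2 := Filter.Eventually.filter_mono (nhdsWithin_le_nhds (s := Ici (0 : ℝ) ×ˢ (univ : Set Z)))
    ((continuous_snd.tendsto (t, z)).eventually h1)
  filter_upwards [e2, self_mem_nhdsWithin, mem_nhdsWithin_of_mem_nhds
    (Metric.ball_mem_nhds (t, z) hr)] with ⟨s, ζ⟩ k1 k2 k3
  have k3' := max_lt_iff.1 (by simpa [Prod.dist_eq] using k3 : max (dist s t) (dist ζ z) < r)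
  have hmv : ‖(y s ζ - s • F (t, z, y t z)) - (y t ζ - t • F (t, z, y t z))‖ ≤ ε / 2 * ‖s - t‖ := by
    refine (convex_uIcc t s).norm_image_sub_le_of_norm_hasDerivWithin_le
      (f := fun τ => y τ ζ - τ • F (t, z, y t z))
      (f' := fun τ => F (τ, ζ, y τ ζ) - F (t, z, y t z)) (fun τ hτ => ?_) (fun τ hτ => ?_)
      left_mem_uIcc right_mem_uIcc
    · have hτ0 : uIcc t s ⊆ Ici 0 := fun x hx => (le_min ht k2.1).trans hx.1
      have := ((h.deriv ζ τ (hτ0 hτ)).mono hτ0).sub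
        ((hasDerivWithinAt_id τ (uIcc t s)).smul_const (F (t, z, y t z)))
      rwa [one_smul] at this
    · have hτ0 : 0 ≤ τ := (le_min ht k2.1).trans hτ.1
      rw [← dist_eq_norm]
      refine (h2 (x := (τ, ζ)) ⟨hτ0, trivial⟩ ?_).le
      rw [Prod.dist_eq]
      refine max_lt (lt_of_le_of_lt ?_ k3'.1) k3'.2
      rw [Real.dist_eq, Real.dist_eq]
      exact abs_sub_left_of_mem_uIcc hτ
  have heq : y s ζ - y t z - ((ContinuousLinearMap.toSpanSingleton ℝ (F (t, z, y t z))).coprod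
      (fderiv ℝ (y t) z)) ((s, ζ) - (t, z)) =
      ((y s ζ - s • F (t, z, y t z)) - (y t ζ - t • F (t, z, y t z))) +
        (y t ζ - y t z - fderiv ℝ (y t) z (ζ - z)) := by
    simp [sub_smul]
    abel
  rw [heq]
  have n1 : ‖s - t‖ ≤ ‖(s, ζ) - (t, z)‖ := by
    rw [Prod.mk_sub_mk, Prod.norm_mk]; exact le_max_left _ _
  have n2 : ‖ζ - z‖ ≤ ‖(s, ζ) - (t, z)‖ := by
    rw [Prod.mk_sub_mk, Prod.norm_mk]; exact le_max_right _ _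
  have := (norm_add_le _ _).trans (add_le_add hmv k1)
  nlinarith

/-- The vector field of the equation together with its variational equation. -/
def extendedField (F : ℝ × Z × E → E) (U : Set E) (q : ℝ × Z × (E × (Z →L[ℝ] E))) :
    E × (Z →L[ℝ] E) :=
  (F (q.1, q.2.1, q.2.2.1), (spaceFDeriv F (univ ×ˢ U) (q.1, q.2.1, q.2.2.1)).comp
    ((ContinuousLinearMap.id ℝ Z).prod q.2.2.2))

/-- The pair `(y, D_z y)` is again a solution family with a smooth field. This allows induction on
the order of differentiability. -/
lemma extended [CompleteSpace E] (h : IsSolutionFamily F U y) :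
    IsSolutionFamily (extendedField F U) (U ×ˢ univ) (fun t z => (y t z, fderiv ℝ (y t) z)) where
  isOpen := h.isOpen.prod isOpen_univ
  smooth := by
    have hp : ContDiffOn ℝ ∞ (fun q : ℝ × Z × (E × (Z →L[ℝ] E)) => (q.1, q.2.1, q.2.2.1))
        (Ici 0 ×ˢ (univ ×ˢ (U ×ˢ univ))) := by
      apply ContDiff.contDiffOn; fun_prop
    have hm : MapsTo (fun q : ℝ × Z × (E × (Z →L[ℝ] E)) => (q.1, q.2.1, q.2.2.1))
        (Ici 0 ×ˢ (univ ×ˢ (U ×ˢ univ))) (Ici 0 ×ˢ (univ ×ˢ U)) := fun q hq =>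
      ⟨hq.1, trivial, hq.2.2.1⟩
    refine (h.smooth.comp hp hm).prodMk
      (((contDiffOn_spaceFDeriv h.isOpen_space h.smooth).comp hp hm).clm_comp ?_)
    have hl : ∀ W : Z →L[ℝ] E, (ContinuousLinearMap.id ℝ Z).prod W =
        ContinuousLinearMap.inl ℝ Z E + (ContinuousLinearMap.inr ℝ Z E).comp W := fun W => by
      ext <;> simp
    simp only [hl]
    exact contDiffOn_const.add (contDiffOn_const.clm_comp
      (contDiff_snd.comp (contDiff_snd.comp contDiff_snd)).contDiffOn)
  mem t ht z := ⟨h.mem t ht z, trivial⟩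
  deriv z t ht := (h.deriv z t ht).prodMk (h.hasDerivWithinAt_fderiv ht z)
  initial := h.initial.prodMk (h.initial.fderiv_right (by simp))

end IsSolutionFamily

/-- The total derivative consists of `F (t, z, y)` and `D_z y`. If all solution families are `C^m`,
the first is `C^m` by composition and the second as a component of the extended family. The state
space changes in this step, so the induction quantifies over it. -/
lemma contDiffOn_nat_of_isSolutionFamily (m : ℕ) : ∀ {E : Type} [NormedAddCommGroup E]
    [NormedSpace ℝ E] [CompleteSpace E] {F : ℝ × Z × E → E} {U : Set E} {y : ℝ → Z → E},
    IsSolutionFamily F U y → ContDiffOn ℝ m (fun q : ℝ × Z => y q.1 q.2) (Ici 0 ×ˢ univ) := by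
  induction m with
  | zero =>
    intro E _ _ _ F U y h
    exact contDiffOn_zero.2 h.continuousOn
  | succ m ih =>
    intro E _ _ _ F U y h
    have hy := ih h
    have hW := (ih h.extended).snd
    push_cast
    rw [contDiffOn_succ_iff_hasFDerivWithinAt_of_uniqueDiffOn (uniqueDiffOn_Ici_prod isOpen_univ)]
    refine ⟨by simp, fun q => (ContinuousLinearMap.toSpanSingleton ℝ (F (q.1, q.2, y q.1 q.2))).coprod
      (fderiv ℝ (y q.1) q.2), ?_, fun q hq => h.hasFDerivWithinAt hq.1 q.2⟩
    have hF : ContDiffOn ℝ m (fun q : ℝ × Z => F (q.1, q.2, y q.1 q.2)) (Ici 0 ×ˢ univ) :=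
      (h.smooth.of_le (by exact_mod_cast le_top)).comp
        (contDiff_fst.contDiffOn.prodMk (contDiff_snd.contDiffOn.prodMk hy))
        fun q hq => ⟨hq.1, trivial, h.mem q.1 hq.1 q.2⟩
    have hl : ∀ (v : E) (W : Z →L[ℝ] E),
        (ContinuousLinearMap.toSpanSingleton ℝ v).coprod W =
          ContinuousLinearMap.smulRightL ℝ (ℝ × Z) E (ContinuousLinearMap.fst ℝ ℝ Z) v +
            W.comp (ContinuousLinearMap.snd ℝ ℝ Z) := fun v W => by
      ext <;> simp
    simp only [hl]
    exact ((ContinuousLinearMap.contDiff _).comp_contDiffOn hF).add (hW.clm_comp contDiffOn_const)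

/-- Solutions of differential equations depend smoothly on time and parameters. -/
theorem IsSolutionFamily.contDiffOn [CompleteSpace E] {y : ℝ → Z → E}
    (h : IsSolutionFamily F U y) :
    ContDiffOn ℝ ∞ (fun q : ℝ × Z => y q.1 q.2) (Ici 0 ×ˢ univ) :=
  contDiffOn_infty.2 fun m => contDiffOn_nat_of_isSolutionFamily m h

end Dependence

end GaussianBeam

end

noncomputable section

namespace GaussianBeam

/-! ### Order of vanishing of power series -/

section Vanishing

open MvPowerSeries

variable {n : ℕ}

lemma mem_ofDegree {m : ℕ} {β : MIdx n} : β ∈ ofDegree n m ↔ β.degree = m := by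
  simp [ofDegree, Finset.mem_finsuppAntidiag, Finsupp.degree_eq_sum]

/-- All coefficients of degree less than `m` vanish. -/
def VanishTo (m : ℕ) (S : Series n) : Prop := ∀ β : MIdx n, β.degree < m → coeff β S = 0

namespace VanishTo

variable {m l : ℕ} {S R : Series n}

lemma add (hS : VanishTo m S) (hR : VanishTo m R) : VanishTo m (S + R) := fun β hβ => by
  rw [map_add, hS β hβ, hR β hβ, add_zero]

lemma neg (hS : VanishTo m S) : VanishTo m (-S) := fun β hβ => by
  rw [map_neg, hS β hβ, neg_zero]

lemma sub (hS : VanishTo m S) (hR : VanishTo m R) : VanishTo m (S - R) := by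
  rw [sub_eq_add_neg]; exact hS.add hR.neg

lemma smul (c : ℂ) (hS : VanishTo m S) : VanishTo m (c • S) := fun β hβ => by
  rw [map_smul, hS β hβ, smul_zero]

lemma sum {ι : Type*} {s : Finset ι} {f : ι → Series n} (h : ∀ i ∈ s, VanishTo m (f i)) :
    VanishTo m (∑ i ∈ s, f i) := fun β hβ => by
  rw [map_sum]; exact Finset.sum_eq_zero fun i hi => h i hi β hβ

lemma mul (hS : VanishTo m S) (hR : VanishTo l R) : VanishTo (m + l) (S * R) := fun β hβ => by
  classical
  rw [coeff_mul]
  refine Finset.sum_eq_zero fun x hx => ?_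
  have hd : x.1.degree + x.2.degree = β.degree := by
    rw [← map_add, Finset.HasAntidiagonal.mem_antidiagonal.1 hx]
  rcases lt_or_ge x.1.degree m with h | h
  · rw [hS _ h, zero_mul]
  · rw [hR _ (by omega), mul_zero]

lemma mul_right (hS : VanishTo m S) (R : Series n) : VanishTo m (S * R) :=
  hS.mul (l := 0) fun _ hβ => absurd hβ (Nat.not_lt_zero _)

lemma mul_left (hS : VanishTo m S) (R : Series n) : VanishTo m (R * S) := by
  rw [mul_comm]; exact hS.mul_right R

lemma pderiv (i : Fin n) (hS : VanishTo (m + 1) S) : VanishTo m (pderiv ℂ i S) := fun β hβ => by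
  rw [coeff_pderiv, hS _ (by simp; omega), zero_mul]

/-- In the lowest degree only the constant term of the other factor contributes: `R` minus its
constant term adds one order of vanishing. -/
lemma coeff_mul_of_degree_eq (hS : VanishTo m S) (R : Series n) {β : MIdx n} (hβ : β.degree = m) :
    coeff β (S * R) = coeff β S * constantCoeff R := by
  have h1 : VanishTo 1 (R - C (constantCoeff R)) := fun γ hγ => by
    have : γ = 0 := (Finsupp.degree_eq_zero_iff _).1 (Nat.lt_one_iff.1 hγ)
    subst this
    simp
  have h2 := hS.mul h1 β (by omega)
  rw [mul_sub, map_sub, coeff_mul_C, sub_eq_zero] at h2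
  exact h2

end VanishTo

lemma vanishTo_one {S : Series n} (h : constantCoeff S = 0) : VanishTo 1 S := fun γ hγ => by
  have : γ = 0 := (Finsupp.degree_eq_zero_iff _).1 (Nat.lt_one_iff.1 hγ)
  subst this
  simpa using h

/-- The part of a power series of degree less than `m`. -/
def truncBelow (m : ℕ) (S : Series n) : Series n :=
  fun β => if β.degree < m then coeff β S else 0

lemma coeff_truncBelow (m : ℕ) (S : Series n) (β : MIdx n) :
    coeff β (truncBelow m S) = if β.degree < m then coeff β S else 0 := rfl

/-- The polynomial with the coefficients of `S` in degrees less than `m` and the coefficients `Y`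
in degree `m`. -/
def fillSeries (m : ℕ) (S : Series n) (Y : {β // β ∈ ofDegree n m} → ℂ) : Series n :=
  fun β => if h : β ∈ ofDegree n m then Y ⟨β, h⟩ else if β.degree < m then coeff β S else 0

lemma coeff_fillSeries (m : ℕ) (S : Series n) (Y : {β // β ∈ ofDegree n m} → ℂ) (β : MIdx n) :
    coeff β (fillSeries m S Y) = if h : β ∈ ofDegree n m then Y ⟨β, h⟩ else
      if β.degree < m then coeff β S else 0 := rfl

lemma vanishTo_sub_truncBelow (m : ℕ) (S : Series n) : VanishTo m (S - truncBelow m S) :=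
  fun β hβ => by rw [map_sub, coeff_truncBelow, if_pos hβ, sub_self]

lemma vanishTo_sub_fillSeries (m : ℕ) (S : Series n) :
    VanishTo (m + 1) (S - fillSeries m S fun β => coeff β.1 S) := fun β hβ => by
  rw [map_sub, coeff_fillSeries]
  by_cases h : β ∈ ofDegree n m
  · rw [dif_pos h, sub_self]
  · rw [dif_neg h, if_pos, sub_self]
    rw [mem_ofDegree] at h
    omega

end Vanishing

/-! ### Families of power series with smooth coefficients -/

section SmoothFamily

open MvPowerSeries

variable {n : ℕ} {X : Type*} [NormedAddCommGroup X] [NormedSpace ℝ X]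

/-- The coefficients of the power series `A q` are smooth functions of `q ∈ D`. -/
def SmoothFamily (D : Set X) (A : X → Series n) : Prop :=
  ∀ β : MIdx n, ContDiffOn ℝ ∞ (fun q => coeff β (A q)) D

namespace SmoothFamily

variable {D : Set X} {A B : X → Series n}

lemma congr (hA : SmoothFamily D A) (h : ∀ q ∈ D, B q = A q) : SmoothFamily D B := fun β =>
  (hA β).congr fun q hq => by rw [h q hq]

lemma comp {X' : Type*} [NormedAddCommGroup X'] [NormedSpace ℝ X'] {D' : Set X'} {f : X' → X}
    (hA : SmoothFamily D A) (hf : ContDiffOn ℝ ∞ f D') (hD : MapsTo f D' D) :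
    SmoothFamily D' (fun q => A (f q)) := fun β => (hA β).comp hf hD

lemma const (S : Series n) : SmoothFamily D (fun _ => S) := fun _ => contDiffOn_const

lemma add (hA : SmoothFamily D A) (hB : SmoothFamily D B) : SmoothFamily D (fun q => A q + B q) :=
  fun β => by simpa only [map_add] using (hA β).add (hB β)

lemma sub (hA : SmoothFamily D A) (hB : SmoothFamily D B) : SmoothFamily D (fun q => A q - B q) :=
  fun β => by simpa only [map_sub] using (hA β).sub (hB β)

lemma smul {f : X → ℂ} (hf : ContDiffOn ℝ ∞ f D) (hA : SmoothFamily D A) :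
    SmoothFamily D (fun q => f q • A q) := fun β => by
  simpa only [coeff_smul] using hf.mul (hA β)

lemma sum {ι : Type*} {s : Finset ι} {f : ι → X → Series n} (h : ∀ i ∈ s, SmoothFamily D (f i)) :
    SmoothFamily D (fun q => ∑ i ∈ s, f i q) := fun β => by
  simpa only [map_sum] using ContDiffOn.sum fun i hi => h i hi β

lemma mul (hA : SmoothFamily D A) (hB : SmoothFamily D B) :
    SmoothFamily D (fun q => A q * B q) := fun β => by
  classical
  simp only [coeff_mul]
  exact ContDiffOn.sum fun x _ => (hA x.1).mul (hB x.2)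

lemma pderiv (i : Fin n) (hA : SmoothFamily D A) :
    SmoothFamily D (fun q => MvPowerSeries.pderiv ℂ i (A q)) := fun β => by
  simp only [coeff_pderiv]
  exact (hA _).mul contDiffOn_const

lemma lap (hA : SmoothFamily D A) : SmoothFamily D (fun q => lap (A q)) :=
  sum fun i _ => (hA.pderiv i).pderiv i

lemma gradDot (hA : SmoothFamily D A) (hB : SmoothFamily D B) :
    SmoothFamily D (fun q => gradDot (A q) (B q)) :=
  sum fun i _ => (hA.pderiv i).mul (hB.pderiv i)

lemma constantCoeff (hA : SmoothFamily D A) :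
    ContDiffOn ℝ ∞ (fun q => MvPowerSeries.constantCoeff (A q)) D := by
  simpa only [coeff_zero_eq_constantCoeff_apply] using hA 0

/-- The recursion for the coefficients of an inverse series expresses each one by those of smaller
degree and the inverse of the constant term; hence induction on the degree. -/
lemma inv (hA : SmoothFamily D A) (h0 : ∀ q ∈ D, MvPowerSeries.constantCoeff (A q) ≠ 0) :
    SmoothFamily D (fun q => (A q)⁻¹) := by
  classical
  intro β
  induction hd : β.degree using Nat.strong_induction_on generalizing β with
  | _ d ih =>
    have hcoeff := fun q => coeff_inv β (A q)
    simp only [hcoeff]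
    split_ifs with hβ
    · exact hA.constantCoeff.inv h0
    · refine ((hA.constantCoeff.inv h0).neg).mul (ContDiffOn.sum fun x hx => ?_)
      split_ifs with hx'
      · refine (hA x.1).mul (ih x.2.degree ?_ x.2 rfl)
        obtain ⟨hle, hne⟩ := lt_iff_le_and_ne.1 hx'
        have hsum : x.1.degree + x.2.degree = β.degree := by
          rw [← map_add, Finset.HasAntidiagonal.mem_antidiagonal.1 hx]
        have : x.1.degree ≠ 0 := fun h0 => by
          have h1 : x.1 = 0 := (Finsupp.degree_eq_zero_iff _).1 h0
          have := Finset.HasAntidiagonal.mem_antidiagonal.1 hx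
          rw [h1, zero_add] at this
          exact hne this
        omega
      · exact contDiffOn_const

lemma truncBelow (m : ℕ) (hA : ∀ β : MIdx n, β.degree < m →
    ContDiffOn ℝ ∞ (fun q => coeff β (A q)) D) :
    SmoothFamily D (fun q => truncBelow m (A q)) := fun β => by
  simp only [coeff_truncBelow]
  split_ifs with h
  · exact hA β h
  · exact contDiffOn_const

lemma fillSeries (m : ℕ) (hA : ∀ β : MIdx n, β.degree < m →
    ContDiffOn ℝ ∞ (fun q => coeff β (A q)) D) {Y : X → {β // β ∈ ofDegree n m} → ℂ}
    (hY : ContDiffOn ℝ ∞ Y D) :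
    SmoothFamily D (fun q => fillSeries m (A q) (Y q)) := fun β => by
  simp only [coeff_fillSeries]
  split_ifs with h h'
  · exact contDiffOn_pi.1 hY ⟨β, h⟩
  · exact hA β h'
  · exact contDiffOn_const

end SmoothFamily

end SmoothFamily

/-! ### Smooth functions of time and of the starting point of the ray -/

section RaySmooth

variable {n : ℕ} {G : Type*} [NormedAddCommGroup G] [NormedSpace ℝ G]

/-- `f (t, z)` is smooth on `[0, ∞) × ℝⁿ`. -/
def RaySmooth (f : ℝ → Pt n → G) : Prop :=
  ContDiffOn ℝ ∞ (fun q : ℝ × Pt n => f q.1 q.2) (Ici 0 ×ˢ univ)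

namespace RaySmooth

variable {f : ℝ → Pt n → G}

lemma contDiffOn (hf : RaySmooth f) :
    ContDiffOn ℝ ∞ (fun q : ℝ × Pt n => f q.1 q.2) (Ici 0 ×ˢ univ) := hf

lemma congr {g : ℝ → Pt n → G} (hf : RaySmooth f) (h : ∀ t ≥ 0, ∀ z, g t z = f t z) :
    RaySmooth g := ContDiffOn.congr hf fun q hq => h q.1 hq.1 q.2

lemma contDiff_slice (hf : RaySmooth f) {t : ℝ} (ht : 0 ≤ t) : ContDiff ℝ ∞ (f t) := by
  rw [← contDiffOn_univ]
  exact hf.contDiffOn.comp (contDiff_prodMk_right t).contDiffOn fun z _ => ⟨ht, trivial⟩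

lemma hasDerivWithinAt_fderivWithin (hf : RaySmooth f) {t : ℝ} (ht : 0 ≤ t) (z : Pt n) :
    HasDerivWithinAt (fun s => f s z) (fderivWithin ℝ (fun q : ℝ × Pt n => f q.1 q.2)
      (Ici 0 ×ˢ univ) (t, z) (1, 0)) (Ici 0) t := by
  have h1 := (ContDiffOn.differentiableOn hf (by simp) (t, z) ⟨ht, trivial⟩).hasFDerivWithinAt
  have h2 : HasDerivWithinAt (fun s : ℝ => (s, z)) ((1 : ℝ), (0 : Pt n)) (Ici 0) t :=
    (hasDerivWithinAt_id t _).prodMk (hasDerivWithinAt_const t _ z)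
  have h3 : MapsTo (fun s : ℝ => (s, z)) (Ici 0) (Ici 0 ×ˢ univ) := fun s hs => ⟨hs, trivial⟩
  exact HasFDerivWithinAt.comp_hasDerivWithinAt (l := fun q : ℝ × Pt n => f q.1 q.2) t h1 h2 h3

lemma derivWithin (hf : RaySmooth f) :
    RaySmooth (fun t z => derivWithin (fun s => f s z) (Ici 0) t) := by
  have h1 := (ContDiffOn.fderivWithin hf (m := ∞)
    (uniqueDiffOn_Ici_prod isOpen_univ) (by simp)).clm_apply
    (contDiffOn_const (c := ((1 : ℝ), (0 : Pt n))))
  exact h1.congr fun q hq => (hf.hasDerivWithinAt_fderivWithin hq.1 q.2).derivWithin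
    (uniqueDiffOn_Ici 0 q.1 hq.1)

/-- This is smooth dependence for a field that does not involve the unknown. -/
lemma of_deriv {n : ℕ} {G : Type} [NormedAddCommGroup G] [NormedSpace ℝ G] [CompleteSpace G]
    {f f' : ℝ → Pt n → G} (hf' : RaySmooth f')
    (h : ∀ z, ∀ t ≥ 0, HasDerivWithinAt (fun s => f s z) (f' t z) (Ici 0) t)
    (h0 : ContDiff ℝ ∞ (f 0)) : RaySmooth f :=
  IsSolutionFamily.contDiffOn (F := fun q => f' q.1 q.2.1) (U := univ)
    { isOpen := isOpen_univ
      smooth := hf'.contDiffOn.comp (f := fun q : ℝ × Pt n × G => (q.1, q.2.1))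
        (by apply ContDiff.contDiffOn; fun_prop) fun q hq => ⟨hq.1, trivial⟩
      mem := fun _ _ _ => trivial
      deriv := h
      initial := h0 }

end RaySmooth

end RaySmooth

/-! ### Formal transport equations -/

section Transport

open MvPowerSeries

variable {n : ℕ}

/-- The domain of time and starting point. -/
abbrev rayDomain (n : ℕ) : Set (ℝ × Pt n) := Ici 0 ×ˢ univ

lemma SmoothFamily.lift {n m : ℕ} {A : ℝ × Pt n → Series n} (hA : SmoothFamily (rayDomain n) A) :
    SmoothFamily (Ici 0 ×ˢ (univ ×ˢ univ))
      (fun q : ℝ × Pt n × ({β // β ∈ ofDegree n m} → ℂ) => A (q.1, q.2.1)) :=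
  hA.comp (by apply ContDiff.contDiffOn; fun_prop) fun q hq => ⟨hq.1, trivial⟩

lemma contDiffOn_lift {m : ℕ} {G : Type*} [NormedAddCommGroup G] [NormedSpace ℝ G]
    {f : ℝ × Pt n → G} (hf : ContDiffOn ℝ ∞ f (rayDomain n)) :
    ContDiffOn ℝ ∞ (fun q : ℝ × Pt n × ({β // β ∈ ofDegree n m} → ℂ) => f (q.1, q.2.1))
      (Ici 0 ×ˢ (univ ×ˢ univ)) :=
  hf.comp (by apply ContDiff.contDiffOn; fun_prop) fun q hq => ⟨hq.1, trivial⟩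

/-- The coefficients of degree `m` are smooth if they satisfy a differential equation with smooth
right hand side. -/
lemma contDiffOn_coeff_of_system {m : ℕ} {A : Pt n → ℝ → Series n}
    {F : ℝ × Pt n × ({β // β ∈ ofDegree n m} → ℂ) → {β // β ∈ ofDegree n m} → ℂ}
    (hF : ∀ β, ContDiffOn ℝ ∞ (fun q => F q β) (Ici 0 ×ˢ (univ ×ˢ univ)))
    (hd : ∀ z, ∀ t ≥ 0, ∀ β : {β // β ∈ ofDegree n m}, HasDerivWithinAt
      (fun s => coeff β.1 (A z s)) (F (t, z, fun γ => coeff γ.1 (A z t)) β) (Ici 0) t)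
    (h0 : ∀ β : MIdx n, ContDiff ℝ ∞ fun z => coeff β (A z 0)) {β : MIdx n} (hβ : β.degree = m) :
    RaySmooth (fun t z => coeff β (A z t)) := by
  have h : IsSolutionFamily F univ
      (fun t z (β : {β // β ∈ ofDegree n m}) => coeff β.1 (A z t)) :=
    { isOpen := isOpen_univ
      smooth := contDiffOn_pi.2 hF
      mem := fun _ _ _ => trivial
      deriv := fun z t ht => hasDerivWithinAt_pi.2 fun β => hd z t ht β
      initial := contDiff_pi.2 fun β => h0 β.1 }
  exact contDiffOn_pi.1 h.contDiffOn ⟨β, mem_ofDegree.2 hβ⟩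

/-- The power series `A` satisfies the transport equation
`W ∂_t A + ∑ K_i ∂_i A + L A = H` coefficientwise, where the coefficients are smooth, `W` is
invertible and the `K_i` vanish on the ray. -/
structure IsTransport (W : ℝ × Pt n → Series n) (K : Fin n → ℝ × Pt n → Series n)
    (L H : ℝ × Pt n → Series n) (A : Pt n → ℝ → Series n) : Prop where
  smooth_W : SmoothFamily (rayDomain n) W
  smooth_K : ∀ i, SmoothFamily (rayDomain n) (K i)
  smooth_L : SmoothFamily (rayDomain n) L
  smooth_H : SmoothFamily (rayDomain n) H
  W_ne : ∀ q ∈ rayDomain n, constantCoeff (W q) ≠ 0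
  K_zero : ∀ i, ∀ q ∈ rayDomain n, constantCoeff (K i q) = 0
  diff : ∀ z β, DifferentiableOn ℝ (fun t => coeff β (A z t)) (Ici 0)
  eqn : ∀ z, ∀ t ≥ 0, W (t, z) * coeffDeriv (A z) t + ∑ i, K i (t, z) * pderiv ℂ i (A z t) +
    L (t, z) * A z t = H (t, z)
  initial : ∀ β : MIdx n, ContDiff ℝ ∞ fun z => coeff β (A z 0)

namespace IsTransport

variable {W : ℝ × Pt n → Series n} {K : Fin n → ℝ × Pt n → Series n}
    {L H : ℝ × Pt n → Series n} {A : Pt n → ℝ → Series n}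

/-- The vector field for the coefficients of degree `m` when those of lower degree are known. -/
def field (W : ℝ × Pt n → Series n) (K : Fin n → ℝ × Pt n → Series n)
    (L H : ℝ × Pt n → Series n) (A : Pt n → ℝ → Series n) (m : ℕ)
    (q : ℝ × Pt n × ({β // β ∈ ofDegree n m} → ℂ)) (β : {β // β ∈ ofDegree n m}) : ℂ :=
  (constantCoeff (W (q.1, q.2.1)))⁻¹ * coeff β.1 (H (q.1, q.2.1) -
    ∑ i, K i (q.1, q.2.1) * pderiv ℂ i (fillSeries m (A q.2.1 q.1) q.2.2) -
    L (q.1, q.2.1) * fillSeries m (A q.2.1 q.1) q.2.2 -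
    W (q.1, q.2.1) * truncBelow m (coeffDeriv (A q.2.1) q.1))

/-- In degree `m`, `∂_i A` brings in coefficients of degree `m + 1`, but `K_i` has no constant term,
so they are multiplied by zero and `A` may be replaced by its part of degree at most `m`. The
unknown time derivatives of degree `m` enter only through the constant term of `W`, by which one
divides. -/
lemma hasDerivWithinAt (h : IsTransport W K L H A) {m : ℕ} (z : Pt n) {t : ℝ} (ht : 0 ≤ t)
    (β : {β // β ∈ ofDegree n m}) : HasDerivWithinAt (fun s => coeff β.1 (A z s))
      (field W K L H A m (t, z, fun γ => coeff γ.1 (A z t)) β) (Ici 0) t := by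
  have hβ := mem_ofDegree.1 β.2
  suffices hs : field W K L H A m (t, z, fun γ => coeff γ.1 (A z t)) β =
      coeff β.1 (coeffDeriv (A z) t) by
    rw [hs]
    exact (h.diff z β.1 t ht).hasDerivWithinAt
  have hW := h.W_ne (t, z) ⟨ht, trivial⟩
  simp only [field]
  rw [inv_mul_eq_iff_eq_mul₀ hW, ← h.eqn z t ht]
  set D := coeffDeriv (A z) t
  set Y := fillSeries m (A z t) fun γ => coeff γ.1 (A z t) with hY
  have hR := vanishTo_sub_fillSeries m (A z t)
  rw [← hY] at hR
  have hD := vanishTo_sub_truncBelow m D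
  have h1 := hD.coeff_mul_of_degree_eq (W (t, z)) hβ
  have h2 : VanishTo (m + 1) (∑ i, K i (t, z) * pderiv ℂ i (A z t - Y) +
      L (t, z) * (A z t - Y)) := by
    refine (VanishTo.sum fun i _ => ?_).add (hR.mul_left _)
    have := (vanishTo_one (h.K_zero i (t, z) ⟨ht, trivial⟩)).mul (hR.pderiv i)
    rwa [add_comm] at this
  have h3 := h2 β.1 (by omega)
  have h4 : W (t, z) * D + ∑ i, K i (t, z) * pderiv ℂ i (A z t) + L (t, z) * A z t -
      ∑ i, K i (t, z) * pderiv ℂ i Y - L (t, z) * Y - W (t, z) * truncBelow m D =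
      (D - truncBelow m D) * W (t, z) +
      (∑ i, K i (t, z) * pderiv ℂ i (A z t - Y) + L (t, z) * (A z t - Y)) := by
    simp only [map_sub, mul_sub, Finset.sum_sub_distrib]
    ring
  rw [h4, map_add, h3, h1, map_sub, coeff_truncBelow, if_neg (by omega)]
  ring

lemma contDiffOn_field (h : IsTransport W K L H A) {m : ℕ}
    (hA : ∀ β : MIdx n, β.degree < m → RaySmooth (fun t z => coeff β (A z t)))
    (β : {β // β ∈ ofDegree n m}) :
    ContDiffOn ℝ ∞ (fun q => field W K L H A m q β) (Ici 0 ×ˢ (univ ×ˢ univ)) := by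
  have hfill : SmoothFamily (Ici 0 ×ˢ (univ ×ˢ univ))
      (fun q : ℝ × Pt n × ({β // β ∈ ofDegree n m} → ℂ) =>
        fillSeries m (A q.2.1 q.1) q.2.2) :=
    SmoothFamily.fillSeries m (fun β hβ => contDiffOn_lift (hA β hβ))
      (by apply ContDiff.contDiffOn; fun_prop)
  have htr : SmoothFamily (Ici 0 ×ˢ (univ ×ˢ univ))
      (fun q : ℝ × Pt n × ({β // β ∈ ofDegree n m} → ℂ) =>
        truncBelow m (coeffDeriv (A q.2.1) q.1)) :=
    SmoothFamily.truncBelow m fun β hβ => contDiffOn_lift (hA β hβ).derivWithin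
  refine ContDiffOn.mul ((contDiffOn_lift h.smooth_W.constantCoeff).inv
    fun q hq => h.W_ne _ ⟨hq.1, trivial⟩) ?_
  exact ((((h.smooth_H.lift).sub (SmoothFamily.sum fun i _ =>
    ((h.smooth_K i).lift).mul (hfill.pderiv i))).sub ((h.smooth_L.lift).mul hfill)).sub
      ((h.smooth_W.lift).mul htr)) β.1

lemma raySmooth (h : IsTransport W K L H A) (β : MIdx n) :
    RaySmooth (fun t z => coeff β (A z t)) := by
  induction hd : β.degree using Nat.strong_induction_on generalizing β with
  | _ m ih =>
    exact contDiffOn_coeff_of_system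
      (h.contDiffOn_field fun γ hγ => ih γ.degree hγ γ rfl)
      (fun z t ht β => h.hasDerivWithinAt z ht β) h.initial hd

lemma smoothFamily (h : IsTransport W K L H A) :
    SmoothFamily (rayDomain n) (fun q => A q.2 q.1) := h.raySmooth

/-- Solutions of homogeneous transport equations with zero initial values vanish. -/
lemma eq_zero (h : IsTransport W K L H A) {z : Pt n} (hH : ∀ t ≥ 0, H (t, z) = 0)
    (h0 : A z 0 = 0) {t : ℝ} (ht : 0 ≤ t) : A z t = 0 := by
  suffices hs : ∀ β : MIdx n, ∀ t ≥ 0, coeff β (A z t) = 0 by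
    ext β
    simpa using hs β t ht
  intro β
  induction hd : β.degree using Nat.strong_induction_on generalizing β with
  | _ m ih =>
    have hlow : ∀ γ : MIdx n, γ.degree < m → ∀ t ≥ 0, coeff γ (A z t) = 0 :=
      fun γ hγ => ih γ.degree hγ γ rfl
    have hfill : ∀ t ≥ 0, fillSeries m (A z t) 0 = 0 := fun t ht => by
      ext γ
      rw [coeff_fillSeries]
      split_ifs with h1 h2
      · simp
      · simp [hlow γ h2 t ht]
      · simp
    have htr : ∀ t ≥ 0, truncBelow m (coeffDeriv (A z) t) = 0 := fun t ht => by
      ext γ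
      rw [coeff_truncBelow]
      split_ifs with h1
      · change derivWithin (fun s => coeff γ (A z s)) (Ici 0) t = _
        have hz : EqOn (fun s => coeff γ (A z s)) (fun _ => 0) (Ici 0) := fun s hs =>
          hlow γ h1 s hs
        rw [derivWithin_congr hz (hlow γ h1 t ht)]
        simp
      · simp
    -- Once the lower coefficients vanish, the system of degree `m` is homogeneous, so the zero
    -- solution is available for comparison and uniqueness applies.
    have key := eqOn_of_hasDerivWithinAt (U := univ)
      (F := field W K L H A m) isOpen_univ
      (contDiffOn_pi.2 (h.contDiffOn_field fun γ _ => h.raySmooth γ)) (z₀ := z)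
      (y₀ := fun _ => 0) (y₁ := fun t β => coeff β.1 (A z t))
      (fun t ht => by
        have : field W K L H A m (t, z, 0) = 0 := by
          funext γ
          simp [field, hfill t ht, htr t ht, hH t ht]
        rw [this]
        exact hasDerivWithinAt_const _ _ _)
      (fun _ _ => trivial)
      (fun t ht => hasDerivWithinAt_pi.2 fun γ => h.hasDerivWithinAt z ht γ)
      (by funext γ; simp [h0])
    intro t ht
    exact congrFun (key t ht) ⟨β, mem_ofDegree.2 hd⟩

end IsTransport

/-! ### The formal eikonal equation -/

/-- The power series `Φ` satisfies the eikonal equation `(d_t Φ)² = c² |∇Φ|²` coefficientwise,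
where `d_t = ∂_t - v · ∇`; the constant term `w` of `d_t Φ` is nonzero and `w v = - c² ∇Φ` on the
ray. -/
structure IsEikonal (c2 : ℝ × Pt n → Series n) (v : Fin n → ℝ × Pt n → ℂ) (w : ℝ × Pt n → ℂ)
    (Φ : Pt n → ℝ → Series n) : Prop where
  smooth_c2 : SmoothFamily (rayDomain n) c2
  smooth_v : ∀ i, ContDiffOn ℝ ∞ (v i) (rayDomain n)
  smooth_w : ContDiffOn ℝ ∞ w (rayDomain n)
  smooth_low : ∀ β : MIdx n, β.degree < 2 → RaySmooth (fun t z => coeff β (Φ z t))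
  diff : ∀ z β, DifferentiableOn ℝ (fun t => coeff β (Φ z t)) (Ici 0)
  w_ne : ∀ q ∈ rayDomain n, w q ≠ 0
  w_eq : ∀ z, ∀ t ≥ 0, constantCoeff
    (coeffDeriv (Φ z) t - ∑ i, v i (t, z) • pderiv ℂ i (Φ z t)) = w (t, z)
  ray : ∀ z, ∀ t ≥ 0, ∀ i, w (t, z) * v i (t, z) =
    -(constantCoeff (c2 (t, z)) * constantCoeff (pderiv ℂ i (Φ z t)))
  eqn : ∀ z, ∀ t ≥ 0, (coeffDeriv (Φ z) t - ∑ i, v i (t, z) • pderiv ℂ i (Φ z t)) ^ 2 =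
    c2 (t, z) * gradDot (Φ z t) (Φ z t)
  initial : ∀ β : MIdx n, ContDiff ℝ ∞ fun z => coeff β (Φ z 0)

namespace IsEikonal

variable {c2 : ℝ × Pt n → Series n} {v : Fin n → ℝ × Pt n → ℂ} {w : ℝ × Pt n → ℂ}
    {Φ : Pt n → ℝ → Series n}

/-- The vector field for the coefficients of degree `m` when those of lower degree are known. -/
def field (c2 : ℝ × Pt n → Series n) (v : Fin n → ℝ × Pt n → ℂ) (w : ℝ × Pt n → ℂ)
    (Φ : Pt n → ℝ → Series n) (m : ℕ)
    (q : ℝ × Pt n × ({β // β ∈ ofDegree n m} → ℂ)) (β : {β // β ∈ ofDegree n m}) : ℂ :=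
  (2 * w (q.1, q.2.1))⁻¹ * coeff β.1 (c2 (q.1, q.2.1) *
      gradDot (fillSeries m (Φ q.2.1 q.1) q.2.2) (fillSeries m (Φ q.2.1 q.1) q.2.2) -
    (truncBelow m (coeffDeriv (Φ q.2.1) q.1) -
      ∑ i, v i (q.1, q.2.1) • pderiv ℂ i (fillSeries m (Φ q.2.1 q.1) q.2.2)) *
    (truncBelow m (coeffDeriv (Φ q.2.1) q.1) -
      ∑ i, v i (q.1, q.2.1) • pderiv ℂ i (fillSeries m (Φ q.2.1 q.1) q.2.2)))

/-- Let `R` be the part of `Φ` of degree above `m`. The degree `m` terms linear in `∂_i R` are `-2 w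
v_i ∂_i R` in `(d_t Φ)²` and `2 c² ∂_i Φ ∂_i R` in `c² |∇Φ|²`; the relation `w v_i = -c² ∂_i Φ` on
the ray makes them equal, so the coefficients of degree `m + 1` drop out. Quadratic remainders
vanish to order `2m > m`. What is left is solved for `∂_t φ_β` by dividing by `2w`. -/
lemma hasDerivWithinAt (h : IsEikonal c2 v w Φ) {m : ℕ} (hm : 2 ≤ m) (z : Pt n) {t : ℝ}
    (ht : 0 ≤ t) (β : {β // β ∈ ofDegree n m}) : HasDerivWithinAt (fun s => coeff β.1 (Φ z s))
      (field c2 v w Φ m (t, z, fun γ => coeff γ.1 (Φ z t)) β) (Ici 0) t := by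
  have hβ := mem_ofDegree.1 β.2
  suffices hs : field c2 v w Φ m (t, z, fun γ => coeff γ.1 (Φ z t)) β =
      coeff β.1 (coeffDeriv (Φ z) t) by
    rw [hs]
    exact (h.diff z β.1 t ht).hasDerivWithinAt
  have hw := h.w_ne (t, z) ⟨ht, trivial⟩
  simp only [field]
  rw [inv_mul_eq_iff_eq_mul₀ (mul_ne_zero two_ne_zero hw)]
  have heq := h.eqn z t ht
  have hwe := h.w_eq z t ht
  set D := coeffDeriv (Φ z) t
  set Y := fillSeries m (Φ z t) fun γ => coeff γ.1 (Φ z t) with hY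
  set V := D - ∑ i, v i (t, z) • pderiv ℂ i (Φ z t) with hV
  set V' := truncBelow m D - ∑ i, v i (t, z) • pderiv ℂ i Y with hV'
  have hR := vanishTo_sub_fillSeries m (Φ z t)
  rw [← hY] at hR
  set R := Φ z t - Y with hRdef
  have hD := vanishTo_sub_truncBelow m D
  set Q := (D - truncBelow m D) - ∑ i, v i (t, z) • pderiv ℂ i R with hQ
  have hQv : VanishTo m Q := hD.sub (VanishTo.sum fun i _ => (hR.pderiv i).smul _)
  have hVQ : V' = V - Q := by
    simp only [hV, hV', hQ, hRdef, map_sub, smul_sub, Finset.sum_sub_distrib]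
    abel
  have hVV : V' * V' = V ^ 2 - 2 • (Q * V) + Q * Q := by
    rw [hVQ]; ring
  have hgrad : gradDot Y Y = gradDot (Φ z t) (Φ z t) - 2 • ∑ i, pderiv ℂ i R * pderiv ℂ i (Φ z t)
      + ∑ i, pderiv ℂ i R * pderiv ℂ i R := by
    have : Y = Φ z t - R := by rw [hRdef]; abel
    rw [this]
    simp only [gradDot, map_sub, Finset.smul_sum, ← Finset.sum_sub_distrib,
      ← Finset.sum_add_distrib]
    refine Finset.sum_congr rfl fun i _ => ?_
    ring
  have e1 : coeff β.1 (Q * V) = coeff β.1 Q * w (t, z) := by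
    rw [hQv.coeff_mul_of_degree_eq V hβ, hwe]
  have e2 : coeff β.1 (Q * Q) = 0 := hQv.mul hQv β.1 (by omega)
  have e3 : coeff β.1 (c2 (t, z) * ∑ i, pderiv ℂ i R * pderiv ℂ i R) = 0 :=
    ((VanishTo.sum fun i _ => (hR.pderiv i).mul (hR.pderiv i)).mul_left _) β.1 (by omega)
  have e4 : coeff β.1 (c2 (t, z) * ∑ i, pderiv ℂ i R * pderiv ℂ i (Φ z t)) =
      -∑ i, coeff β.1 (pderiv ℂ i R) * (w (t, z) * v i (t, z)) := by
    rw [Finset.mul_sum, map_sum, ← Finset.sum_neg_distrib]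
    refine Finset.sum_congr rfl fun i _ => ?_
    rw [show c2 (t, z) * (pderiv ℂ i R * pderiv ℂ i (Φ z t)) =
      pderiv ℂ i R * (c2 (t, z) * pderiv ℂ i (Φ z t)) by ring,
      (hR.pderiv i).coeff_mul_of_degree_eq _ hβ, map_mul, h.ray z t ht i]
    ring
  have e5 : coeff β.1 Q = coeff β.1 D - ∑ i, v i (t, z) * coeff β.1 (pderiv ℂ i R) := by
    rw [hQ, map_sub, map_sub, coeff_truncBelow, if_neg (by omega), map_sum]
    simp
  rw [hVV, hgrad, mul_add, mul_sub, ← heq, map_sub, map_add, map_add, map_sub, map_sub, e2, e3,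
    mul_smul_comm, map_nsmul, map_nsmul, e1, e4, e5]
  simp only [nsmul_eq_mul, sub_mul, Finset.sum_mul]
  have : ∀ i, coeff β.1 (pderiv ℂ i R) * (w (t, z) * v i (t, z)) =
    v i (t, z) * coeff β.1 (pderiv ℂ i R) * w (t, z) := fun i => by ring
  simp only [this]
  push_cast
  ring

lemma contDiffOn_field (h : IsEikonal c2 v w Φ) {m : ℕ}
    (hA : ∀ β : MIdx n, β.degree < m → RaySmooth (fun t z => coeff β (Φ z t)))
    (β : {β // β ∈ ofDegree n m}) :
    ContDiffOn ℝ ∞ (fun q => field c2 v w Φ m q β) (Ici 0 ×ˢ (univ ×ˢ univ)) := by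
  have hfill : SmoothFamily (Ici 0 ×ˢ (univ ×ˢ univ))
      (fun q : ℝ × Pt n × ({β // β ∈ ofDegree n m} → ℂ) =>
        fillSeries m (Φ q.2.1 q.1) q.2.2) :=
    SmoothFamily.fillSeries m (fun β hβ => contDiffOn_lift (hA β hβ))
      (by apply ContDiff.contDiffOn; fun_prop)
  have htr : SmoothFamily (Ici 0 ×ˢ (univ ×ˢ univ))
      (fun q : ℝ × Pt n × ({β // β ∈ ofDegree n m} → ℂ) =>
        truncBelow m (coeffDeriv (Φ q.2.1) q.1)) :=
    SmoothFamily.truncBelow m fun β hβ => contDiffOn_lift (hA β hβ).derivWithin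
  refine ContDiffOn.mul ((contDiffOn_const.mul (contDiffOn_lift h.smooth_w)).inv
    fun q hq => mul_ne_zero two_ne_zero (h.w_ne _ ⟨hq.1, trivial⟩)) ?_
  have hV := htr.sub (SmoothFamily.sum (s := Finset.univ) fun i _ =>
    SmoothFamily.smul (contDiffOn_lift (h.smooth_v i)) (hfill.pderiv i))
  exact (((h.smooth_c2.lift).mul (hfill.gradDot hfill)).sub (hV.mul hV)) β.1

lemma raySmooth (h : IsEikonal c2 v w Φ) (β : MIdx n) :
    RaySmooth (fun t z => coeff β (Φ z t)) := by
  induction hd : β.degree using Nat.strong_induction_on generalizing β with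
  | _ m ih =>
    rcases lt_or_ge m 2 with hm | hm
    · exact h.smooth_low β (by omega)
    · exact contDiffOn_coeff_of_system
        (h.contDiffOn_field fun γ hγ => ih γ.degree hγ γ rfl)
        (fun z t ht β => h.hasDerivWithinAt hm z ht β) h.initial hd

end IsEikonal

end Transport

end GaussianBeam

end

noncomputable section

namespace GaussianBeam

open MvPowerSeries
open scoped RealInnerProductSpace

variable {n : ℕ}

/-! ### Smoothness of derivatives and Taylor series -/

lemma contDiff_pd {F : Type*} [NormedAddCommGroup F] [NormedSpace ℝ F] {f : Pt n → F}
    (hf : ContDiff ℝ ∞ f) (i : Fin n) : ContDiff ℝ ∞ (pd i f) :=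
  (hf.fderiv_right (by simp)).clm_apply contDiff_const

lemma contDiff_mderiv {F : Type*} [NormedAddCommGroup F] [NormedSpace ℝ F] {f : Pt n → F}
    (hf : ContDiff ℝ ∞ f) (β : MIdx n) : ContDiff ℝ ∞ (mderiv β f) := by
  unfold mderiv
  induction List.finRange n with
  | nil => exact hf
  | cons i L ih =>
    rw [List.foldr_cons]
    generalize β i = m
    induction m with
    | zero => exact ih
    | succ m ihm => rw [Function.iterate_succ_apply']; exact contDiff_pd ihm i

lemma contDiff_gradient {f : Pt n → ℝ} (hf : ContDiff ℝ ∞ f) : ContDiff ℝ ∞ (gradient f) :=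
  (InnerProductSpace.toDual ℝ (Pt n)).symm.contDiff.comp (hf.fderiv_right (by simp))

lemma inner_gradient {f : Pt n → ℝ} (x v : Pt n) : ⟪gradient f x, v⟫ = fderiv ℝ f x v := by
  simp [gradient]

lemma contDiff_ofReal : ContDiff ℝ ∞ (fun r : ℝ => (r : ℂ)) := Complex.ofRealCLM.contDiff

lemma mfact_ne_zero (β : MIdx n) : (mfact β : ℂ) ≠ 0 := by
  simp [mfact, Finset.prod_ne_zero_iff, Nat.factorial_ne_zero]

lemma mfact_single (i : Fin n) : mfact (e i) = 1 := by
  refine Finset.prod_eq_one fun l _ => ?_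
  by_cases h : i = l
  · subst h; simp
  · simp [Finsupp.single_eq_of_ne' h]

lemma coeff_series (c : MIdx n → ℂ) (β : MIdx n) :
    coeff β (series c) = c β / (mfact β : ℂ) := rfl

lemma constantCoeff_series (c : MIdx n → ℂ) : constantCoeff (series c) = c 0 := by
  rw [← coeff_zero_eq_constantCoeff_apply, coeff_series]
  simp [mfact]

lemma constantCoeff_pderiv_series (c : MIdx n → ℂ) (i : Fin n) :
    constantCoeff (pderiv ℂ i (series c)) = c (e i) := by
  rw [← coeff_zero_eq_constantCoeff_apply, coeff_pderiv, zero_add, coeff_series, mfact_single]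
  simp

lemma constantCoeff_taylor (f : Pt n → ℝ) (x : Pt n) :
    constantCoeff (taylor f x) = (f x : ℂ) := by
  rw [taylor, constantCoeff_series]
  have : mderiv 0 f = f := by
    unfold mderiv
    induction List.finRange n with
    | nil => rfl
    | cons i L ih => rw [List.foldr_cons, ih]; rfl
  rw [this]

lemma smoothFamily_taylor {X : Type*} [NormedAddCommGroup X] [NormedSpace ℝ X] {D : Set X}
    {f : Pt n → ℝ} (hf : ContDiff ℝ ∞ f) {x : X → Pt n} (hx : ContDiffOn ℝ ∞ x D) :
    SmoothFamily D (fun q => taylor f (x q)) := fun β =>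
  (contDiff_ofReal.comp_contDiffOn ((contDiff_mderiv hf β).comp_contDiffOn hx)).div_const _

lemma mderiv_eq_zero_of_notMem_tsupport {f : Pt n → ℝ} {x : Pt n} (hx : x ∉ tsupport f)
    (β : MIdx n) : mderiv β f x = 0 := by
  have hpd : ∀ (g : Pt n → ℝ) (i : Fin n), tsupport g ⊆ tsupport f →
      tsupport (pd i g) ⊆ tsupport f := fun g i hg =>
    (tsupport_fderiv_apply_subset ℝ _).trans hg
  have : tsupport (mderiv β f) ⊆ tsupport f := by
    unfold mderiv
    induction List.finRange n with
    | nil => exact le_rfl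
    | cons i L ih =>
      rw [List.foldr_cons]
      generalize β i = m
      induction m with
      | zero => exact ih
      | succ m ihm => rw [Function.iterate_succ_apply']; exact hpd _ i ihm
  exact image_eq_zero_of_notMem_tsupport fun h => hx (this h)

lemma taylor_eq_zero_of_notMem_tsupport {f : Pt n → ℝ} {x : Pt n} (hx : x ∉ tsupport f) :
    taylor f x = 0 := by
  ext β
  simp [taylor, coeff_series, mderiv_eq_zero_of_notMem_tsupport hx]

lemma raySmooth_of_smoothFamily_series {c : MIdx n → ℝ → Pt n → ℂ}
    (h : SmoothFamily (rayDomain n) (fun q => series fun β => c β q.1 q.2)) (β : MIdx n) :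
    RaySmooth (c β) :=
  ((h β).mul (contDiffOn_const (c := (mfact β : ℂ)))).congr fun q _ => by
    rw [coeff_series, div_mul_cancel₀ _ (mfact_ne_zero β)]

/-! ### Differentiation with respect to the starting point -/

/-- Exchange of `∂_t` and `D_z`, read off from the variational equation of a field independent of
the unknown; this covers the one-sided derivative at `t = 0`. -/
lemma RaySmooth.hasDerivWithinAt_fderiv {G : Type} [NormedAddCommGroup G] [NormedSpace ℝ G]
    [CompleteSpace G] {f f' : ℝ → Pt n → G} (hf' : RaySmooth f')
    (h : ∀ z, ∀ t ≥ 0, HasDerivWithinAt (fun s => f s z) (f' t z) (Ici 0) t)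
    (h0 : ContDiff ℝ ∞ (f 0)) (z : Pt n) {t : ℝ} (ht : 0 ≤ t) :
    HasDerivWithinAt (fun s => fderiv ℝ (f s) z) (fderiv ℝ (f' t) z) (Ici 0) t := by
  have hsol : IsSolutionFamily (fun q : ℝ × Pt n × G => f' q.1 q.2.1) univ f :=
    { isOpen := isOpen_univ
      smooth := hf'.contDiffOn.comp (f := fun q : ℝ × Pt n × G => (q.1, q.2.1))
        (by apply ContDiff.contDiffOn; fun_prop) fun q hq => ⟨hq.1, trivial⟩
      mem := fun _ _ _ => trivial
      deriv := h
      initial := h0 }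
  have h1 := hsol.hasDerivWithinAt_fderiv ht z
  have h2 := hasFDerivAt_spaceFDeriv hsol.isOpen_space hsol.smooth ht (q := (z, f t z))
    ⟨trivial, trivial⟩
  have h3 : HasFDerivAt (fun z' => (z', f t z')) ((ContinuousLinearMap.id ℝ (Pt n)).prod
      (fderiv ℝ (f t) z)) z :=
    (hasFDerivAt_id z).prodMk (hsol.differentiableAt ht z).hasFDerivAt
  have h4 := (HasFDerivAt.comp z h2 h3).fderiv
  rw [← h4] at h1
  exact h1

lemma eq_of_hasDerivWithinAt_zero {G : Type*} [NormedAddCommGroup G] [NormedSpace ℝ G]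
    {f : ℝ → G} (h : ∀ t ≥ 0, HasDerivWithinAt f 0 (Ici 0) t) {t : ℝ} (ht : 0 ≤ t) :
    f t = f 0 := by
  have := (convex_Ici (0 : ℝ)).norm_image_sub_le_of_norm_hasDerivWithin_le (C := 0)
    (f' := fun _ => 0) h (fun _ _ => by simp) (mem_Ici.2 le_rfl) ht
  rw [zero_mul, norm_le_zero_iff, sub_eq_zero] at this
  exact this

/-- The relation `(D_z x)ᵀ p = ∇_z φ₀` propagates along the rays. -/
lemma isotropic_of_deriv {x p x' p' : ℝ → Pt n → Pt n} {φ : ℝ → Pt n → ℂ} {r : ℝ → Pt n → ℝ}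
    {φ₀ : Pt n → ℝ} (hφ₀ : ContDiff ℝ ∞ φ₀)
    (hx' : RaySmooth x') (hr : RaySmooth r)
    (hx : ∀ z, ∀ t ≥ 0, HasDerivWithinAt (fun s => x s z) (x' t z) (Ici 0) t)
    (hp : ∀ z, ∀ t ≥ 0, HasDerivWithinAt (fun s => p s z) (p' t z) (Ici 0) t)
    (hφ : ∀ z, ∀ t ≥ 0, HasDerivWithinAt (fun s => φ s z) (r t z : ℂ) (Ici 0) t)
    (hx0 : ∀ z, x 0 z = z) (hp0 : ∀ z, p 0 z = gradient φ₀ z) (hφ0 : ∀ z, φ 0 z = (φ₀ z : ℂ))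
    (key : ∀ t ≥ 0, ∀ z v, ⟪p t z, fderiv ℝ (x' t) z v⟫ + ⟪p' t z, fderiv ℝ (x t) z v⟫ =
      fderiv ℝ (r t) z v) {t : ℝ} (ht : 0 ≤ t) (z : Pt n) (l : Fin n) :
    ∑ i, ((pd l (x t) z i : ℝ) : ℂ) * (p t z i : ℂ) = pd l (φ t) z := by
  have hx0' : x 0 = fun z => z := funext hx0
  have hφ0' : φ 0 = fun z => (φ₀ z : ℂ) := funext hφ0
  set v : Pt n := EuclideanSpace.single l 1 with hv
  have hrc : RaySmooth fun t z => (r t z : ℂ) := contDiff_ofReal.comp_contDiffOn hr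
  have hc : ∀ (f : Pt n → ℝ), ContDiff ℝ ∞ f → ∀ z v, fderiv ℝ (fun z => (f z : ℂ)) z v =
      ((fderiv ℝ f z v : ℝ) : ℂ) := fun f hf z v => by
    have := (Complex.ofRealCLM.hasFDerivAt.comp z
      (hf.differentiable (by simp) z).hasFDerivAt).fderiv
    exact congrArg (fun T : Pt n →L[ℝ] ℂ => T v) this
  -- The defect of the relation in the direction `v` has time derivative zero: this is the content
  -- of `key`.
  have h1 : ∀ t ≥ 0, HasDerivWithinAt (fun s => ((⟪p s z, fderiv ℝ (x s) z v⟫ : ℝ) : ℂ) -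
      fderiv ℝ (φ s) z v) 0 (Ici 0) t := fun t ht => by
    have e1 := (hx'.hasDerivWithinAt_fderiv hx (hx0' ▸ contDiff_id) z ht).clm_apply
      (hasDerivWithinAt_const t _ v)
    have e2 := (hrc.hasDerivWithinAt_fderiv hφ (hφ0' ▸ contDiff_ofReal.comp hφ₀) z ht).clm_apply
      (hasDerivWithinAt_const t _ v)
    have e3 := ((hp z t ht).inner ℝ e1).ofReal_comp.sub e2
    rw [map_zero, map_zero, add_zero, add_zero, key t ht z v, hc _ (hr.contDiff_slice ht),
      sub_self] at e3
    exact e3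
  have h2 := eq_of_hasDerivWithinAt_zero h1 ht
  have h3 : ((⟪p 0 z, fderiv ℝ (x 0) z v⟫ : ℝ) : ℂ) - fderiv ℝ (φ 0) z v = 0 := by
    rw [hx0', hφ0', hc _ hφ₀, hp0, inner_gradient, fderiv_fun_id]
    simp
  rw [h3, sub_eq_zero] at h2
  change _ = fderiv ℝ (φ t) z v
  rw [← h2]
  simp only [PiLp.inner_apply, pd, RCLike.inner_apply]
  simp [hv]

/-! ### Backward estimates -/

/-- Grönwall's inequality for the time-reversed function. -/
lemma norm_le_exp_mul_norm_of_norm_deriv_le {E : Type*} [NormedAddCommGroup E] [NormedSpace ℝ E]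
    {u u' : ℝ → E} (hu : ∀ s ≥ 0, HasDerivWithinAt u (u' s) (Ici 0) s) {t L : ℝ} (ht : 0 ≤ t)
    (hL : ∀ s ∈ Icc 0 t, ‖u' s‖ ≤ L * ‖u s‖) : ‖u 0‖ ≤ ‖u t‖ * Real.exp (L * t) := by
  have hmem : ∀ s ∈ Icc 0 t, t - s ∈ Icc 0 t := fun s hs => ⟨by linarith [hs.2], by linarith [hs.1]⟩
  have hcont : ContinuousOn (fun s => u (t - s)) (Icc 0 t) := by
    refine ContinuousOn.comp (t := Ici 0) (fun s hs => (hu s hs).continuousWithinAt)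
      (by fun_prop) fun s hs => (hmem s hs).1
  have hder : ∀ s ∈ Ico 0 t, HasDerivWithinAt (fun s => u (t - s)) (-u' (t - s)) (Ici s) s := by
    intro s hs
    have hpos : 0 < t - s := by linarith [hs.2]
    have h1 : HasDerivAt u (u' (t - s)) (t - s) := (hu _ hpos.le).hasDerivAt (Ici_mem_nhds hpos)
    have h2 := h1.scomp s ((hasDerivAt_id s).const_sub t)
    rw [neg_one_smul] at h2
    exact h2.hasDerivWithinAt
  have := norm_le_gronwallBound_of_norm_deriv_right_le (δ := ‖u t‖) (K := L) (ε := 0) hcont hder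
    (by simp) (fun s hs => by
      rw [norm_neg, add_zero]
      exact hL _ (hmem s (Ico_subset_Icc_self hs))) t ⟨ht, le_rfl⟩
  simpa [gronwallBound_ε0] using this

/-- Two orbits of an autonomous field cannot approach each other faster than exponentially. The
orbits over `[0, T] × K` fill a compact subset of `U`, on which the locally Lipschitz field is
Lipschitz, and the backward estimate applies to their difference. -/
lemma exists_lower_bound_of_flow {E : Type*} [NormedAddCommGroup E] [NormedSpace ℝ E]
    {f : E → E} {U : Set E} (hU : IsOpen U) (hf : ContDiffOn ℝ ∞ f U) {Y : ℝ → Pt n → E}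
    (hY : ContinuousOn (fun q : ℝ × Pt n => Y q.1 q.2) (Ici 0 ×ˢ univ))
    (hmem : ∀ t ≥ 0, ∀ z, Y t z ∈ U)
    (hd : ∀ z, ∀ t ≥ 0, HasDerivWithinAt (fun s => Y s z) (f (Y t z)) (Ici 0) t)
    (T : ℝ) {K : Set (Pt n)} (hK : IsCompact K) :
    ∃ C > 0, ∀ t ∈ Icc 0 T, ∀ z ∈ K, ∀ z' ∈ K, C * ‖Y 0 z - Y 0 z'‖ ≤ ‖Y t z - Y t z'‖ := by
  set S : Set E := (fun q : ℝ × Pt n => Y q.1 q.2) '' (Icc 0 T ×ˢ K) with hS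
  have hSc : IsCompact S := (isCompact_Icc.prod hK).image_of_continuousOn
    (hY.mono (prod_mono Icc_subset_Ici_self (subset_univ _)))
  have hSU : S ⊆ U := by
    rintro _ ⟨q, hq, rfl⟩
    exact hmem q.1 hq.1.1 q.2
  obtain ⟨L, hL⟩ : ∃ L, LipschitzOnWith L f S := by
    refine LocallyLipschitzOn.exists_lipschitzOnWith_of_compact hSc fun x hx => ?_
    obtain ⟨K, s, hs, hK⟩ := ((hf.contDiffAt (hU.mem_nhds (hSU hx))).of_le
      (m := 1) (by simp)).exists_lipschitzOnWith
    exact ⟨K, s, mem_nhdsWithin_of_mem_nhds hs, hK⟩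
  refine ⟨Real.exp (-(L * T)), Real.exp_pos _, fun t ht z hz z' hz' => ?_⟩
  have h1 := norm_le_exp_mul_norm_of_norm_deriv_le (u := fun s => Y s z - Y s z')
    (fun s hs => (hd z s hs).sub (hd z' s hs)) ht.1 (L := L) (fun s hs =>
      hL.norm_sub_le ⟨(s, z), ⟨⟨hs.1, hs.2.trans ht.2⟩, hz⟩, rfl⟩
        ⟨(s, z'), ⟨⟨hs.1, hs.2.trans ht.2⟩, hz'⟩, rfl⟩)
  have h2 : Real.exp (L * t) ≤ Real.exp (L * T) := by
    have := ht.2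
    gcongr
  calc Real.exp (-(L * T)) * ‖Y 0 z - Y 0 z'‖
      ≤ Real.exp (-(L * T)) * (‖Y t z - Y t z'‖ * Real.exp (L * T)) := by
        gcongr
        exact h1.trans (by gcongr)
    _ = ‖Y t z - Y t z'‖ := by
        rw [mul_left_comm, ← Real.exp_add]
        simp

/-! ### Regular modes -/

/-- The properties of the coefficients of a mode which do not depend on the equation. -/
structure IsRegularMode (K₀ : Set (Pt n)) (b : Coeffs n) : Prop where
  x_smooth : RaySmooth b.x
  p_smooth : RaySmooth b.p
  φ_smooth : ∀ β, RaySmooth (b.φ β)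
  a_smooth : ∀ j β, RaySmooth (b.a j β)
  φ_real : ∀ t ≥ 0, ∀ z, (b.φ 0 t z).im = 0
  isotropic : ∀ t ≥ 0, ∀ z l,
    ∑ i, ((pd l (b.x t) z i : ℝ) : ℂ) * (b.p t z i : ℂ) = pd l (b.φ 0 t) z
  lower : ∀ (T : ℝ) (K : Set (Pt n)), IsCompact K → ∃ C > 0, ∀ t ∈ Icc 0 T, ∀ z ∈ K, ∀ z' ∈ K,
    C * ‖z - z'‖ ≤ ‖b.p t z - b.p t z'‖ + ‖b.x t z - b.x t z'‖
  supp : ∃ S ⊆ K₀, IsClosed S ∧ ∀ j β, ∀ t ≥ 0, ∀ z ∉ S, b.a j β t z = 0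

lemma im_eq_zero_of_deriv {φ : ℝ → ℂ} {r : ℝ → ℝ}
    (hφ : ∀ t ≥ 0, HasDerivWithinAt φ (r t : ℂ) (Ici 0) t) (h0 : (φ 0).im = 0) {t : ℝ}
    (ht : 0 ≤ t) : (φ t).im = 0 := by
  have h : ∀ t ≥ 0, HasDerivWithinAt (fun s => (φ s).im) 0 (Ici 0) t := fun t ht => by
    have := Complex.imCLM.hasFDerivAt.comp_hasDerivWithinAt t (hφ t ht)
    rw [Complex.imCLM_apply, Complex.ofReal_im] at this
    exact this
  exact (eq_of_hasDerivWithinAt_zero h ht).trans h0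

/-- The position component of the initial state is `z` itself, so distances of initial states
dominate `‖z - z'‖`; this gives the bound in (P3). -/
lemma lower_of_flow {f : Pt n × Pt n → Pt n × Pt n} {U : Set (Pt n × Pt n)} (hU : IsOpen U)
    (hf : ContDiffOn ℝ ∞ f U) {x p : ℝ → Pt n → Pt n}
    (hY : RaySmooth fun t z => (x t z, p t z)) (hmem : ∀ t ≥ 0, ∀ z, (x t z, p t z) ∈ U)
    (hd : ∀ z, ∀ t ≥ 0, HasDerivWithinAt (fun s => (x s z, p s z)) (f (x t z, p t z)) (Ici 0) t)
    (hx0 : ∀ z, x 0 z = z) (T : ℝ) (K : Set (Pt n)) (hK : IsCompact K) :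
    ∃ C > 0, ∀ t ∈ Icc 0 T, ∀ z ∈ K, ∀ z' ∈ K,
      C * ‖z - z'‖ ≤ ‖p t z - p t z'‖ + ‖x t z - x t z'‖ := by
  obtain ⟨C, hC, h⟩ := exists_lower_bound_of_flow hU hf hY.contDiffOn.continuousOn hmem hd T hK
  refine ⟨C, hC, fun t ht z hz z' hz' => ?_⟩
  have h1 := h t ht z hz z' hz'
  rw [Prod.mk_sub_mk, Prod.mk_sub_mk, Prod.norm_mk, Prod.norm_mk, hx0, hx0] at h1
  calc C * ‖z - z'‖ ≤ C * max ‖z - z'‖ ‖p 0 z - p 0 z'‖ := by gcongr; exact le_max_left _ _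
    _ ≤ _ := h1
    _ ≤ _ := max_le (by linarith [norm_nonneg (p t z - p t z')])
        (by linarith [norm_nonneg (x t z - x t z')])

/-- The velocity components of the ray, as a complex function. -/
def velocity (b : Coeffs n) (i : Fin n) (q : ℝ × Pt n) : ℂ :=
  ((derivWithin (fun s => b.x s q.2 i) (Ici 0) q.1 : ℝ) : ℂ)

lemma contDiffOn_velocity {b : Coeffs n} (hx : RaySmooth b.x) (i : Fin n) :
    ContDiffOn ℝ ∞ (velocity b i) (rayDomain n) := by
  have h1 : RaySmooth fun t z => b.x t z i :=
    (EuclideanSpace.proj (𝕜 := ℝ) i).contDiff.comp_contDiffOn hx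
  exact contDiff_ofReal.comp_contDiffOn h1.derivWithin

lemma velocity_eq {b : Coeffs n} {z : Pt n} {t : ℝ} (ht : 0 ≤ t) {v : Pt n}
    (h : HasDerivWithinAt (fun s => b.x s z) v (Ici 0) t) (i : Fin n) :
    velocity b i (t, z) = (v i : ℂ) := by
  have h1 := (EuclideanSpace.proj (𝕜 := ℝ) i).hasFDerivAt.comp_hasDerivWithinAt t h
  have h2 : HasDerivWithinAt (fun s => b.x s z i) (v i) (Ici 0) t := h1
  rw [velocity, h2.derivWithin (uniqueDiffOn_Ici 0 t ht)]

lemma SmoothFamily.coeffDeriv {A : Pt n → ℝ → Series n}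
    (hA : SmoothFamily (rayDomain n) fun q => A q.2 q.1) :
    SmoothFamily (rayDomain n) fun q => coeffDeriv (A q.2) q.1 := fun β =>
  RaySmooth.derivWithin (f := fun t z => coeff β (A z t)) (hA β)

lemma SmoothFamily.dt {b : Coeffs n} (hx : RaySmooth b.x) {A : Pt n → ℝ → Series n}
    (hA : SmoothFamily (rayDomain n) fun q => A q.2 q.1) :
    SmoothFamily (rayDomain n) fun q => dt (fun s => b.x s q.2) (A q.2) q.1 :=
  hA.coeffDeriv.sub (SmoothFamily.sum fun i _ =>
    SmoothFamily.smul (contDiffOn_velocity hx i) (hA.pderiv i))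

lemma dt_eq_sub_sum_velocity {b : Coeffs n} (z : Pt n) (A : ℝ → Series n) (t : ℝ) :
    dt (fun s => b.x s z) A t =
      coeffDeriv A t - ∑ i, velocity b i (t, z) • pderiv ℂ i (A t) := rfl

lemma smoothFamily_phaseSeries {b : Coeffs n} (h : ∀ β, RaySmooth (b.φ β)) :
    SmoothFamily (rayDomain n) fun q => b.phaseSeries q.2 q.1 := fun β =>
  (h β).contDiffOn.div_const _

end GaussianBeam

end

noncomputable section

namespace GaussianBeam

open MvPowerSeries
open scoped RealInnerProductSpace

variable {n : ℕ}

/-! ### Multi-indices of low degree and initial values of the phase coefficients -/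

lemma exists_eq_add_single_of_degree_eq_two {β : MIdx n} (hβ : β.degree = 2) :
    ∃ i l, β = e i + e l := by
  have h1 : β ≠ 0 := fun h => by simp [h] at hβ
  obtain ⟨i, hi⟩ := Finsupp.ne_iff.1 h1
  have hi' : e i ≤ β := by
    rw [Finsupp.single_le_iff]; exact Nat.one_le_iff_ne_zero.2 hi
  have h2 : (β - e i).degree = 1 := by
    have : (β - e i).degree + (e i).degree = β.degree := by
      rw [← map_add, tsub_add_cancel_of_le hi']
    simp at this
    omega
  have h3 : β - e i ≠ 0 := fun h => by simp [h] at h2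
  obtain ⟨l, hl⟩ := Finsupp.ne_iff.1 h3
  have hl' : e l ≤ β - e i := by
    rw [Finsupp.single_le_iff]; exact Nat.one_le_iff_ne_zero.2 hl
  have h4 : (β - e i - e l).degree = 0 := by
    have : (β - e i - e l).degree + (e l).degree = (β - e i).degree := by
      rw [← map_add, tsub_add_cancel_of_le hl']
    simp at this
    omega
  have h5 : β - e i - e l = 0 := (Finsupp.degree_eq_zero_iff _).1 h4
  refine ⟨i, l, ?_⟩
  rw [← tsub_add_cancel_of_le hi', ← tsub_add_cancel_of_le hl', h5, zero_add, add_comm]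

lemma exists_eq_single_of_degree_eq_one {β : MIdx n} (hβ : β.degree = 1) : ∃ i, β = e i := by
  have h1 : β ≠ 0 := fun h => by simp [h] at hβ
  obtain ⟨i, hi⟩ := Finsupp.ne_iff.1 h1
  have hi' : e i ≤ β := by
    rw [Finsupp.single_le_iff]; exact Nat.one_le_iff_ne_zero.2 hi
  have h2 : (β - e i).degree = 0 := by
    have : (β - e i).degree + (e i).degree = β.degree := by
      rw [← map_add, tsub_add_cancel_of_le hi']
    simp at this
    omega
  exact ⟨i, by rw [← tsub_add_cancel_of_le hi', (Finsupp.degree_eq_zero_iff _).1 h2, zero_add]⟩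

lemma PhaseInit.contDiff_phi {φ₀ : Pt n → ℝ} (hφ₀ : ContDiff ℝ ∞ φ₀) {b : Coeffs n}
    (h : PhaseInit φ₀ b) (β : MIdx n) : ContDiff ℝ ∞ (b.φ β 0) := by
  rcases Nat.lt_or_ge β.degree 3 with hβ | hβ
  · interval_cases hd : β.degree
    · rw [(Finsupp.degree_eq_zero_iff _).1 hd, funext h.phi0_zero]
      exact contDiff_ofReal.comp hφ₀
    · obtain ⟨i, rfl⟩ := exists_eq_single_of_degree_eq_one hd
      have : b.φ (e i) 0 = fun z => ((gradient φ₀ z i : ℝ) : ℂ) := funext fun z => by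
        rw [h.first_order z 0 le_rfl, h.p_zero]
      rw [this]
      exact contDiff_ofReal.comp ((EuclideanSpace.proj (𝕜 := ℝ) i).contDiff.comp
        (contDiff_gradient hφ₀))
    · obtain ⟨i, l, rfl⟩ := exists_eq_add_single_of_degree_eq_two hd
      have : b.φ (e i + e l) 0 = fun z => ((pd i (pd l φ₀) z : ℝ) : ℂ) +
          if i = l then Complex.I else 0 := funext fun z => h.M_zero z i l
      rw [this]
      exact (contDiff_ofReal.comp (contDiff_pd (contDiff_pd hφ₀ l) i)).add contDiff_const
  · rw [funext fun z => h.phi_zero z β hβ]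
    exact contDiff_ofReal.comp (contDiff_mderiv hφ₀ β)

lemma PhaseInit.constantCoeff_pderiv {φ₀ : Pt n → ℝ} {b : Coeffs n} (h : PhaseInit φ₀ b)
    (z : Pt n) {t : ℝ} (ht : 0 ≤ t) (i : Fin n) :
    constantCoeff (pderiv ℂ i (b.phaseSeries z t)) = (b.p t z i : ℂ) := by
  rw [Coeffs.phaseSeries, constantCoeff_pderiv_series, h.first_order z t ht]

/-! ### The Schrödinger equation -/

namespace IsSchrodinger

variable {V φ₀ B₀ : Pt n → ℝ} {b : Coeffs n}

/-- The Hamiltonian vector field of the Schrödinger equation. -/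
def hamiltonField (V : Pt n → ℝ) (q : Pt n × Pt n) : Pt n × Pt n := (q.2, -gradient V q.1)

lemma contDiff_hamiltonField (hV : ContDiff ℝ ∞ V) : ContDiff ℝ ∞ (hamiltonField V) :=
  contDiff_snd.prodMk ((contDiff_gradient hV).comp contDiff_fst).neg

lemma raySmooth_ray (hV : ContDiff ℝ ∞ V) (hφ₀ : ContDiff ℝ ∞ φ₀) (h : IsSchrodinger V φ₀ B₀ b) :
    RaySmooth fun t z => (b.x t z, b.p t z) :=
  IsSolutionFamily.contDiffOn (F := fun q => hamiltonField V q.2.2) (U := univ)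
    { isOpen := isOpen_univ
      smooth := ((contDiff_hamiltonField hV).comp
        (contDiff_snd.comp contDiff_snd)).contDiffOn
      mem := fun _ _ _ => trivial
      deriv := fun z t ht => (h.ray z t ht).prodMk (h.direction z t ht)
      initial := by
        have h0 : (fun z => (b.x 0 z, b.p 0 z)) = fun z => (z, gradient φ₀ z) := funext fun z => by
          rw [h.phase_init.x_zero, h.phase_init.p_zero]
        rw [h0]
        exact contDiff_id.prodMk (contDiff_gradient hφ₀) }

lemma raySmooth_x (hV : ContDiff ℝ ∞ V) (hφ₀ : ContDiff ℝ ∞ φ₀) (h : IsSchrodinger V φ₀ B₀ b) :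
    RaySmooth b.x := contDiff_fst.comp_contDiffOn (h.raySmooth_ray hV hφ₀)

lemma raySmooth_p (hV : ContDiff ℝ ∞ V) (hφ₀ : ContDiff ℝ ∞ φ₀) (h : IsSchrodinger V φ₀ B₀ b) :
    RaySmooth b.p := contDiff_snd.comp_contDiffOn (h.raySmooth_ray hV hφ₀)

lemma raySmooth_phi0_deriv (hV : ContDiff ℝ ∞ V) (hφ₀ : ContDiff ℝ ∞ φ₀)
    (h : IsSchrodinger V φ₀ B₀ b) : RaySmooth fun t z => ‖b.p t z‖ ^ 2 / 2 - V (b.x t z) :=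
  (((h.raySmooth_p hV hφ₀).contDiffOn.norm_sq ℝ).div_const 2).sub
    (hV.comp_contDiffOn (h.raySmooth_x hV hφ₀))

/-- All entries are treated as one Riccati system. Its quadratic right hand side does no harm, since
the solution is given for all `t ≥ 0` and only its dependence on `z` is in question. -/
lemma raySmooth_phi_two (hV : ContDiff ℝ ∞ V) (hφ₀ : ContDiff ℝ ∞ φ₀)
    (h : IsSchrodinger V φ₀ B₀ b) (i l : Fin n) : RaySmooth (b.φ (e i + e l)) := by
  set F : ℝ × Pt n × (Fin n → Fin n → ℂ) → Fin n → Fin n → ℂ := fun q i l =>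
    -(∑ k, q.2.2 i k * q.2.2 k l) - ((pd i (pd l V) (b.x q.1 q.2.1) : ℝ) : ℂ) with hF
  have hsol : IsSolutionFamily F univ (fun t z i l => b.φ (e i + e l) t z) :=
    { isOpen := isOpen_univ
      smooth := by
        refine contDiffOn_pi.2 fun i => contDiffOn_pi.2 fun l => ContDiffOn.sub ?_ ?_
        · apply ContDiff.contDiffOn
          refine ContDiff.neg (ContDiff.sum fun k _ => ContDiff.mul ?_ ?_) <;> fun_prop
        · refine contDiff_ofReal.comp_contDiffOn ((contDiff_pd (contDiff_pd hV l) i).comp_contDiffOn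
            ((h.raySmooth_x hV hφ₀).contDiffOn.comp
              (f := fun q : ℝ × Pt n × (Fin n → Fin n → ℂ) => (q.1, q.2.1))
              (by apply ContDiff.contDiffOn; fun_prop) fun q hq => ⟨hq.1, trivial⟩))
      mem := fun _ _ _ => trivial
      deriv := fun z t ht => hasDerivWithinAt_pi.2 fun i => hasDerivWithinAt_pi.2 fun l =>
        h.hessian z t ht i l
      initial := contDiff_pi.2 fun i => contDiff_pi.2 fun l => h.phase_init.contDiff_phi hφ₀ _ }
  exact contDiffOn_pi.1 (contDiffOn_pi.1 hsol.contDiffOn i) l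

/-- The right hand side of the equations for the phase coefficients of degree `m`. -/
def phaseField (V : Pt n → ℝ) (b : Coeffs n) (m : ℕ)
    (q : ℝ × Pt n × ({β // β ∈ ofDegree n m} → ℂ)) (β : {β // β ∈ ofDegree n m}) : ℂ :=
  (-(1 / 2) * ∑ l, ∑ γ ∈ (Finset.Iic β.1).filter
      (fun γ => 1 ≤ γ.degree ∧ γ.degree ≤ β.1.degree - 1),
      (mfact β.1 : ℂ) / ((mfact (β.1 - γ) : ℂ) * (mfact γ : ℂ)) *
        (coeff (β.1 - γ + e l) (fillSeries m (b.phaseSeries q.2.1 q.1) q.2.2) *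
          mfact (β.1 - γ + e l)) *
        (coeff (γ + e l) (fillSeries m (b.phaseSeries q.2.1 q.1) q.2.2) * mfact (γ + e l)) -
    ((mderiv β.1 V (b.x q.1 q.2.1) : ℝ) : ℂ)) / mfact β.1

/-- The restriction `1 ≤ |γ| ≤ |β| - 1` keeps the degrees of `γ + e l` and `β - γ + e l` at most
`|β|`, so the equations of degree `m` form a closed system given the lower degrees. -/
lemma hasDerivWithinAt_phase (h : IsSchrodinger V φ₀ B₀ b) {m : ℕ} (hm : 3 ≤ m) (z : Pt n)
    {t : ℝ} (ht : 0 ≤ t) (β : {β // β ∈ ofDegree n m}) :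
    HasDerivWithinAt (fun s => coeff β.1 (b.phaseSeries z s))
      (phaseField V b m (t, z, fun γ => coeff γ.1 (b.phaseSeries z t)) β) (Ici 0) t := by
  have hβ := mem_ofDegree.1 β.2
  have hfill : ∀ γ : MIdx n, γ.degree ≤ m →
      coeff γ (fillSeries m (b.phaseSeries z t) fun γ => coeff γ.1 (b.phaseSeries z t)) *
        mfact γ = b.φ γ t z := fun γ hγ => by
    have h1 := vanishTo_sub_fillSeries m (b.phaseSeries z t) γ (by omega)
    rw [map_sub, sub_eq_zero] at h1
    rw [← h1, Coeffs.phaseSeries, coeff_series, div_mul_cancel₀ _ (mfact_ne_zero γ)]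
  have h1 := (h.phi z t ht β.1 (by omega)).div_const (mfact β.1 : ℂ)
  refine h1.congr_deriv (Eq.symm ?_)
  simp only [phaseField]
  congr 3
  refine Finset.sum_congr rfl fun l _ => Finset.sum_congr rfl fun γ hγ => ?_
  rw [Finset.mem_filter, Finset.mem_Iic] at hγ
  have hd : (β.1 - γ).degree + γ.degree = β.1.degree := by
    rw [← map_add, tsub_add_cancel_of_le hγ.1]
  rw [hfill _ (by rw [map_add]; simp; omega), hfill _ (by rw [map_add]; simp; omega)]

lemma raySmooth_phi (hV : ContDiff ℝ ∞ V) (hφ₀ : ContDiff ℝ ∞ φ₀)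
    (h : IsSchrodinger V φ₀ B₀ b) (β : MIdx n) : RaySmooth (b.φ β) := by
  refine raySmooth_of_smoothFamily_series (c := b.φ) (fun β => ?_) β
  change RaySmooth fun t z => coeff β (b.phaseSeries z t)
  have hdiv : ∀ β, RaySmooth (b.φ β) → RaySmooth fun t z => coeff β (b.phaseSeries z t) :=
    fun β hβ => hβ.contDiffOn.div_const _
  have h_initial : ∀ β : MIdx n, ContDiff ℝ ∞ fun z => coeff β (b.phaseSeries z 0) := fun β =>
    (h.phase_init.contDiff_phi hφ₀ β).div_const _
  induction hd : β.degree using Nat.strong_induction_on generalizing β with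
  | _ m ih =>
    rcases Nat.lt_or_ge m 3 with hm | hm
    · refine hdiv β ?_
      interval_cases m
      · rw [(Finsupp.degree_eq_zero_iff _).1 hd]
        have hr : RaySmooth fun t z => ((‖b.p t z‖ ^ 2 / 2 - V (b.x t z) : ℝ) : ℂ) :=
          contDiff_ofReal.comp_contDiffOn (h.raySmooth_phi0_deriv hV hφ₀)
        exact hr.of_deriv h.phi0 (h.phase_init.contDiff_phi hφ₀ 0)
      · obtain ⟨i, rfl⟩ := exists_eq_single_of_degree_eq_one hd
        have : RaySmooth fun t z => (b.p t z i : ℂ) := contDiff_ofReal.comp_contDiffOn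
          ((EuclideanSpace.proj (𝕜 := ℝ) i).contDiff.comp_contDiffOn (h.raySmooth_p hV hφ₀))
        exact this.congr fun t ht z => h.phase_init.first_order z t ht i
      · obtain ⟨i, l, rfl⟩ := exists_eq_add_single_of_degree_eq_two hd
        exact h.raySmooth_phi_two hV hφ₀ i l
    · refine contDiffOn_coeff_of_system (F := phaseField V b m) (fun β => ?_)
        (fun z t ht β => h.hasDerivWithinAt_phase hm z ht β) h_initial hd
      have hfill : SmoothFamily (Ici 0 ×ˢ (univ ×ˢ univ))
          (fun q : ℝ × Pt n × ({β // β ∈ ofDegree n m} → ℂ) =>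
            fillSeries m (b.phaseSeries q.2.1 q.1) q.2.2) :=
        SmoothFamily.fillSeries m (fun β hβ => contDiffOn_lift (ih β.degree hβ β rfl).contDiffOn)
          (by apply ContDiff.contDiffOn; fun_prop)
      refine ContDiffOn.div_const (ContDiffOn.sub ?_ ?_) _
      · refine contDiffOn_const.mul (ContDiffOn.sum fun l _ => ContDiffOn.sum fun γ _ => ?_)
        exact (contDiffOn_const.mul ((hfill _).mul contDiffOn_const)).mul
          ((hfill _).mul contDiffOn_const)
      · exact contDiffOn_lift (contDiff_ofReal.comp_contDiffOn
          ((contDiff_mderiv hV β.1).comp_contDiffOn (h.raySmooth_x hV hφ₀).contDiffOn))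

/-- The coefficient of `∂_i a_j` is `∂_i Φ - ∂_t x_i`, whose value on the ray is `p_i - p_i = 0`. -/
lemma isTransport (hV : ContDiff ℝ ∞ V) (hφ₀ : ContDiff ℝ ∞ φ₀) (hB₀ : ContDiff ℝ ∞ B₀)
    (h : IsSchrodinger V φ₀ B₀ b) (j : ℕ)
    (hprev : SmoothFamily (rayDomain n) fun q => b.prevAmpSeries j q.2 q.1) :
    IsTransport (fun _ => 1)
      (fun i q => pderiv ℂ i (b.phaseSeries q.2 q.1) - velocity b i q • (1 : Series n))
      (fun q => (1 / 2 : ℂ) • lap (b.phaseSeries q.2 q.1))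
      (fun q => (Complex.I / 2) • lap (b.prevAmpSeries j q.2 q.1)) (b.ampSeries j) := by
  have hΦ := smoothFamily_phaseSeries (h.raySmooth_phi hV hφ₀)
  have hx := h.raySmooth_x hV hφ₀
  refine
    { smooth_W := SmoothFamily.const 1
      smooth_K := fun i => (hΦ.pderiv i).sub
        (SmoothFamily.smul (contDiffOn_velocity hx i) (SmoothFamily.const 1))
      smooth_L := SmoothFamily.smul contDiffOn_const hΦ.lap
      smooth_H := SmoothFamily.smul contDiffOn_const hprev.lap
      W_ne := fun q _ => by simp
      K_zero := fun i q hq => ?_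
      diff := fun z β => (h.amp_diff z j β).div_const _
      eqn := fun z t ht => ?_
      initial := fun β => ?_ }
  · rw [map_sub, h.phase_init.constantCoeff_pderiv q.2 hq.1, velocity_eq hq.1 (h.ray q.2 q.1 hq.1),
      smul_eq_C_mul, map_mul, constantCoeff_C, map_one, mul_one, sub_self]
  · rw [← h.transport z t ht j, dt_eq_sub_sum_velocity]
    simp only [gradDot, sub_mul, Finset.sum_sub_distrib, smul_mul_assoc, one_mul]
    rw [mul_comm (b.ampSeries j z t) (lap _)]
    simp only [mul_comm (pderiv ℂ _ (b.phaseSeries z t))]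
    abel
  · have : (fun z => coeff β (b.ampSeries j z 0)) = fun z =>
        (if j = 0 then ((mderiv β B₀ z : ℝ) : ℂ) else 0) / (mfact β : ℂ) := by
      funext z
      rw [Coeffs.ampSeries, coeff_series, h.amp_zero]
    rw [this]
    refine ContDiff.div_const ?_ _
    split_ifs
    · exact contDiff_ofReal.comp (contDiff_mderiv hB₀ β)
    · exact contDiff_const

lemma smoothFamily_ampSeries (hV : ContDiff ℝ ∞ V) (hφ₀ : ContDiff ℝ ∞ φ₀)
    (hB₀ : ContDiff ℝ ∞ B₀) (h : IsSchrodinger V φ₀ B₀ b) (j : ℕ) :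
    SmoothFamily (rayDomain n) fun q => b.ampSeries j q.2 q.1 := by
  induction j with
  | zero => exact (h.isTransport hV hφ₀ hB₀ 0 (SmoothFamily.const 0)).smoothFamily
  | succ j ih => exact (h.isTransport hV hφ₀ hB₀ (j + 1) ih).smoothFamily

/-- Off the support of `B₀` all initial coefficients vanish, and by induction on `j` so does the
source of each linear transport equation. -/
lemma ampSeries_eq_zero (hV : ContDiff ℝ ∞ V) (hφ₀ : ContDiff ℝ ∞ φ₀)
    (hB₀ : ContDiff ℝ ∞ B₀) (h : IsSchrodinger V φ₀ B₀ b) {z : Pt n} (hz : z ∉ tsupport B₀)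
    (j : ℕ) {t : ℝ} (ht : 0 ≤ t) : b.ampSeries j z t = 0 := by
  have h_initial : ∀ j, b.ampSeries j z 0 = 0 := fun j => by
    ext β
    rw [Coeffs.ampSeries, coeff_series, h.amp_zero, mderiv_eq_zero_of_notMem_tsupport hz]
    simp
  induction j generalizing t with
  | zero =>
    exact (h.isTransport hV hφ₀ hB₀ 0 (SmoothFamily.const 0)).eq_zero
      (fun t _ => by simp [Coeffs.prevAmpSeries, lap]) (h_initial 0) ht
  | succ j ih =>
    exact (h.isTransport hV hφ₀ hB₀ (j + 1) (h.smoothFamily_ampSeries hV hφ₀ hB₀ j)).eq_zero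
      (fun t ht => by simp [Coeffs.prevAmpSeries, lap, ih ht]) (h_initial _) ht

theorem isRegularMode (hV : ContDiff ℝ ∞ V) (hφ₀ : ContDiff ℝ ∞ φ₀)
    (hB₀ : ContDiff ℝ ∞ B₀) (h : IsSchrodinger V φ₀ B₀ b) {K₀ : Set (Pt n)}
    (hK₀ : tsupport B₀ ⊆ K₀) : IsRegularMode K₀ b where
  x_smooth := h.raySmooth_x hV hφ₀
  p_smooth := h.raySmooth_p hV hφ₀
  φ_smooth := h.raySmooth_phi hV hφ₀
  a_smooth j := raySmooth_of_smoothFamily_series (h.smoothFamily_ampSeries hV hφ₀ hB₀ j)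
  φ_real t ht z := im_eq_zero_of_deriv (fun t ht => h.phi0 z t ht)
    (by rw [h.phase_init.phi0_zero]; simp) ht
  isotropic t ht z l := by
    refine isotropic_of_deriv hφ₀ (h.raySmooth_p hV hφ₀) (h.raySmooth_phi0_deriv hV hφ₀) h.ray
      h.direction h.phi0 h.phase_init.x_zero h.phase_init.p_zero h.phase_init.phi0_zero
      (fun t ht z v => ?_) ht z l
    have hp := ((h.raySmooth_p hV hφ₀).contDiff_slice ht).differentiable (by simp) z
    have hx := ((h.raySmooth_x hV hφ₀).contDiff_slice ht).differentiable (by simp) z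
    have hVx := (hV.differentiable (by simp) (b.x t z)).hasFDerivAt.comp z hx.hasFDerivAt
    -- Here `∂_t x = p` and `∂_t p = -∇V(x)`, so both sides equal `⟪p, D_z p v⟫ - ⟪∇V(x), D_z x v⟫`,
    -- the derivative of the phase rate `|p|²/2 - V(x)`.
    have h1 := ((hp.hasFDerivAt.norm_sq).mul_const (1 / 2 : ℝ)).sub hVx
    have h2 : (fun z => ‖b.p t z‖ ^ 2 / 2 - V (b.x t z)) =
        (fun z => ‖b.p t z‖ ^ 2 * (1 / 2)) - V ∘ b.x t := by
      funext z; simp [div_eq_mul_inv]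
    rw [h2, h1.fderiv, inner_neg_left, inner_gradient]
    simp
    ring
  lower := lower_of_flow isOpen_univ (contDiff_hamiltonField hV).contDiffOn
    (h.raySmooth_ray hV hφ₀) (fun _ _ _ => trivial)
    (fun z t ht => (h.ray z t ht).prodMk (h.direction z t ht)) h.phase_init.x_zero
  supp := ⟨tsupport B₀, hK₀, isClosed_tsupport _, fun j β t ht z hz => by
    have h1 := congrArg (coeff β) (h.ampSeries_eq_zero hV hφ₀ hB₀ hz j ht)
    rw [Coeffs.ampSeries, coeff_series, map_zero, div_eq_zero_iff] at h1
    exact h1.resolve_right (mfact_ne_zero β)⟩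

end IsSchrodinger

end GaussianBeam

end

noncomputable section

namespace GaussianBeam

open MvPowerSeries
open scoped RealInnerProductSpace

variable {n : ℕ}

/-! ### The wave equation -/

lemma coeffDeriv_eq_zero {A : ℝ → Series n} (hA : ∀ s ≥ 0, A s = 0) {t : ℝ} (ht : 0 ≤ t) :
    coeffDeriv A t = 0 := by
  ext γ
  change derivWithin (fun s => coeff γ (A s)) (Ici 0) t = _
  have hz : EqOn (fun s => coeff γ (A s)) (fun _ => 0) (Ici 0) := fun s hs => by
    simp [hA s hs]
  rw [derivWithin_congr hz (hz ht)]
  simp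

lemma dt_eq_zero {x : ℝ → Pt n} {A : ℝ → Series n} (hA : ∀ s ≥ 0, A s = 0) {t : ℝ}
    (ht : 0 ≤ t) : dt x A t = 0 := by
  simp [dt, coeffDeriv_eq_zero hA ht, hA t ht]

namespace IsWaveMode

variable {c φ₀ : Pt n → ℝ} {σ : ℝ} {b : Coeffs n}

/-- The Hamiltonian vector field of the wave equation. -/
def hamiltonField (c : Pt n → ℝ) (σ : ℝ) (q : Pt n × Pt n) : Pt n × Pt n :=
  ((σ * c q.1 / ‖q.2‖) • q.2, -(σ * ‖q.2‖) • gradient c q.1)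

lemma isOpen_snd_ne_zero : IsOpen {q : Pt n × Pt n | q.2 ≠ 0} :=
  isOpen_ne_fun continuous_snd continuous_const

lemma contDiffOn_hamiltonField (hc : ContDiff ℝ ∞ c) :
    ContDiffOn ℝ ∞ (hamiltonField c σ) {q : Pt n × Pt n | q.2 ≠ 0} := by
  have h1 : ContDiffOn ℝ ∞ (fun q : Pt n × Pt n => ‖q.2‖) {q : Pt n × Pt n | q.2 ≠ 0} :=
    contDiff_snd.contDiffOn.norm ℝ fun q hq => hq
  have h2 : ContDiffOn ℝ ∞ (fun q : Pt n × Pt n => c q.1) {q : Pt n × Pt n | q.2 ≠ 0} :=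
    (hc.comp contDiff_fst).contDiffOn
  exact (((contDiffOn_const.mul h2).div h1 fun q hq => norm_ne_zero_iff.2 hq).smul
    contDiff_snd.contDiffOn).prodMk ((contDiffOn_const.mul h1).neg.smul
      ((contDiff_gradient hc).comp contDiff_fst).contDiffOn)

/-- Since `|∂_t p|` is at most a constant times `|p|` on bounded times, the backward estimate shows
that `p` can vanish only if it does so initially. This keeps the ray in the region where the
Hamiltonian field is smooth. -/
lemma p_ne_zero (hc : ContDiff ℝ ∞ c) (hδ : ∀ y, gradient φ₀ y ≠ 0) (h : IsWaveMode c φ₀ σ b)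
    {t : ℝ} (ht : 0 ≤ t) (z : Pt n) : b.p t z ≠ 0 := by
  have hcont : ContinuousOn (fun s => gradient c (b.x s z)) (Icc 0 t) :=
    (contDiff_gradient hc).continuous.comp_continuousOn fun s hs =>
      ((h.ray z s hs.1).continuousWithinAt).mono Icc_subset_Ici_self
  obtain ⟨L, hL⟩ := isCompact_Icc.exists_bound_of_continuousOn hcont
  have h1 := norm_le_exp_mul_norm_of_norm_deriv_le (h.direction z) ht (L := |σ| * L)
    (fun s hs => by
      rw [norm_smul, norm_neg, norm_mul, Real.norm_eq_abs, norm_norm]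
      calc |σ| * ‖b.p s z‖ * ‖gradient c (b.x s z)‖ ≤ |σ| * ‖b.p s z‖ * L := by
            gcongr; exact hL s hs
        _ = |σ| * L * ‖b.p s z‖ := by ring)
  intro h0
  rw [h0, norm_zero, zero_mul, norm_le_zero_iff, h.phase_init.p_zero] at h1
  exact hδ z h1

lemma raySmooth_ray (hc : ContDiff ℝ ∞ c) (hφ₀ : ContDiff ℝ ∞ φ₀) (hδ : ∀ y, gradient φ₀ y ≠ 0)
    (h : IsWaveMode c φ₀ σ b) : RaySmooth fun t z => (b.x t z, b.p t z) :=
  IsSolutionFamily.contDiffOn (F := fun q => hamiltonField c σ q.2.2)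
    (U := {q : Pt n × Pt n | q.2 ≠ 0})
    { isOpen := isOpen_snd_ne_zero
      smooth := (contDiffOn_hamiltonField hc).comp
        (contDiff_snd.comp contDiff_snd).contDiffOn fun q hq => hq.2.2
      mem := fun t ht z => h.p_ne_zero hc hδ ht z
      deriv := fun z t ht => (h.ray z t ht).prodMk (h.direction z t ht)
      initial := by
        have h0 : (fun z => (b.x 0 z, b.p 0 z)) = fun z => (z, gradient φ₀ z) := funext fun z => by
          rw [h.phase_init.x_zero, h.phase_init.p_zero]
        rw [h0]
        exact contDiff_id.prodMk (contDiff_gradient hφ₀) }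

lemma raySmooth_x (hc : ContDiff ℝ ∞ c) (hφ₀ : ContDiff ℝ ∞ φ₀) (hδ : ∀ y, gradient φ₀ y ≠ 0)
    (h : IsWaveMode c φ₀ σ b) : RaySmooth b.x :=
  contDiff_fst.comp_contDiffOn (h.raySmooth_ray hc hφ₀ hδ)

lemma raySmooth_p (hc : ContDiff ℝ ∞ c) (hφ₀ : ContDiff ℝ ∞ φ₀) (hδ : ∀ y, gradient φ₀ y ≠ 0)
    (h : IsWaveMode c φ₀ σ b) : RaySmooth b.p :=
  contDiff_snd.comp_contDiffOn (h.raySmooth_ray hc hφ₀ hδ)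

/-- The value of `d_t Φ` on the central ray. -/
def dtPhaseRay (c : Pt n → ℝ) (σ : ℝ) (b : Coeffs n) (q : ℝ × Pt n) : ℂ :=
  ((-(σ * c (b.x q.1 q.2) * ‖b.p q.1 q.2‖) : ℝ) : ℂ)

/-- As `φ_0` is constant in time, only `-∂_t x · p` contributes. -/
lemma constantCoeff_dtPhase (h : IsWaveMode c φ₀ σ b) (z : Pt n) {t : ℝ} (ht : 0 ≤ t)
    (hp : b.p t z ≠ 0) : constantCoeff (b.dtPhase z t) = dtPhaseRay c σ b (t, z) := by
  have h1 : constantCoeff (coeffDeriv (b.phaseSeries z) t) = 0 := by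
    rw [← coeff_zero_eq_constantCoeff_apply]
    change derivWithin (fun s => b.φ 0 s z / (mfact (0 : MIdx n) : ℂ)) (Ici 0) t = 0
    rw [((h.phi0 z t ht).div_const _).derivWithin (uniqueDiffOn_Ici 0 t ht), zero_div]
  have hn : ‖b.p t z‖ ≠ 0 := norm_ne_zero_iff.2 hp
  have h2 : ∑ i, (b.p t z i) ^ 2 = ‖b.p t z‖ ^ 2 := by
    rw [EuclideanSpace.real_norm_sq_eq]
  rw [Coeffs.dtPhase, dt_eq_sub_sum_velocity, map_sub, h1, map_sum, zero_sub]
  simp only [smul_eq_C_mul, map_mul, constantCoeff_C, velocity_eq ht (h.ray z t ht),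
    h.phase_init.constantCoeff_pderiv z ht, dtPhaseRay]
  have h3 : ∑ i, ((σ * c (b.x t z) / ‖b.p t z‖) • b.p t z) i * b.p t z i =
      σ * c (b.x t z) * ‖b.p t z‖ := by
    have : ∀ i, ((σ * c (b.x t z) / ‖b.p t z‖) • b.p t z) i * b.p t z i =
        σ * c (b.x t z) / ‖b.p t z‖ * b.p t z i ^ 2 := fun i => by
      rw [PiLp.smul_apply, smul_eq_mul]; ring
    simp only [this]
    rw [← Finset.mul_sum, h2]
    field_simp
  rw [Complex.ofReal_neg, ← h3]
  push_cast
  rfl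

lemma dtPhaseRay_ne_zero (hc₀ : ∀ y, 0 < c y) (hσ : σ * σ = 1) {q : ℝ × Pt n}
    (hp : b.p q.1 q.2 ≠ 0) : dtPhaseRay c σ b q ≠ 0 := by
  have h1 : σ ≠ 0 := fun h => by simp [h] at hσ
  have h2 : c (b.x q.1 q.2) ≠ 0 := (hc₀ _).ne'
  have h3 : ‖b.p q.1 q.2‖ ≠ 0 := norm_ne_zero_iff.2 hp
  simp [dtPhaseRay, h1, h2, h3]

/-- The cancellation condition on the ray required by `IsEikonal`; the sign disappears through `σ² =
1`. It also makes the first order coefficients of the transport equations vanish on the ray. -/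
lemma dtPhaseRay_mul_velocity (hσ : σ * σ = 1) (h : IsWaveMode c φ₀ σ b) (z : Pt n) {t : ℝ}
    (ht : 0 ≤ t) (hp : b.p t z ≠ 0) (i : Fin n) : dtPhaseRay c σ b (t, z) * velocity b i (t, z) =
      -(constantCoeff (taylor c (b.x t z) ^ 2) *
        constantCoeff (pderiv ℂ i (b.phaseSeries z t))) := by
  have hn : ‖b.p t z‖ ≠ 0 := norm_ne_zero_iff.2 hp
  rw [velocity_eq ht (h.ray z t ht), h.phase_init.constantCoeff_pderiv z ht, map_pow,
    constantCoeff_taylor, dtPhaseRay]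
  have : -(σ * c (b.x t z) * ‖b.p t z‖) * ((σ * c (b.x t z) / ‖b.p t z‖) • b.p t z) i =
      -(c (b.x t z) ^ 2 * b.p t z i) := by
    rw [PiLp.smul_apply, smul_eq_mul]
    field_simp
    linear_combination (-(c (b.x t z) ^ 2 * b.p t z i)) * hσ
  exact_mod_cast this

lemma smoothFamily_speed (hc : ContDiff ℝ ∞ c) (hx : RaySmooth b.x) :
    SmoothFamily (rayDomain n) fun q => taylor c (b.x q.1 q.2) ^ 2 := by
  have h1 := smoothFamily_taylor hc hx.contDiffOn
  exact (h1.mul h1).congr fun q _ => pow_two _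

lemma isEikonal (hc : ContDiff ℝ ∞ c) (hc₀ : ∀ y, 0 < c y) (hφ₀ : ContDiff ℝ ∞ φ₀)
    (hδ : ∀ y, gradient φ₀ y ≠ 0) (hσ : σ * σ = 1) (h : IsWaveMode c φ₀ σ b) :
    IsEikonal (fun q => taylor c (b.x q.1 q.2) ^ 2) (velocity b) (dtPhaseRay c σ b)
      b.phaseSeries := by
  have hx := h.raySmooth_x hc hφ₀ hδ
  have hp := h.raySmooth_p hc hφ₀ hδ
  refine
    { smooth_c2 := smoothFamily_speed hc hx
      smooth_v := contDiffOn_velocity hx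
      smooth_w := contDiff_ofReal.comp_contDiffOn ((contDiffOn_const.mul
        (hc.comp_contDiffOn hx)).mul (hp.contDiffOn.norm ℝ fun q hq =>
          h.p_ne_zero hc hδ hq.1 q.2)).neg
      smooth_low := fun β hβ => ?_
      diff := fun z β => ((h.phi_diff z β).differentiableOn (by norm_num)).div_const _
      w_ne := fun q hq => dtPhaseRay_ne_zero hc₀ hσ (h.p_ne_zero hc hδ hq.1 q.2)
      w_eq := fun z t ht => h.constantCoeff_dtPhase z ht (h.p_ne_zero hc hδ ht z)
      ray := fun z t ht i => h.dtPhaseRay_mul_velocity hσ z ht (h.p_ne_zero hc hδ ht z) i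
      eqn := h.eikonal
      initial := fun β => (h.phase_init.contDiff_phi hφ₀ β).div_const _ }
  suffices hs : RaySmooth (b.φ β) from hs.contDiffOn.div_const _
  interval_cases hd : β.degree
  · rw [(Finsupp.degree_eq_zero_iff _).1 hd]
    exact RaySmooth.of_deriv (f' := fun _ _ => 0) contDiffOn_const h.phi0
      (h.phase_init.contDiff_phi hφ₀ 0)
  · obtain ⟨i, rfl⟩ := exists_eq_single_of_degree_eq_one hd
    have : RaySmooth fun t z => (b.p t z i : ℂ) := contDiff_ofReal.comp_contDiffOn
      ((EuclideanSpace.proj (𝕜 := ℝ) i).contDiff.comp_contDiffOn hp)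
    exact this.congr fun t ht z => h.phase_init.first_order z t ht i

lemma raySmooth_phi (hc : ContDiff ℝ ∞ c) (hc₀ : ∀ y, 0 < c y) (hφ₀ : ContDiff ℝ ∞ φ₀)
    (hδ : ∀ y, gradient φ₀ y ≠ 0) (hσ : σ * σ = 1) (h : IsWaveMode c φ₀ σ b) (β : MIdx n) :
    RaySmooth (b.φ β) :=
  raySmooth_of_smoothFamily_series (h.isEikonal hc hc₀ hφ₀ hδ hσ).raySmooth β

lemma smoothFamily_dtPhase (hc : ContDiff ℝ ∞ c) (hc₀ : ∀ y, 0 < c y) (hφ₀ : ContDiff ℝ ∞ φ₀)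
    (hδ : ∀ y, gradient φ₀ y ≠ 0) (hσ : σ * σ = 1) (h : IsWaveMode c φ₀ σ b) :
    SmoothFamily (rayDomain n) fun q => b.dtPhase q.2 q.1 :=
  SmoothFamily.dt (h.raySmooth_x hc hφ₀ hδ)
    (smoothFamily_phaseSeries (h.raySmooth_phi hc hc₀ hφ₀ hδ hσ))

/-- Normal form of the transport equation: `d_t a_j` is expanded as `∂_t a_j - ∂_t x · ∇a_j` and the
gradient terms are collected. -/
lemma transport_eq (h : IsWaveMode c φ₀ σ b) (z : Pt n) {t : ℝ} (ht : 0 ≤ t) (j : ℕ) :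
    (2 : ℂ) • b.dtPhase z t * coeffDeriv (b.ampSeries j z) t +
      ∑ i, (-2 : ℂ) • (velocity b i (t, z) • b.dtPhase z t +
        taylor c (b.x t z) ^ 2 * pderiv ℂ i (b.phaseSeries z t)) * pderiv ℂ i (b.ampSeries j z t) +
      (dt (fun s => b.x s z) (b.dtPhase z) t -
        taylor c (b.x t z) ^ 2 * lap (b.phaseSeries z t)) * b.ampSeries j z t =
    Complex.I • (dt (fun s => b.x s z) (dt (fun s => b.x s z) (b.prevAmpSeries j z)) t -
      taylor c (b.x t z) ^ 2 * lap (b.prevAmpSeries j z t)) := by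
  rw [← h.transport z t ht j, Coeffs.dtAmp, dt_eq_sub_sum_velocity z (b.ampSeries j z) t]
  generalize b.dtPhase z t = P
  generalize dt (fun s => b.x s z) (b.dtPhase z) t = P'
  generalize coeffDeriv (b.ampSeries j z) t = D
  generalize b.ampSeries j z t = A
  generalize b.phaseSeries z t = Φ
  generalize taylor c (b.x t z) = τ
  have h1 : ∑ i, (-2 : ℂ) • (velocity b i (t, z) • P + τ ^ 2 * pderiv ℂ i Φ) * pderiv ℂ i A =
      -(2 * P * ∑ i, velocity b i (t, z) • pderiv ℂ i A) - τ ^ 2 * (2 * gradDot A Φ) := by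
    simp only [gradDot, Finset.mul_sum]
    rw [← Finset.sum_neg_distrib, ← Finset.sum_sub_distrib]
    refine Finset.sum_congr rfl fun i _ => ?_
    simp only [smul_eq_C_mul, map_neg, map_ofNat]
    ring
  rw [h1]
  simp only [smul_eq_C_mul, map_ofNat]
  ring

lemma isTransport (hc : ContDiff ℝ ∞ c) (hc₀ : ∀ y, 0 < c y) (hφ₀ : ContDiff ℝ ∞ φ₀)
    (hδ : ∀ y, gradient φ₀ y ≠ 0) (hσ : σ * σ = 1) (h : IsWaveMode c φ₀ σ b) (j : ℕ)
    (hprev : SmoothFamily (rayDomain n) fun q => b.prevAmpSeries j q.2 q.1)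
    (h_initial : ∀ β : MIdx n, ContDiff ℝ ∞ fun z => coeff β (b.ampSeries j z 0)) :
    IsTransport (fun q => (2 : ℂ) • b.dtPhase q.2 q.1)
      (fun i q => (-2 : ℂ) • (velocity b i q • b.dtPhase q.2 q.1 +
        taylor c (b.x q.1 q.2) ^ 2 * pderiv ℂ i (b.phaseSeries q.2 q.1)))
      (fun q => dt (fun s => b.x s q.2) (b.dtPhase q.2) q.1 -
        taylor c (b.x q.1 q.2) ^ 2 * lap (b.phaseSeries q.2 q.1))
      (fun q => Complex.I • (dt (fun s => b.x s q.2)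
          (dt (fun s => b.x s q.2) (b.prevAmpSeries j q.2)) q.1 -
        taylor c (b.x q.1 q.2) ^ 2 * lap (b.prevAmpSeries j q.2 q.1))) (b.ampSeries j) := by
  have hx := h.raySmooth_x hc hφ₀ hδ
  have hΦ := smoothFamily_phaseSeries (h.raySmooth_phi hc hc₀ hφ₀ hδ hσ)
  have hdΦ := h.smoothFamily_dtPhase hc hc₀ hφ₀ hδ hσ
  have hc2 := smoothFamily_speed hc hx
  have hddΦ := SmoothFamily.dt (A := b.dtPhase) hx hdΦ
  have hdprev := SmoothFamily.dt (A := b.prevAmpSeries j) hx hprev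
  have hddprev := SmoothFamily.dt
    (A := fun z t => dt (fun s => b.x s z) (b.prevAmpSeries j z) t) hx hdprev
  refine
    { smooth_W := SmoothFamily.smul contDiffOn_const hdΦ
      smooth_K := fun i => SmoothFamily.smul contDiffOn_const
        ((SmoothFamily.smul (contDiffOn_velocity hx i) hdΦ).add (hc2.mul (hΦ.pderiv i)))
      smooth_L := hddΦ.sub (hc2.mul hΦ.lap)
      smooth_H := SmoothFamily.smul contDiffOn_const (hddprev.sub (hc2.mul hprev.lap))
      W_ne := fun q hq => ?_
      K_zero := fun i q hq => ?_
      diff := fun z β => ((h.amp_diff z j β).differentiableOn (by norm_num)).div_const _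
      eqn := fun z t ht => ?_
      initial := h_initial }
  · have hp := h.p_ne_zero hc hδ hq.1 q.2
    rw [smul_eq_C_mul, map_mul, constantCoeff_C, h.constantCoeff_dtPhase q.2 hq.1 hp]
    exact mul_ne_zero two_ne_zero (dtPhaseRay_ne_zero hc₀ hσ hp)
  · have hp := h.p_ne_zero hc hδ hq.1 q.2
    have h1 := h.dtPhaseRay_mul_velocity hσ q.2 hq.1 hp i
    rw [smul_eq_C_mul, smul_eq_C_mul, map_mul, map_add, map_mul, map_mul, constantCoeff_C,
      constantCoeff_C, h.constantCoeff_dtPhase q.2 hq.1 hp, mul_comm (velocity b i q), h1,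
      neg_add_cancel, mul_zero]
  · exact h.transport_eq z ht j

/-- The Hamiltonian `σ c |p|` is homogeneous of degree one in `p`, so the phase is constant along
rays. Differentiating `|p| ∂_t x = σ c(x) p` in `z` and pairing with `p`, the terms containing `D_z
p` cancel; what remains balances `⟪∂_t p, D_z x v⟫`. -/
theorem isotropic (hc : ContDiff ℝ ∞ c) (hφ₀ : ContDiff ℝ ∞ φ₀)
    (hδ : ∀ y, gradient φ₀ y ≠ 0) (h : IsWaveMode c φ₀ σ b) {t : ℝ}
    (ht : 0 ≤ t) (z : Pt n) (l : Fin n) :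
    ∑ i, ((pd l (b.x t) z i : ℝ) : ℂ) * (b.p t z i : ℂ) = pd l (b.φ 0 t) z := by
  have hxs := h.raySmooth_x hc hφ₀ hδ
  have hps := h.raySmooth_p hc hφ₀ hδ
  have hfield : RaySmooth fun t z => (σ * c (b.x t z) / ‖b.p t z‖) • b.p t z :=
    contDiff_fst.comp_contDiffOn ((contDiffOn_hamiltonField (σ := σ) hc).comp
      (h.raySmooth_ray hc hφ₀ hδ).contDiffOn fun q hq => h.p_ne_zero hc hδ hq.1 q.2)
  refine isotropic_of_deriv (r := fun _ _ => 0) hφ₀ hfield contDiffOn_const h.ray h.direction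
    (by simpa using h.phi0) h.phase_init.x_zero h.phase_init.p_zero h.phase_init.phi0_zero
    (fun t ht z v => ?_) ht z l
  have hp := (hps.contDiff_slice ht).differentiable (by simp) z
  have hx := (hxs.contDiff_slice ht).differentiable (by simp) z
  have hp0 := h.p_ne_zero hc hδ ht z
  have hn0 : ‖b.p t z‖ ≠ 0 := norm_ne_zero_iff.2 hp0
  have hN : DifferentiableAt ℝ (fun z => ‖b.p t z‖) z := hp.norm ℝ hp0
  have hf := (hfield.contDiff_slice ht).differentiable (by simp) z
  have hcx := ((hc.differentiable (by simp) (b.x t z)).hasFDerivAt.comp z hx.hasFDerivAt).const_mul σ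
  have h1 := (hN.hasFDerivAt.smul hf.hasFDerivAt).fderiv
  have h2 := (hcx.smul hp.hasFDerivAt).fderiv
  -- Multiplying the velocity by `‖p‖` avoids differentiating a quotient.
  have h3 : (fun z => ‖b.p t z‖) • (fun z => (σ * c (b.x t z) / ‖b.p t z‖) • b.p t z) =
      (fun z => σ * (c ∘ b.x t) z) • b.p t := by
    funext z
    have : ‖b.p t z‖ ≠ 0 := norm_ne_zero_iff.2 (h.p_ne_zero hc hδ ht z)
    simp only [Pi.smul_apply', smul_smul, Function.comp]
    congr 1
    field_simp
  have h4 := congrArg (fun T : Pt n →L[ℝ] Pt n => ⟪b.p t z, T v⟫) (h1.symm.trans ((congrArg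
    (fun g => fderiv ℝ g z) h3).trans h2))
  have h5 := (hN.hasFDerivAt.pow 2).unique hp.hasFDerivAt.norm_sq
  have h6 := congrArg (fun T : Pt n →L[ℝ] ℝ => T v) h5
  simp [inner_add_right, inner_smul_right] at h4 h6
  rw [inner_smul_left, inner_gradient]
  simp only [map_neg, map_mul, RCLike.conj_to_real, zero_apply,
    fderiv_fun_const, Pi.zero_apply, neg_mul]
  refine mul_left_cancel₀ hn0 ?_
  have h7 : σ * c (b.x t z) / ‖b.p t z‖ * ‖b.p t z‖ ^ 2 = σ * c (b.x t z) * ‖b.p t z‖ := by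
    field_simp
  rw [h7] at h4
  linear_combination h4 - σ * c (b.x t z) / 2 * h6

lemma smoothFamily_inv_dtPhase (hc : ContDiff ℝ ∞ c) (hc₀ : ∀ y, 0 < c y)
    (hφ₀ : ContDiff ℝ ∞ φ₀) (hδ : ∀ y, gradient φ₀ y ≠ 0) (hσ : σ * σ = 1)
    (h : IsWaveMode c φ₀ σ b) :
    SmoothFamily univ fun z => (Complex.I • b.dtPhase z 0)⁻¹ := by
  refine SmoothFamily.inv (SmoothFamily.smul contDiffOn_const
    ((h.smoothFamily_dtPhase hc hc₀ hφ₀ hδ hσ).comp (f := fun z => ((0 : ℝ), z))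
      (contDiff_prodMk_right 0).contDiffOn fun z _ => ⟨mem_Ici.2 le_rfl, trivial⟩)) fun z _ => ?_
  have hp := h.p_ne_zero hc hδ le_rfl z
  rw [smul_eq_C_mul, map_mul, constantCoeff_C, h.constantCoeff_dtPhase z le_rfl hp]
  exact mul_ne_zero Complex.I_ne_zero (dtPhaseRay_ne_zero hc₀ hσ hp)

lemma contDiff_ampSeries_zero (hc : ContDiff ℝ ∞ c) (hc₀ : ∀ y, 0 < c y)
    (hφ₀ : ContDiff ℝ ∞ φ₀) (hδ : ∀ y, gradient φ₀ y ≠ 0) (hσ : σ * σ = 1)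
    (h : IsWaveMode c φ₀ σ b) {B₀ B₁ : Pt n → ℝ} (hB₀ : ContDiff ℝ ∞ B₀) (hB₁ : ContDiff ℝ ∞ B₁)
    {bp bm : Coeffs n} (hi : WaveAmpInit B₀ B₁ bp bm b) (β : MIdx n) :
    ContDiff ℝ ∞ fun z => coeff β (b.ampSeries 0 z 0) := by
  have h1 : SmoothFamily univ fun z => b.ampSeries 0 z 0 :=
    (SmoothFamily.smul contDiffOn_const ((smoothFamily_taylor hB₀ contDiffOn_id).add
      ((smoothFamily_taylor hB₁ contDiffOn_id).mul
        (h.smoothFamily_inv_dtPhase hc hc₀ hφ₀ hδ hσ)))).congr fun z _ => hi.zero z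
  exact contDiffOn_univ.1 (h1 β)

lemma contDiff_ampSeries_succ (hc : ContDiff ℝ ∞ c) (hc₀ : ∀ y, 0 < c y)
    (hφ₀ : ContDiff ℝ ∞ φ₀) (hδ : ∀ y, gradient φ₀ y ≠ 0) (hσ : σ * σ = 1)
    (h : IsWaveMode c φ₀ σ b) {B₀ B₁ : Pt n → ℝ} {bp bm : Coeffs n}
    (hi : WaveAmpInit B₀ B₁ bp bm b) {j : ℕ} (hxp : RaySmooth bp.x) (hxm : RaySmooth bm.x)
    (hap : SmoothFamily (rayDomain n) fun q => bp.ampSeries j q.2 q.1)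
    (ham : SmoothFamily (rayDomain n) fun q => bm.ampSeries j q.2 q.1) (β : MIdx n) :
    ContDiff ℝ ∞ fun z => coeff β (b.ampSeries (j + 1) z 0) := by
  have hdt : ∀ {b' : Coeffs n}, RaySmooth b'.x →
      SmoothFamily (rayDomain n) (fun q => b'.ampSeries j q.2 q.1) →
      SmoothFamily univ fun z => b'.dtAmp j z 0 := fun hx ha =>
    (SmoothFamily.dt hx ha).comp (f := fun z => ((0 : ℝ), z))
      (contDiff_prodMk_right 0).contDiffOn fun z _ => ⟨mem_Ici.2 le_rfl, trivial⟩
  have h1 : SmoothFamily univ fun z => b.ampSeries (j + 1) z 0 :=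
    (SmoothFamily.smul contDiffOn_const (((hdt hxp hap).add (hdt hxm ham)).mul
        (h.smoothFamily_inv_dtPhase hc hc₀ hφ₀ hδ hσ))).congr fun z _ => hi.succ z j
  exact contDiffOn_univ.1 (h1 β)

theorem isRegularMode (hc : ContDiff ℝ ∞ c) (hc₀ : ∀ y, 0 < c y)
    (hφ₀ : ContDiff ℝ ∞ φ₀) (hδ : ∀ y, gradient φ₀ y ≠ 0) (hσ : σ * σ = 1)
    (h : IsWaveMode c φ₀ σ b) {K₀ S : Set (Pt n)} (hS : IsClosed S) (hSK : S ⊆ K₀)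
    (ha : ∀ j, SmoothFamily (rayDomain n) fun q => b.ampSeries j q.2 q.1)
    (ha0 : ∀ j, ∀ z ∉ S, ∀ t ≥ 0, b.ampSeries j z t = 0) : IsRegularMode K₀ b where
  x_smooth := h.raySmooth_x hc hφ₀ hδ
  p_smooth := h.raySmooth_p hc hφ₀ hδ
  φ_smooth := h.raySmooth_phi hc hc₀ hφ₀ hδ hσ
  a_smooth j := raySmooth_of_smoothFamily_series (ha j)
  φ_real t ht z := im_eq_zero_of_deriv (r := fun _ => 0) (by simpa using h.phi0 z)
    (by rw [h.phase_init.phi0_zero]; simp) ht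
  isotropic t ht z l := h.isotropic hc hφ₀ hδ ht z l
  lower := lower_of_flow isOpen_snd_ne_zero (contDiffOn_hamiltonField hc)
    (h.raySmooth_ray hc hφ₀ hδ) (fun t ht z => h.p_ne_zero hc hδ ht z)
    (fun z t ht => (h.ray z t ht).prodMk (h.direction z t ht)) h.phase_init.x_zero
  supp := ⟨S, hSK, hS, fun j β t ht z hz => by
    have h1 := congrArg (coeff β) (ha0 j z hz t ht)
    rw [Coeffs.ampSeries, coeff_series, map_zero, div_eq_zero_iff] at h1
    exact h1.resolve_right (mfact_ne_zero β)⟩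

end IsWaveMode

/-! ### The two coupled modes of the wave equation -/

namespace IsWave

variable {c φ₀ B₀ B₁ : Pt n → ℝ} {bp bm : Coeffs n}

/-- The modes are treated together because the initial value of either amplitude of order `j + 1`
contains the time derivatives of both amplitudes of order `j`. -/
lemma smoothFamily_ampSeries (hc : ContDiff ℝ ∞ c) (hc₀ : ∀ y, 0 < c y)
    (hφ₀ : ContDiff ℝ ∞ φ₀) (hδ : ∀ y, gradient φ₀ y ≠ 0) (hB₀ : ContDiff ℝ ∞ B₀)
    (hB₁ : ContDiff ℝ ∞ B₁) (h : IsWave c φ₀ B₀ B₁ bp bm) (j : ℕ) :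
    (SmoothFamily (rayDomain n) fun q => bp.ampSeries j q.2 q.1) ∧
      SmoothFamily (rayDomain n) fun q => bm.ampSeries j q.2 q.1 := by
  have hσp : (1 : ℝ) * 1 = 1 := by norm_num
  have hσm : (-1 : ℝ) * -1 = 1 := by norm_num
  induction j with
  | zero =>
    exact ⟨(h.plus.isTransport hc hc₀ hφ₀ hδ hσp 0 (SmoothFamily.const 0)
        (h.plus.contDiff_ampSeries_zero hc hc₀ hφ₀ hδ hσp hB₀ hB₁ h.amp_plus)).smoothFamily,
      (h.minus.isTransport hc hc₀ hφ₀ hδ hσm 0 (SmoothFamily.const 0)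
        (h.minus.contDiff_ampSeries_zero hc hc₀ hφ₀ hδ hσm hB₀ hB₁ h.amp_minus)).smoothFamily⟩
  | succ j ih =>
    have hxp := h.plus.raySmooth_x hc hφ₀ hδ
    have hxm := h.minus.raySmooth_x hc hφ₀ hδ
    exact ⟨(h.plus.isTransport hc hc₀ hφ₀ hδ hσp (j + 1) ih.1
        (h.plus.contDiff_ampSeries_succ hc hc₀ hφ₀ hδ hσp h.amp_plus hxp hxm
          ih.1 ih.2)).smoothFamily,
      (h.minus.isTransport hc hc₀ hφ₀ hδ hσm (j + 1) ih.2
        (h.minus.contDiff_ampSeries_succ hc hc₀ hφ₀ hδ hσm h.amp_minus hxp hxm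
          ih.1 ih.2)).smoothFamily⟩

lemma ampSeries_eq_zero (hc : ContDiff ℝ ∞ c) (hc₀ : ∀ y, 0 < c y)
    (hφ₀ : ContDiff ℝ ∞ φ₀) (hδ : ∀ y, gradient φ₀ y ≠ 0) (hB₀ : ContDiff ℝ ∞ B₀)
    (hB₁ : ContDiff ℝ ∞ B₁) (h : IsWave c φ₀ B₀ B₁ bp bm) {z : Pt n} (hz₀ : z ∉ tsupport B₀)
    (hz₁ : z ∉ tsupport B₁) (j : ℕ) :
    (∀ t ≥ 0, bp.ampSeries j z t = 0) ∧ ∀ t ≥ 0, bm.ampSeries j z t = 0 := by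
  have hσp : (1 : ℝ) * 1 = 1 := by norm_num
  have hσm : (-1 : ℝ) * -1 = 1 := by norm_num
  have hzero : ∀ {b : Coeffs n}, WaveAmpInit B₀ B₁ bp bm b → b.ampSeries 0 z 0 = 0 := fun hi => by
    rw [hi.zero, taylor_eq_zero_of_notMem_tsupport hz₀, taylor_eq_zero_of_notMem_tsupport hz₁]
    simp
  induction j with
  | zero =>
    refine ⟨fun t ht => (h.plus.isTransport hc hc₀ hφ₀ hδ hσp 0 (SmoothFamily.const 0)
        (h.plus.contDiff_ampSeries_zero hc hc₀ hφ₀ hδ hσp hB₀ hB₁ h.amp_plus)).eq_zero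
        (fun t ht => ?_) (hzero h.amp_plus) ht,
      fun t ht => (h.minus.isTransport hc hc₀ hφ₀ hδ hσm 0 (SmoothFamily.const 0)
        (h.minus.contDiff_ampSeries_zero hc hc₀ hφ₀ hδ hσm hB₀ hB₁ h.amp_minus)).eq_zero
        (fun t ht => ?_) (hzero h.amp_minus) ht⟩
    all_goals
      have h1 := fun (x : ℝ → Pt n) (s : ℝ) (hs : s ≥ 0) =>
        dt_eq_zero (x := x) (A := fun _ => 0) (fun _ _ => rfl) hs
      simp only [Coeffs.prevAmpSeries]
      rw [dt_eq_zero (h1 _) ht]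
      simp [lap]
  | succ j ih =>
    have hs := h.smoothFamily_ampSeries hc hc₀ hφ₀ hδ hB₀ hB₁ j
    have hxp := h.plus.raySmooth_x hc hφ₀ hδ
    have hxm := h.minus.raySmooth_x hc hφ₀ hδ
    have hsucc : ∀ {b : Coeffs n}, WaveAmpInit B₀ B₁ bp bm b → b.ampSeries (j + 1) z 0 = 0 :=
      fun hi => by
        rw [hi.succ, Coeffs.dtAmp, Coeffs.dtAmp, dt_eq_zero ih.1 le_rfl, dt_eq_zero ih.2 le_rfl]
        simp
    refine ⟨fun t ht => (h.plus.isTransport hc hc₀ hφ₀ hδ hσp (j + 1) hs.1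
        (h.plus.contDiff_ampSeries_succ hc hc₀ hφ₀ hδ hσp h.amp_plus hxp hxm
          hs.1 hs.2)).eq_zero (fun t ht => ?_) (hsucc h.amp_plus) ht,
      fun t ht => (h.minus.isTransport hc hc₀ hφ₀ hδ hσm (j + 1) hs.2
        (h.minus.contDiff_ampSeries_succ hc hc₀ hφ₀ hδ hσm h.amp_minus hxp hxm
          hs.1 hs.2)).eq_zero (fun t ht => ?_) (hsucc h.amp_minus) ht⟩
    · simp only [Coeffs.prevAmpSeries]
      rw [dt_eq_zero (fun s hs => dt_eq_zero ih.1 hs) ht, ih.1 t ht]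
      simp [lap]
    · simp only [Coeffs.prevAmpSeries]
      rw [dt_eq_zero (fun s hs => dt_eq_zero ih.2 hs) ht, ih.2 t ht]
      simp [lap]

theorem isRegularMode (hc : ContDiff ℝ ∞ c) (hc₀ : ∀ y, 0 < c y)
    (hφ₀ : ContDiff ℝ ∞ φ₀) (hδ : ∀ y, gradient φ₀ y ≠ 0) (hB₀ : ContDiff ℝ ∞ B₀)
    (hB₁ : ContDiff ℝ ∞ B₁) (h : IsWave c φ₀ B₀ B₁ bp bm) {K₀ : Set (Pt n)}
    (hB₀K : tsupport B₀ ⊆ K₀) (hB₁K : tsupport B₁ ⊆ K₀) :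
    IsRegularMode K₀ bp ∧ IsRegularMode K₀ bm := by
  have hS : IsClosed (tsupport B₀ ∪ tsupport B₁) := (isClosed_tsupport _).union (isClosed_tsupport _)
  have ha := h.smoothFamily_ampSeries hc hc₀ hφ₀ hδ hB₀ hB₁
  have ha0 := fun (j : ℕ) (z : Pt n) (hz : z ∉ tsupport B₀ ∪ tsupport B₁) =>
    h.ampSeries_eq_zero hc hc₀ hφ₀ hδ hB₀ hB₁ (fun h0 => hz (Or.inl h0))
      (fun h0 => hz (Or.inr h0)) j
  exact ⟨h.plus.isRegularMode hc hc₀ hφ₀ hδ (by norm_num) hS (union_subset hB₀K hB₁K)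
      (fun j => (ha j).1) fun j z hz => (ha0 j z hz).1,
    h.minus.isRegularMode hc hc₀ hφ₀ hδ (by norm_num) hS (union_subset hB₀K hB₁K)
      (fun j => (ha j).2) fun j z hz => (ha0 j z hz).2⟩

end IsWave

end GaussianBeam

end

noncomputable section

namespace GaussianBeam

variable {n : ℕ}

/-! ### Weights -/

/-- Continuous bounded functions of a complex variable that are Lipschitz at the origin. -/
structure IsWeight (H : ℂ → ℂ) : Prop where
  continuous : Continuous H
  bounded : ∃ C > 0, ∀ w, ‖H w‖ ≤ C
  lipschitz : ∃ C > 0, ∀ w, ‖H w - H 0‖ ≤ C * ‖w‖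

lemma isWeight_one : IsWeight (fun _ => 1) :=
  ⟨continuous_const, ⟨1, one_pos, by simp⟩, ⟨1, one_pos, by simp⟩⟩

/-- Differentiability controls the difference quotient at `0` in a ball of radius `r`; farther out,
boundedness gives at most `2C / r`. -/
lemma IsWeight.of_differentiableAt {H : ℂ → ℂ} (hc : Continuous H) (hb : ∃ C > 0, ∀ w, ‖H w‖ ≤ C)
    (hd : DifferentiableAt ℝ H 0) : IsWeight H := by
  refine ⟨hc, hb, ?_⟩
  obtain ⟨C, hC, hCb⟩ := hb
  obtain ⟨D, hD, hDb⟩ := hd.isBigO_sub.exists_pos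
  obtain ⟨r, hr, hrb⟩ := Metric.eventually_nhds_iff.1 hDb.bound
  refine ⟨D + 2 * C / r, by positivity, fun w => ?_⟩
  have h0 : 0 ≤ ‖w‖ := norm_nonneg w
  by_cases hw : ‖w‖ < r
  · have := hrb (y := w) (by simpa using hw)
    rw [sub_zero] at this
    calc _ ≤ D * ‖w‖ := this
      _ ≤ _ := by gcongr; simp; positivity
  · push Not at hw
    calc ‖H w - H 0‖ ≤ ‖H w‖ + ‖H 0‖ := norm_sub_le _ _
      _ ≤ 2 * C * 1 := by linarith [hCb w, hCb 0]
      _ ≤ 2 * C * (‖w‖ / r) := by gcongr; rwa [one_le_div hr]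
      _ = 2 * C / r * ‖w‖ := by ring
      _ ≤ _ := by gcongr; simp [hD.le]

/-- The entire function `(e^w - 1) / w`. -/
def expQuot (w : ℂ) : ℂ := dslope Complex.exp 0 w

lemma mul_expQuot (w : ℂ) : w * expQuot w = Complex.exp w - 1 := by
  simpa [expQuot] using sub_smul_dslope Complex.exp 0 w

lemma differentiable_expQuot : Differentiable ℂ expQuot := by
  rw [← differentiableOn_univ]
  exact (Complex.differentiableOn_dslope Filter.univ_mem).2 Complex.differentiable_exp.differentiableOn

/-- Compactness on the unit disc; outside of it, division by `w` only helps. -/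
lemma exists_norm_expQuot_le : ∃ C > 0, ∀ w, ‖expQuot w‖ ≤ C * (1 + ‖Complex.exp w‖) := by
  obtain ⟨C, hC⟩ := (isCompact_closedBall (0 : ℂ) 1).exists_bound_of_continuousOn
    differentiable_expQuot.continuous.continuousOn
  refine ⟨|C| + 1, by positivity, fun w => ?_⟩
  have hE : 0 ≤ ‖Complex.exp w‖ := norm_nonneg _
  by_cases hw : ‖w‖ ≤ 1
  · have := hC w (by simpa using hw)
    nlinarith [abs_nonneg C, le_abs_self C]
  · push Not at hw
    have h1 : ‖w‖ * ‖expQuot w‖ ≤ ‖Complex.exp w‖ + 1 := by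
      rw [← norm_mul, mul_expQuot]
      simpa using norm_sub_le (Complex.exp w) 1
    have h2 : ‖expQuot w‖ ≤ ‖w‖ * ‖expQuot w‖ := le_mul_of_one_le_left (norm_nonneg _) hw.le
    nlinarith [abs_nonneg C]

/-- With `expWeightRight`, the two bounded parts of
`(e^w - 1) / w = expWeightLeft w + expWeightRight w * e^w`. -/
def expWeightLeft (w : ℂ) : ℂ := expQuot w / ((1 + ‖Complex.exp w‖ ^ 2 : ℝ) : ℂ)

def expWeightRight (w : ℂ) : ℂ :=
  expQuot w * (starRingEnd ℂ) (Complex.exp w) / ((1 + ‖Complex.exp w‖ ^ 2 : ℝ) : ℂ)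

lemma one_add_normSq_exp_ne_zero (w : ℂ) : ((1 + ‖Complex.exp w‖ ^ 2 : ℝ) : ℂ) ≠ 0 := by
  rw [Complex.ofReal_ne_zero]; positivity

/-- The partition `1 = 1/(1 + |e^w|²) + |e^w|²/(1 + |e^w|²)` separates the regions where `e^w` is
small and large; in the second summand one factor `e^w` of `|e^w|² = conj(e^w) e^w` is left outside.
By `|e^w - 1| / |w| ≤ C (1 + |e^w|)` both weights are bounded, whatever the sign of `Re w`. -/
lemma expWeight_add (w : ℂ) :
    w * (expWeightLeft w + expWeightRight w * Complex.exp w) = Complex.exp w - 1 := by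
  have h : (starRingEnd ℂ) (Complex.exp w) * Complex.exp w = ((‖Complex.exp w‖ ^ 2 : ℝ) : ℂ) := by
    rw [Complex.conj_mul']; push_cast; rfl
  have h0 := one_add_normSq_exp_ne_zero w
  rw [← mul_expQuot, expWeightLeft, expWeightRight]
  have : expQuot w * (starRingEnd ℂ) (Complex.exp w) / ((1 + ‖Complex.exp w‖ ^ 2 : ℝ) : ℂ) *
      Complex.exp w = expQuot w * ((‖Complex.exp w‖ ^ 2 : ℝ) : ℂ) /
        ((1 + ‖Complex.exp w‖ ^ 2 : ℝ) : ℂ) := by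
    rw [← h]; ring
  rw [this, ← add_div]
  rw [show expQuot w + expQuot w * ((‖Complex.exp w‖ ^ 2 : ℝ) : ℂ) =
    expQuot w * ((1 + ‖Complex.exp w‖ ^ 2 : ℝ) : ℂ) by push_cast; ring, mul_div_cancel_right₀ _ h0]

/-- Only real differentiability is available, as `|e^w|²` is not holomorphic. -/
lemma differentiable_div_one_add_normSq_exp {f : ℂ → ℂ} (hf : Differentiable ℝ f) :
    Differentiable ℝ (fun w => f w / ((1 + ‖Complex.exp w‖ ^ 2 : ℝ) : ℂ)) := by
  have hexp : Differentiable ℝ Complex.exp :=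
    (Complex.differentiable_exp (𝕜 := ℂ)).restrictScalars ℝ
  have hr : Differentiable ℝ (fun w : ℂ => (1 + ‖Complex.exp w‖ ^ 2)⁻¹) := fun w =>
    DifferentiableAt.fun_inv ((differentiable_const 1).add (hexp.norm_sq ℝ) w)
      (by positivity)
  have := hf.fun_mul (Complex.ofRealCLM.differentiable.comp hr)
  simpa [Function.comp_def, div_eq_mul_inv] using this

lemma isWeight_expWeightLeft : IsWeight expWeightLeft := by
  have hd : Differentiable ℝ expWeightLeft :=
    differentiable_div_one_add_normSq_exp (differentiable_expQuot.restrictScalars ℝ)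
  refine .of_differentiableAt hd.continuous ?_ (hd 0)
  obtain ⟨C, hC, h⟩ := exists_norm_expQuot_le
  refine ⟨2 * C, by positivity, fun w => ?_⟩
  rw [expWeightLeft, norm_div, Complex.norm_real, Real.norm_of_nonneg (by positivity),
    div_le_iff₀ (by positivity)]
  refine (h w).trans ?_
  rw [mul_comm 2 C, mul_assoc]
  gcongr
  nlinarith [sq_nonneg (‖Complex.exp w‖ - 1)]

lemma isWeight_expWeightRight : IsWeight expWeightRight := by
  have hexp : Differentiable ℝ Complex.exp :=
    (Complex.differentiable_exp (𝕜 := ℂ)).restrictScalars ℝ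
  have hd : Differentiable ℝ expWeightRight :=
    differentiable_div_one_add_normSq_exp ((differentiable_expQuot.restrictScalars ℝ).fun_mul
      (Complex.conjCLE.differentiable.comp hexp))
  refine .of_differentiableAt hd.continuous ?_ (hd 0)
  obtain ⟨C, hC, h⟩ := exists_norm_expQuot_le
  refine ⟨2 * C, by positivity, fun w => ?_⟩
  rw [expWeightRight, norm_div, Complex.norm_real, Real.norm_of_nonneg (by positivity),
    div_le_iff₀ (by positivity), norm_mul, RCLike.norm_conj]
  calc ‖expQuot w‖ * ‖Complex.exp w‖ ≤ C * (1 + ‖Complex.exp w‖) * ‖Complex.exp w‖ := by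
        gcongr; exact h w
    _ = C * ((1 + ‖Complex.exp w‖) * ‖Complex.exp w‖) := by ring
    _ ≤ C * (2 * (1 + ‖Complex.exp w‖ ^ 2)) := by
        refine mul_le_mul_of_nonneg_left ?_ hC.le
        nlinarith [sq_nonneg (‖Complex.exp w‖ - 1)]
    _ = _ := by ring

/-! ### Bounds for ray functions -/

lemma RaySmooth.exists_bound {G : Type*} [NormedAddCommGroup G] [NormedSpace ℝ G]
    {f : ℝ → Pt n → G} (hf : RaySmooth f) (T : ℝ) {K : Set (Pt n)} (hK : IsCompact K) :
    ∃ C > 0, ∀ t ∈ Icc 0 T, ∀ z ∈ K, ‖f t z‖ ≤ C := by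
  obtain ⟨C, hC⟩ := (isCompact_Icc.prod hK).exists_bound_of_continuousOn
    (hf.contDiffOn.continuousOn.mono (t := Icc 0 T ×ˢ K)
      (prod_mono Icc_subset_Ici_self (subset_univ _)))
  exact ⟨|C| + 1, by positivity, fun t ht z hz =>
    (hC (t, z) ⟨ht, hz⟩).trans (by linarith [le_abs_self C])⟩

/-- No convexity of `K` is needed: smoothness gives local Lipschitz bounds on the convex set `[0, ∞)
× ℝⁿ`, and compactness turns them into one global bound. -/
lemma RaySmooth.exists_lipschitz {G : Type*} [NormedAddCommGroup G] [NormedSpace ℝ G]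
    {f : ℝ → Pt n → G} (hf : RaySmooth f) (T : ℝ) {K : Set (Pt n)} (hK : IsCompact K) :
    ∃ L > 0, ∀ t ∈ Icc 0 T, ∀ z ∈ K, ∀ z' ∈ K, ‖f t z - f t z'‖ ≤ L * ‖z - z'‖ := by
  have hsub : Icc 0 T ×ˢ K ⊆ Ici (0 : ℝ) ×ˢ (univ : Set (Pt n)) :=
    prod_mono Icc_subset_Ici_self (subset_univ _)
  have hloc : LocallyLipschitzOn (Icc 0 T ×ˢ K) (fun q : ℝ × Pt n => f q.1 q.2) := by
    intro q hq
    obtain ⟨L, t, ht, hL⟩ := ((hf.contDiffOn q (hsub hq)).of_le (m := 1)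
      (by simp)).exists_lipschitzOnWith ((convex_Ici 0).prod convex_univ)
    exact ⟨L, t, nhdsWithin_mono _ hsub ht, hL⟩
  obtain ⟨L, hL⟩ := hloc.exists_lipschitzOnWith_of_compact (isCompact_Icc.prod hK)
  refine ⟨L + 1, by positivity, fun t ht z hz z' hz' => ?_⟩
  have := hL.norm_sub_le (x := (t, z)) ⟨ht, hz⟩ (y := (t, z')) ⟨ht, hz'⟩
  refine this.trans ?_
  rw [Prod.mk_sub_mk, sub_self, Prod.norm_mk, norm_zero, max_eq_right (norm_nonneg _)]
  gcongr
  simp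

/-! ### Monomials -/

lemma abs_mpow_le (y : Pt n) (β : MIdx n) : |mpow y β| ≤ ‖y‖ ^ β.degree := by
  rw [mpow, Finset.abs_prod, Finsupp.degree_eq_sum, ← Finset.prod_pow_eq_pow_sum]
  refine Finset.prod_le_prod (fun i _ => abs_nonneg _) fun i _ => ?_
  rw [abs_pow]
  gcongr
  exact PiLp.norm_apply_le y i

lemma mpow_add (y : Pt n) (β γ : MIdx n) : mpow y (β + γ) = mpow y β * mpow y γ := by
  simp [mpow, pow_add, Finset.prod_mul_distrib]

lemma contDiff_mpow (β : MIdx n) : ContDiff ℝ ∞ (fun y : Pt n => mpow y β) := by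
  unfold mpow
  fun_prop

lemma contDiff_coord (i : Fin n) : ContDiff ℝ ∞ (fun y : Pt n => y i) := by fun_prop

end GaussianBeam
end

noncomputable section

namespace GaussianBeam

variable {n : ℕ}

/-! ### Beam phases -/

/-- The difference of the beam phases of orders `k + p` and `k`. -/
def Coeffs.phaseRest (b : Coeffs n) (k p : ℕ) (t : ℝ) (y z : Pt n) : ℂ :=
  ∑ m ∈ Finset.Icc (k + 2) (k + p + 1), ∑ β ∈ ofDegree n m,
    1 / (mfact β : ℂ) * b.φ β t z * (mpow y β : ℂ)

lemma Coeffs.phase_add (b : Coeffs n) {k : ℕ} (hk : 1 ≤ k) (p : ℕ) (t : ℝ) (y z : Pt n) :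
    b.phase (k + p) t y z = b.phase k t y z + b.phaseRest k p t y z := by
  rw [phase, phase, phaseRest, add_assoc _ (∑ m ∈ _, _) (∑ m ∈ _, _)]
  congr 1
  simp only [← Finset.Ico_add_one_right_eq_Icc]
  -- For `k ≥ 1` the two ranges of degrees join without gap or overlap; for `k = 1` the first one,
  -- starting at `3`, is empty.
  rw [show k + 2 = k + 1 + 1 from rfl, Finset.sum_Ico_consecutive _ (by omega) (by omega)]

lemma mpow_zero_left {β : MIdx n} (hβ : 0 < β.degree) : mpow (0 : Pt n) β = 0 := by
  have := abs_mpow_le (0 : Pt n) β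
  rw [norm_zero, zero_pow hβ.ne'] at this
  exact abs_nonpos_iff.1 this

lemma Coeffs.phaseRest_zero (b : Coeffs n) (k p : ℕ) (t : ℝ) (z : Pt n) :
    b.phaseRest k p t 0 z = 0 := by
  refine Finset.sum_eq_zero fun m hm => Finset.sum_eq_zero fun β hβ => ?_
  rw [mem_ofDegree] at hβ
  rw [Finset.mem_Icc] at hm
  rw [mpow_zero_left (by omega)]
  simp

lemma Coeffs.phase_zero (b : Coeffs n) (k : ℕ) (t : ℝ) (z : Pt n) :
    b.phase k t 0 z = b.φ 0 t z := by
  rw [phase, Finset.sum_eq_zero (s := Finset.Icc 3 (k + 1))]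
  · simp
  intro m hm
  refine Finset.sum_eq_zero fun β hβ => ?_
  rw [mem_ofDegree] at hβ
  rw [Finset.mem_Icc] at hm
  rw [mpow_zero_left (by omega)]
  simp

open Asymptotics Topology in
lemma isBigO_mpow {β : MIdx n} (hβ : 2 ≤ β.degree) :
    (fun y : Pt n => (mpow y β : ℂ)) =O[𝓝 0] fun y => ‖y - 0‖ ^ 2 := by
  refine IsBigO.of_bound 1 ?_
  filter_upwards [Metric.ball_mem_nhds (0 : Pt n) one_pos] with y hy
  rw [mem_ball_zero_iff] at hy
  rw [Complex.norm_real, Real.norm_eq_abs, one_mul, sub_zero, norm_pow, norm_norm]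
  exact (abs_mpow_le y β).trans (pow_le_pow_of_le_one (norm_nonneg _) hy.le hβ)

open Asymptotics Topology in
lemma isBigO_coord_mul_coord (i l : Fin n) (c : ℂ) :
    (fun y : Pt n => (y i : ℂ) * c * (y l : ℂ)) =O[𝓝 0] fun y => ‖y - 0‖ ^ 2 := by
  refine IsBigO.of_bound ‖c‖ (Filter.Eventually.of_forall fun y => ?_)
  rw [norm_mul, norm_mul, Complex.norm_real, Complex.norm_real, sub_zero, norm_pow, norm_norm]
  calc ‖y i‖ * ‖c‖ * ‖y l‖ ≤ ‖y‖ * ‖c‖ * ‖y‖ := by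
        gcongr <;> exact PiLp.norm_apply_le y _
    _ = _ := by ring

open Asymptotics Topology in
-- Beyond its affine part the phase is `O(|y|²)`, so it has zero derivative at the origin.
lemma Coeffs.pd_phase (b : Coeffs n) (k : ℕ) (t : ℝ) (z : Pt n) (i : Fin n) :
    pd i (fun y => b.phase k t y z) 0 = b.p t z i := by
  have hlin : HasFDerivAt (fun y : Pt n => b.φ 0 t z + ∑ i, (y i : ℂ) * (b.p t z i : ℂ))
      (∑ i, (b.p t z i : ℂ) • (Complex.ofRealCLM.comp (EuclideanSpace.proj i : Pt n →L[ℝ] ℝ))) 0 := by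
    refine HasFDerivAt.const_add _ (HasFDerivAt.fun_sum fun i _ => ?_)
    exact (Complex.ofRealCLM.comp (EuclideanSpace.proj i : Pt n →L[ℝ] ℝ)).hasFDerivAt.mul_const _
  have hquad : HasFDerivAt (fun y : Pt n => 1 / 2 * ∑ i, ∑ l, (y i : ℂ) * b.M t z i l * (y l : ℂ) +
      ∑ m ∈ Finset.Icc 3 (k + 1), ∑ β ∈ ofDegree n m,
        1 / (mfact β : ℂ) * b.φ β t z * (mpow y β : ℂ)) (0 : Pt n →L[ℝ] ℂ) 0 := by
    refine IsBigO.hasFDerivAt (n := 2) (IsBigO.add ?_ ?_) one_lt_two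
    · refine IsBigO.const_mul_left (IsBigO.fun_sum fun i _ => IsBigO.fun_sum fun l _ => ?_) _
      exact isBigO_coord_mul_coord i l _
    · refine IsBigO.fun_sum fun m hm => IsBigO.fun_sum fun β hβ => IsBigO.const_mul_left ?_ _
      rw [mem_ofDegree] at hβ
      rw [Finset.mem_Icc] at hm
      exact isBigO_mpow (by omega)
  have h := (hlin.add hquad).fderiv
  have hfun : (fun y => b.phase k t y z) = (fun y : Pt n => b.φ 0 t z + ∑ i, (y i : ℂ) * (b.p t z i : ℂ)) +
      (fun y : Pt n => 1 / 2 * ∑ i, ∑ l, (y i : ℂ) * b.M t z i l * (y l : ℂ) +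
      ∑ m ∈ Finset.Icc 3 (k + 1), ∑ β ∈ ofDegree n m,
        1 / (mfact β : ℂ) * b.φ β t z * (mpow y β : ℂ)) := by
    funext y
    simp only [phase, Pi.add_apply]
    ring
  rw [pd, hfun, h]
  simp [PiLp.single_apply, apply_ite]

lemma RaySmooth.lift_snd {G : Type*} [NormedAddCommGroup G] [NormedSpace ℝ G]
    {f : ℝ → Pt n → G} (hf : RaySmooth f) :
    ContDiffOn ℝ ∞ (fun q : ℝ × Pt n × Pt n => f q.1 q.2.2) (Ici 0 ×ˢ univ) :=
  hf.contDiffOn.comp (f := fun q : ℝ × Pt n × Pt n => (q.1, q.2.2)) (by fun_prop)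
    fun q hq => ⟨hq.1, trivial⟩

lemma contDiff_ofReal_mpow_snd (β : MIdx n) :
    ContDiff ℝ ∞ (fun q : ℝ × Pt n × Pt n => (mpow q.2.1 β : ℂ)) :=
  contDiff_ofReal.comp ((contDiff_mpow β).comp (contDiff_fst.comp contDiff_snd))

lemma contDiff_ofReal_coord_snd (i : Fin n) :
    ContDiff ℝ ∞ (fun q : ℝ × Pt n × Pt n => (q.2.1 i : ℂ)) :=
  contDiff_ofReal.comp ((contDiff_coord i).comp (contDiff_fst.comp contDiff_snd))

/-! ### Properties (P1)–(P3) and (P6) of beam phases and rays -/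

namespace IsRegularMode

variable {K₀ : Set (Pt n)} {b : Coeffs n}

lemma contDiffOn_term (h : IsRegularMode K₀ b) (β : MIdx n) :
    ContDiffOn ℝ ∞ (fun q : ℝ × Pt n × Pt n =>
      1 / (mfact β : ℂ) * b.φ β q.1 q.2.2 * (mpow q.2.1 β : ℂ)) (Ici 0 ×ˢ univ) :=
  (contDiffOn_const.mul (h.φ_smooth β).lift_snd).mul (contDiff_ofReal_mpow_snd β).contDiffOn

lemma contDiffOn_phase (h : IsRegularMode K₀ b) (k : ℕ) :
    ContDiffOn ℝ ∞ (fun q : ℝ × Pt n × Pt n => b.phase k q.1 q.2.1 q.2.2) (Ici 0 ×ˢ univ) := by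
  refine (((h.φ_smooth 0).lift_snd.add (ContDiffOn.sum fun i _ => ?_)).add
    (contDiffOn_const.mul (ContDiffOn.sum fun i _ => ContDiffOn.sum fun l _ => ?_))).add
    (ContDiffOn.sum fun m _ => ContDiffOn.sum fun β _ => h.contDiffOn_term β)
  · refine (contDiff_ofReal_coord_snd i).contDiffOn.mul ?_
    exact contDiff_ofReal.comp_contDiffOn ((contDiff_coord i).comp_contDiffOn h.p_smooth.lift_snd)
  · exact ((contDiff_ofReal_coord_snd i).contDiffOn.mul (h.φ_smooth (e i + e l)).lift_snd).mul
      (contDiff_ofReal_coord_snd l).contDiffOn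

lemma contDiffOn_phaseRest (h : IsRegularMode K₀ b) (k p : ℕ) :
    ContDiffOn ℝ ∞ (fun q : ℝ × Pt n × Pt n => b.phaseRest k p q.1 q.2.1 q.2.2)
      (Ici 0 ×ˢ univ) :=
  ContDiffOn.sum fun _ _ => ContDiffOn.sum fun β _ => h.contDiffOn_term β

lemma gradPhase_apply (b : Coeffs n) (k : ℕ) (t : ℝ) (z : Pt n) (i : Fin n) :
    gradPhase (b.phase k) t z i = (b.p t z i : ℂ) :=
  b.pd_phase k t z i

lemma norm_gradPhase_sub (b : Coeffs n) (k : ℕ) (t : ℝ) (z z' : Pt n) :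
    ‖gradPhase (b.phase k) t z - gradPhase (b.phase k) t z'‖ = ‖b.p t z - b.p t z'‖ := by
  rw [EuclideanSpace.norm_eq, EuclideanSpace.norm_eq]
  congr 1
  refine Finset.sum_congr rfl fun i _ => ?_
  rw [PiLp.sub_apply, PiLp.sub_apply, gradPhase_apply, gradPhase_apply, ← Complex.ofReal_sub,
    Complex.norm_real]

lemma p1 (h : IsRegularMode K₀ b) (T : ℝ) : P1 T b.x :=
  h.x_smooth.contDiffOn.mono (prod_mono Icc_subset_Ici_self subset_rfl)

lemma p2 (h : IsRegularMode K₀ b) (T : ℝ) (k : ℕ) : P2 T (b.phase k) :=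
  (h.contDiffOn_phase k).mono (prod_mono Icc_subset_Ici_self subset_rfl)

lemma p3 (h : IsRegularMode K₀ b) (T : ℝ) (k : ℕ) {K : Set (Pt n)} (hK : IsCompact K) :
    P3 T K (b.phase k) b.x := by
  refine ⟨fun t _ z _ i => by rw [gradPhase_apply, Complex.ofReal_im], ?_⟩
  obtain ⟨C, hC, hb⟩ := h.lower T K hK
  exact ⟨C, hC, fun t ht z hz z' hz' => by
    rw [norm_gradPhase_sub]; exact hb t ht z hz z' hz'⟩

lemma p6 (h : IsRegularMode K₀ b) (k : ℕ) : P6 (b.phase k) b.x := by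
  intro t ht z
  simp only [b.phase_zero, gradPhase_apply]
  refine ⟨h.φ_real t ht z, fun i => Complex.ofReal_im _,
    (h.x_smooth.contDiff_slice ht).differentiable (by simp) z,
    ((h.φ_smooth 0).contDiff_slice ht).differentiable (by simp) z, fun l => h.isotropic t ht z l⟩

end IsRegularMode

/-! ### Bounds -/

lemma exists_bound_sum {ι X G : Type*} [NormedAddCommGroup G] {s : Finset ι} {D : Set X}
    {f : ι → X → G} {r : X → ℝ} (hr : ∀ q ∈ D, 0 ≤ r q)
    (h : ∀ i ∈ s, ∃ C > 0, ∀ q ∈ D, ‖f i q‖ ≤ C * r q) :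
    ∃ C > 0, ∀ q ∈ D, ‖∑ i ∈ s, f i q‖ ≤ C * r q := by
  choose! C hC hb using h
  refine ⟨∑ i ∈ s, C i + 1, by have := Finset.sum_nonneg fun i hi => (hC i hi).le; linarith,
    fun q hq => ?_⟩
  calc _ ≤ ∑ i ∈ s, ‖f i q‖ := norm_sum_le _ _
    _ ≤ ∑ i ∈ s, C i * r q := Finset.sum_le_sum fun i hi => hb i hi q hq
    _ = (∑ i ∈ s, C i) * r q := by rw [Finset.sum_mul]
    _ ≤ _ := by nlinarith [hr q hq]

/-- All monomials have degree at least `k + 2 ≥ 3`; for bounded `y` the surplus powers are absorbed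
in the constant. -/
lemma IsRegularMode.exists_norm_phaseRest_le {K₀ : Set (Pt n)} {b : Coeffs n}
    (h : IsRegularMode K₀ b) {k : ℕ} (hk : 1 ≤ k) (p : ℕ) (T : ℝ) {K : Set (Pt n)}
    (hK : IsCompact K) (r : ℝ) :
    ∃ C > 0, ∀ t ∈ Icc 0 T, ∀ z ∈ K, ∀ y : Pt n, ‖y‖ ≤ r →
      ‖b.phaseRest k p t y z‖ ≤ C * ‖y‖ ^ 3 := by
  suffices hs : ∃ C > 0, ∀ q ∈ {q : ℝ × Pt n × Pt n | q.1 ∈ Icc 0 T ∧ q.2.2 ∈ K ∧ ‖q.2.1‖ ≤ r},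
      ‖b.phaseRest k p q.1 q.2.1 q.2.2‖ ≤ C * ‖q.2.1‖ ^ 3 by
    obtain ⟨C, hC, hb⟩ := hs
    exact ⟨C, hC, fun t ht z hz y hy => hb (t, y, z) ⟨ht, hz, hy⟩⟩
  refine exists_bound_sum (fun q _ => by positivity) fun m hm =>
    exists_bound_sum (fun q _ => by positivity) fun β hβ => ?_
  rw [Finset.mem_Icc] at hm
  rw [mem_ofDegree] at hβ
  obtain ⟨C, hC, hb⟩ := (h.φ_smooth β).exists_bound T hK
  refine ⟨‖1 / (mfact β : ℂ)‖ * C * (|r| + 1) ^ (m - 3), ?_, fun q hq => ?_⟩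
  · have := norm_pos_iff.2 (one_div_ne_zero (mfact_ne_zero β))
    positivity
  · obtain ⟨ht, hz, hy⟩ := hq
    rw [norm_mul, norm_mul, Complex.norm_real, Real.norm_eq_abs]
    have h1 : |mpow q.2.1 β| ≤ (|r| + 1) ^ (m - 3) * ‖q.2.1‖ ^ 3 := by
      refine (abs_mpow_le q.2.1 β).trans ?_
      rw [hβ, show m = (m - 3) + 3 by omega, pow_add, Nat.add_sub_cancel]
      gcongr
      linarith [le_abs_self r]
    calc _ ≤ ‖1 / (mfact β : ℂ)‖ * C * ((|r| + 1) ^ (m - 3) * ‖q.2.1‖ ^ 3) := by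
          gcongr
          exact hb _ ht _ hz
      _ = _ := by ring

lemma IsCutoff.exists_bound {η : ℝ≥0∞} {ρ : Pt n → ℝ} (h : IsCutoff η ρ) :
    ∃ C > 0, ∀ y, |ρ y| ≤ C := by
  -- For finite `η` the cutoff lives in a compact ball; for infinite `η` it is constant.
  by_cases hη : η = ⊤
  · exact ⟨1, one_pos, fun y => by rw [h.eq_one y (by simp [hη])]; simp⟩
  obtain ⟨C, hC⟩ := (isCompact_closedBall (0 : Pt n) (2 * η).toReal).exists_bound_of_continuousOn
    h.smooth.continuous.continuousOn
  refine ⟨|C| + 1, by positivity, fun y => ?_⟩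
  by_cases hy : ‖y‖ ≤ (2 * η).toReal
  · exact (hC y (by simpa using hy)).trans (by linarith [le_abs_self C])
  · push Not at hy
    have h0 : 2 * η ≤ ‖y‖ₑ := by
      rw [← ofReal_norm, ← ENNReal.ofReal_toReal (a := 2 * η) (by simp [hη, ENNReal.mul_eq_top])]
      exact ENNReal.ofReal_le_ofReal hy.le
    rw [h.eq_zero y h0, abs_zero]
    positivity

lemma norm_exp_I_mul_div (w : ℂ) (ε : ℝ) :
    ‖Complex.exp (Complex.I * w / ε)‖ = Real.exp (-w.im / ε) := by
  rw [Complex.norm_exp, Complex.div_ofReal_re, Complex.I_mul_re]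

/-- The modulus of the exponential is `e^{-Im Φ/ε}`. The lower bound on `Im Φ` holds for `|y| ≤ 2η`,
and the cutoff vanishes beyond. -/
lemma P4.exists_norm_exp_mul_cutoff_le {η : ℝ≥0∞} {ρ : Pt n → ℝ} (hρ : IsCutoff η ρ) {T : ℝ}
    {K : Set (Pt n)} {Φ : ℝ → Pt n → Pt n → ℂ} (h : P4 T K η Φ) :
    ∃ D > 0, ∃ w > 0, ∀ t ∈ Icc 0 T, ∀ z ∈ K, ∀ ε > (0 : ℝ), ∀ y,
      ‖Complex.exp (Complex.I * Φ t y z / (ε : ℂ)) * (ρ y : ℂ)‖ ≤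
        D * Real.exp (-w * ‖y‖ ^ 2 / ε) := by
  obtain ⟨D, hD, hb⟩ := hρ.exists_bound
  obtain ⟨w, hw, hΦ⟩ := h
  refine ⟨D, hD, w, hw, fun t ht z hz ε hε y => ?_⟩
  rw [norm_mul, norm_exp_I_mul_div, Complex.norm_real, Real.norm_eq_abs, mul_comm]
  rcases le_total ‖y‖ₑ (2 * η) with hy | hy
  · gcongr
    · exact hb y
    · linarith [hΦ t ht z hz y hy]
  · rw [hρ.eq_zero y hy, abs_zero, zero_mul]
    positivity

end GaussianBeam
end

noncomputable section

namespace GaussianBeam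

variable {n : ℕ}

/-! ### Amplitudes of the oscillatory integrals -/

/-- Smooth functions of `(t, z)` that vanish for `z` outside of a closed subset of `K₀`. -/
structure IsRayAmplitude (K₀ : Set (Pt n)) (A : ℝ → Pt n → ℂ) : Prop where
  smooth : RaySmooth A
  supp : ∃ S ⊆ K₀, IsClosed S ∧ ∀ t ≥ 0, ∀ z ∉ S, A t z = 0

/-- The function `g` of an oscillatory integral with amplitude `A` and weight `H`. -/
def oscWeight (b : Coeffs n) (k p : ℕ) (A : ℝ → Pt n → ℂ) (H : ℂ → ℂ) (t : ℝ) (y z : Pt n)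
    (ε : ℝ) : ℂ :=
  (((1 / (2 * Real.pi)) ^ ((n : ℝ) / 2) : ℝ) : ℂ) * A t z *
    H (Complex.I * b.phaseRest k p t (y - b.x t z) z / ε)

section

variable {K₀ : Set (Pt n)} {b : Coeffs n} {A : ℝ → Pt n → ℂ} {H : ℂ → ℂ}

lemma continuousOn_oscWeight (h : IsRegularMode K₀ b) (hA : IsRayAmplitude K₀ A) (hH : IsWeight H)
    (k p : ℕ) :
    ContinuousOn (fun r : ℝ × Pt n × Pt n × ℝ => oscWeight b k p A H r.1 r.2.1 r.2.2.1 r.2.2.2)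
      (Ici 0 ×ˢ univ ×ˢ univ ×ˢ Ioi 0) := by
  have hmaps : MapsTo (fun r : ℝ × Pt n × Pt n × ℝ => (r.1, r.2.2.1))
      (Ici 0 ×ˢ univ ×ˢ univ ×ˢ Ioi 0) (Ici 0 ×ˢ univ) := fun r hr => ⟨hr.1, trivial⟩
  have hx : ContinuousOn (fun r : ℝ × Pt n × Pt n × ℝ => b.x r.1 r.2.2.1)
      (Ici 0 ×ˢ univ ×ˢ univ ×ˢ Ioi 0) :=
    h.x_smooth.contDiffOn.continuousOn.comp (by fun_prop) hmaps
  have hA' : ContinuousOn (fun r : ℝ × Pt n × Pt n × ℝ => A r.1 r.2.2.1)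
      (Ici 0 ×ˢ univ ×ˢ univ ×ˢ Ioi 0) :=
    hA.smooth.contDiffOn.continuousOn.comp (by fun_prop) hmaps
  have hR : ContinuousOn (fun r : ℝ × Pt n × Pt n × ℝ =>
      b.phaseRest k p r.1 (r.2.1 - b.x r.1 r.2.2.1) r.2.2.1) (Ici 0 ×ˢ univ ×ˢ univ ×ˢ Ioi 0) :=
    (h.contDiffOn_phaseRest k p).continuousOn.comp
      (f := fun r : ℝ × Pt n × Pt n × ℝ => (r.1, r.2.1 - b.x r.1 r.2.2.1, r.2.2.1))
      (by fun_prop) fun r hr => ⟨hr.1, trivial⟩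
  refine (continuousOn_const.mul hA').mul (hH.continuous.comp_continuousOn ?_)
  refine (continuousOn_const.mul hR).div (by fun_prop) fun r hr => ?_
  exact Complex.ofReal_ne_zero.2 (ne_of_gt hr.2.2.2)

lemma exists_norm_oscWeight_le (hA : IsRayAmplitude K₀ A) (hH : IsWeight H) (k p : ℕ) (T : ℝ)
    {K : Set (Pt n)} (hK : IsCompact K) :
    ∃ C > 0, ∀ t ∈ Icc 0 T, ∀ y, ∀ z ∈ K, ∀ ε > 0, ‖oscWeight b k p A H t y z ε‖ ≤ C := by
  obtain ⟨C, hC, hb⟩ := hA.smooth.exists_bound T hK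
  obtain ⟨D, hD, hw⟩ := hH.bounded
  refine ⟨(1 / (2 * Real.pi)) ^ ((n : ℝ) / 2) * C * D, by positivity, fun t ht y z hz ε _ => ?_⟩
  rw [oscWeight, norm_mul, norm_mul, Complex.norm_real, Real.norm_of_nonneg (by positivity)]
  gcongr
  · exact hb t ht z hz
  · exact hw _

lemma p7_oscWeight {η : ℝ≥0∞} {ρ : Pt n → ℝ} (hρ : IsCutoff η ρ) (hA : IsRayAmplitude K₀ A)
    (hH : IsWeight H) (k p m : ℕ) {T : ℝ} {K : Set (Pt n)} (hK : IsCompact K)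
    (h4 : P4 T K η (b.phase m)) :
    P7 T K₀ K ρ (b.phase m) b.x (oscWeight b k p A H) := by
  obtain ⟨C, hC, hb⟩ := exists_norm_oscWeight_le (b := b) hA hH k p T hK
  obtain ⟨D, hD, w, hw, he⟩ := h4.exists_norm_exp_mul_cutoff_le hρ
  refine ⟨⟨C, hb⟩, fun t ht y ε _ => ?_, C * D, by positivity, w, hw, fun t ht z hz ε hε y => ?_⟩
  · obtain ⟨S, hS, hSc, h0⟩ := hA.supp
    refine (closure_minimal (fun z hz => ?_) hSc).trans hS
    by_contra hzS
    exact hz (by simp [oscWeight, h0 t ht.1 z hzS])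
  · rw [mul_assoc, norm_mul, mul_assoc]
    gcongr
    · exact hb t ht y z hz ε hε
    · exact he t ht z hz ε hε _

/-- On the ray from `z₀` the phase rest vanishes, so `g` at `z₀` involves `H 0`. The difference
splits into `(A t z - A t z₀) H W + A t z₀ (H W - H 0)`. The first part is Lipschitz in `z`; in the
second `|W| ≤ C |z - z₀|³ / ε`, since the rest is cubic and `x` is Lipschitz. -/
lemma p8_oscWeight {η : ℝ≥0∞} {ρ : Pt n → ℝ} (hρ : IsCutoff η ρ) (h : IsRegularMode K₀ b)
    (hA : IsRayAmplitude K₀ A) (hH : IsWeight H) {k : ℕ} (hk : 1 ≤ k) (p m : ℕ) {T : ℝ}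
    {K : Set (Pt n)} (hK : IsCompact K) (h4 : P4 T K η (b.phase m)) :
    P8 T K ρ (b.phase m) b.x (oscWeight b k p A H) := by
  obtain ⟨D, hD, w, hw, he⟩ := h4.exists_norm_exp_mul_cutoff_le hρ
  obtain ⟨CA, hCA, hAb⟩ := hA.smooth.exists_bound T hK
  obtain ⟨LA, hLA, hAl⟩ := hA.smooth.exists_lipschitz T hK
  obtain ⟨Cx, hCx, hxb⟩ := h.x_smooth.exists_bound T hK
  obtain ⟨Lx, hLx, hxl⟩ := h.x_smooth.exists_lipschitz T hK
  obtain ⟨CH, hCH, hHb⟩ := hH.bounded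
  obtain ⟨LH, hLH, hHl⟩ := hH.lipschitz
  obtain ⟨CR, hCR, hR⟩ := h.exists_norm_phaseRest_le hk p T hK (Cx + Cx)
  set c : ℝ := (1 / (2 * Real.pi)) ^ ((n : ℝ) / 2) with hc
  have hc0 : 0 < c := by positivity
  refine ⟨c * (LA * CH + CA * (LH * (CR * Lx ^ 3))) * D, by positivity, w, hw, 2, 1, le_rfl, ?_⟩
  rintro t ht z hz z₀ hz₀ ε hε _ rfl
  rw [mul_assoc, norm_mul]
  set W : ℂ := Complex.I * b.phaseRest k p t (b.x t z₀ - b.x t z) z / ε with hW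
  have hx : ‖b.x t z₀ - b.x t z‖ ≤ Lx * ‖z - z₀‖ := by
    rw [norm_sub_rev]; exact hxl t ht z hz z₀ hz₀
  have hWn : ‖W‖ ≤ CR * Lx ^ 3 * (‖z - z₀‖ ^ 3 / ε) := by
    rw [hW, norm_div, norm_mul, Complex.norm_I, one_mul, Complex.norm_real,
      Real.norm_of_nonneg hε.le, ← mul_div_assoc]
    gcongr
    calc _ ≤ CR * ‖b.x t z₀ - b.x t z‖ ^ 3 := hR t ht z hz _
          ((norm_sub_le _ _).trans (add_le_add (hxb t ht z₀ hz₀) (hxb t ht z hz)))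
      _ ≤ CR * (Lx * ‖z - z₀‖) ^ 3 := by gcongr
      _ = _ := by ring
  have hg : oscWeight b k p A H t (b.x t z₀) z ε - oscWeight b k p A H t (b.x t z₀) z₀ ε =
      (c : ℂ) * ((A t z - A t z₀) * H W + A t z₀ * (H W - H 0)) := by
    rw [oscWeight, oscWeight, sub_self, b.phaseRest_zero, mul_zero, zero_div, ← hW, ← hc]
    ring
  have hgn : ‖oscWeight b k p A H t (b.x t z₀) z ε - oscWeight b k p A H t (b.x t z₀) z₀ ε‖ ≤
      c * (LA * CH + CA * (LH * (CR * Lx ^ 3))) *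
        (‖z - z₀‖ * (1 + ‖z - z₀‖ ^ 2 / ε ^ 1)) := by
    rw [hg, norm_mul, Complex.norm_real, Real.norm_of_nonneg hc0.le, mul_assoc c]
    gcongr
    have h1 : 0 ≤ ‖z - z₀‖ := norm_nonneg _
    have h2 : 0 ≤ ‖z - z₀‖ ^ 3 / ε := by positivity
    calc _ ≤ ‖A t z - A t z₀‖ * ‖H W‖ + ‖A t z₀‖ * ‖H W - H 0‖ := by
          rw [← norm_mul, ← norm_mul]; exact norm_add_le _ _
      _ ≤ LA * ‖z - z₀‖ * CH + CA * (LH * (CR * Lx ^ 3 * (‖z - z₀‖ ^ 3 / ε))) := by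
          gcongr
          · exact hAl t ht z hz z₀ hz₀
          · exact hHb W
          · exact hAb t ht z₀ hz₀
          · exact (hHl W).trans (by gcongr)
      _ = (LA * CH) * ‖z - z₀‖ + (CA * (LH * (CR * Lx ^ 3))) * (‖z - z₀‖ ^ 3 / ε) := by ring
      _ ≤ (LA * CH + CA * (LH * (CR * Lx ^ 3))) * (‖z - z₀‖ + ‖z - z₀‖ ^ 3 / ε) := by
          have h3 : 0 ≤ LA * CH := by positivity
          have h4 : 0 ≤ CA * (LH * (CR * Lx ^ 3)) := by positivity
          nlinarith [mul_nonneg h3 h2, mul_nonneg h4 h1]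
      _ = _ := by rw [pow_one]; ring
  calc _ ≤ c * (LA * CH + CA * (LH * (CR * Lx ^ 3))) *
        (‖z - z₀‖ * (1 + ‖z - z₀‖ ^ 2 / ε ^ 1)) *
        (D * Real.exp (-w * ‖b.x t z₀ - b.x t z‖ ^ 2 / ε)) := by
        gcongr
        exact he t ht z hz ε hε _
    _ = _ := by ring

end

/-! ### Sums of oscillatory integrals -/

/-- The data of one oscillatory integral for superpositions of modes indexed by `ι`: the mode `s`,
the order `m` of the phase, the power `ℓ` of `ε`, the multi-index and the function `g`. -/
structure OscTerm (n : ℕ) (ι : Type) where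
  s : ι
  m : ℕ
  ℓ : ℝ
  β : MIdx n
  g : ℝ → Pt n → Pt n → ℝ → ℂ

namespace OscTerm

variable {ι : Type}

/-- The oscillatory integral, with its power of `ε`. -/
def eval (τ : OscTerm n ι) (b : ι → Coeffs n) (K₀ : Set (Pt n)) (ρ : Pt n → ℝ) (ε t : ℝ)
    (y : Pt n) : ℂ :=
  ((ε ^ τ.ℓ : ℝ) : ℂ) * oscInt K₀ ρ τ.β ((b τ.s).phase τ.m) (b τ.s).x τ.g ε t y

/-- The conditions on the integrals in the representation of `u_{k+p} - u_k`. -/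
structure IsGood (τ : OscTerm n ι) (b : ι → Coeffs n) (K₀ : Set (Pt n)) (η : ℝ≥0∞) (ρ : Pt n → ℝ)
    (k p : ℕ) : Prop where
  order : τ.m = k ∨ τ.m = k + p
  exponent : 0 ≤ τ.ℓ ∧ ∃ N : ℕ, τ.ℓ = (N : ℝ) / 2
  parity : τ.ℓ = 0 → (Even τ.β.degree ↔ Even k)
  continuousOn : ContinuousOn (fun r : ℝ × Pt n × Pt n × ℝ => τ.g r.1 r.2.1 r.2.2.1 r.2.2.2)
    (Ici 0 ×ˢ univ ×ˢ univ ×ˢ Ioi 0)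
  properties : ∀ T > 0, ∀ d > 0,
    (∀ i, Admissible (Metric.cthickening d K₀) T ((b i).phase k) η ∧
      Admissible (Metric.cthickening d K₀) T ((b i).phase (k + p)) η) →
    P1 T (b τ.s).x ∧
    P2 T ((b τ.s).phase τ.m) ∧
    P3 T (Metric.cthickening d K₀) ((b τ.s).phase τ.m) (b τ.s).x ∧
    P4 T (Metric.cthickening d K₀) η ((b τ.s).phase τ.m) ∧
    P6 ((b τ.s).phase τ.m) (b τ.s).x ∧
    P7 T K₀ (Metric.cthickening d K₀) ρ ((b τ.s).phase τ.m) (b τ.s).x τ.g ∧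
    P8 T (Metric.cthickening d K₀) ρ ((b τ.s).phase τ.m) (b τ.s).x τ.g

end OscTerm

section

variable {ι : Type} {b : ι → Coeffs n} {K₀ : Set (Pt n)} {η : ℝ≥0∞} {ρ : Pt n → ℝ} {k p : ℕ}

/-- The identity `hr` balances powers of `ε`: a factor `ε^r` and a monomial of degree `|β|` together
have size `ε^{(k + N)/2}`. With `N = 0` it shows that `|β|` and `k` have the same parity. -/
lemma OscTerm.isGood_oscWeight (hK₀ : IsCompact K₀) (hρ : IsCutoff η ρ) (hk : 1 ≤ k)
    (hb : ∀ i, IsRegularMode K₀ (b i)) (s : ι) {m : ℕ} (hm : m = k ∨ m = k + p)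
    {A : ℝ → Pt n → ℂ} (hA : IsRayAmplitude K₀ A) {H : ℂ → ℂ} (hH : IsWeight H) {β : MIdx n}
    {N : ℕ} {r : ℤ} (hr : 2 * r + β.degree = k + N) :
    OscTerm.IsGood ⟨s, m, (N : ℝ) / 2, β, oscWeight (b s) k p A H⟩ b K₀ η ρ k p where
  order := hm
  exponent := ⟨by positivity, N, rfl⟩
  parity h0 := by
    have hN : N = 0 := by simpa using h0
    subst hN
    rw [← Int.even_coe_nat, ← Int.even_coe_nat, show ((k : ℕ) : ℤ) = 2 * r + β.degree by
      rw [hr]; simp, Int.even_add]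
    simp
  continuousOn := continuousOn_oscWeight (hb s) hA hH k p
  properties T _ d _ had := by
    have hK : IsCompact (Metric.cthickening d K₀) := hK₀.cthickening
    have h4 : P4 T (Metric.cthickening d K₀) η ((b s).phase m) := by
      rcases hm with rfl | rfl
      exacts [(had s).1, (had s).2]
    exact ⟨(hb s).p1 T, (hb s).p2 T m, (hb s).p3 T m hK, h4, (hb s).p6 m,
      p7_oscWeight hρ hA hH k p m hK h4, p8_oscWeight hρ (hb s) hA hH hk p m hK h4⟩

/-- `G` is an integrand whose integral over `z ∈ K₀`, scaled as a superposition of beams, is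
`ε^{k/2}` times a sum of admissible oscillatory integrals. -/
structure IsOscSum (b : ι → Coeffs n) (K₀ : Set (Pt n)) (η : ℝ≥0∞) (ρ : Pt n → ℝ) (k p : ℕ)
    (G : ℝ → ℝ → Pt n → Pt n → ℂ) : Prop where
  continuous : ∀ ε > 0, ∀ t ≥ 0, ∀ y, Continuous (G ε t y)
  rep : ∃ L : List (OscTerm n ι), (∀ τ ∈ L, τ.IsGood b K₀ η ρ k p) ∧
    ∀ ε > 0, ∀ t ≥ 0, ∀ y,
      (((1 / (2 * Real.pi * ε)) ^ ((n : ℝ) / 2) : ℝ) : ℂ) * ∫ z in K₀, G ε t y z =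
        ((ε ^ ((k : ℝ) / 2) : ℝ) : ℂ) * (L.map fun τ => τ.eval b K₀ ρ ε t y).sum

namespace IsOscSum

variable {G G' : ℝ → ℝ → Pt n → Pt n → ℂ}

lemma congr (h : IsOscSum b K₀ η ρ k p G)
    (hG : ∀ ε > 0, ∀ t ≥ 0, ∀ y z, G' ε t y z = G ε t y z) : IsOscSum b K₀ η ρ k p G' := by
  have hG' : ∀ ε > 0, ∀ t ≥ 0, ∀ y, G' ε t y = G ε t y := fun ε hε t ht y =>
    funext (hG ε hε t ht y)
  obtain ⟨L, hL, hrep⟩ := h.rep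
  exact ⟨fun ε hε t ht y => hG' ε hε t ht y ▸ h.continuous ε hε t ht y, L, hL,
    fun ε hε t ht y => hG' ε hε t ht y ▸ hrep ε hε t ht y⟩

lemma zero : IsOscSum b K₀ η ρ k p fun _ _ _ _ => 0 :=
  ⟨fun _ _ _ _ _ => continuous_const, [], by simp, by simp⟩

/-- Continuity of the integrands on the compact set `K₀` is what permits splitting the integral. -/
lemma add (hK₀ : IsCompact K₀) (h : IsOscSum b K₀ η ρ k p G) (h' : IsOscSum b K₀ η ρ k p G') :
    IsOscSum b K₀ η ρ k p fun ε t y z => G ε t y z + G' ε t y z := by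
  obtain ⟨L, hL, hrep⟩ := h.rep
  obtain ⟨L', hL', hrep'⟩ := h'.rep
  refine ⟨fun ε hε t ht y => (h.continuous ε hε t ht y).add (h'.continuous ε hε t ht y),
    L ++ L', fun τ hτ => ?_, fun ε hε t ht y => ?_⟩
  · rcases List.mem_append.1 hτ with hτ | hτ
    exacts [hL τ hτ, hL' τ hτ]
  · rw [integral_add ((h.continuous ε hε t ht y).continuousOn.integrableOn_compact hK₀)
      ((h'.continuous ε hε t ht y).continuousOn.integrableOn_compact hK₀), mul_add,
      hrep ε hε t ht y, hrep' ε hε t ht y, List.map_append, List.sum_append, mul_add]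

lemma sum (hK₀ : IsCompact K₀) {κ : Type*} {S : Finset κ} {F : κ → ℝ → ℝ → Pt n → Pt n → ℂ}
    (h : ∀ i ∈ S, IsOscSum b K₀ η ρ k p (F i)) :
    IsOscSum b K₀ η ρ k p fun ε t y z => ∑ i ∈ S, F i ε t y z := by
  classical
  induction S using Finset.induction_on with
  | empty => simpa using zero
  | insert i S hi ih =>
    simp only [Finset.sum_insert hi]
    exact add hK₀ (h i (Finset.mem_insert_self i S))
      (ih fun l hl => h l (Finset.mem_insert_of_mem hl))

end IsOscSum

end

lemma superposition_scaling {N d k : ℕ} {r : ℤ} (hr : 2 * r + d = k + N) {ε : ℝ} (hε : 0 < ε) :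
    (1 / (2 * Real.pi * ε)) ^ ((n : ℝ) / 2) * ε ^ r =
      ε ^ ((k : ℝ) / 2) * ε ^ ((N : ℝ) / 2) * ε ^ (-((n : ℝ) + (d : ℝ)) / 2) *
        (1 / (2 * Real.pi)) ^ ((n : ℝ) / 2) := by
  have h1 : (1 / (2 * Real.pi * ε)) ^ ((n : ℝ) / 2) =
      (1 / (2 * Real.pi)) ^ ((n : ℝ) / 2) * ε ^ (-((n : ℝ) / 2)) := by
    rw [Real.rpow_neg hε.le, ← Real.inv_rpow hε.le, ← Real.mul_rpow (by positivity) (by positivity)]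
    congr 1
    field_simp
  have hr' : 2 * (r : ℝ) + d = k + N := by exact_mod_cast hr
  rw [h1, ← Real.rpow_intCast, ← Real.rpow_add hε, ← Real.rpow_add hε, mul_assoc,
    ← Real.rpow_add hε, mul_comm]
  congr 2
  linarith

end GaussianBeam
end

noncomputable section

namespace GaussianBeam

variable {n : ℕ}

/-! ### The difference of two superpositions -/

lemma IsRegularMode.continuous_comp_ray {K₀ : Set (Pt n)} {b : Coeffs n} (h : IsRegularMode K₀ b)
    {F : ℝ → Pt n → Pt n → ℂ}
    (hF : ContDiffOn ℝ ∞ (fun q : ℝ × Pt n × Pt n => F q.1 q.2.1 q.2.2) (Ici 0 ×ˢ univ))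
    {t : ℝ} (ht : 0 ≤ t) (y : Pt n) : Continuous fun z => F t (y - b.x t z) z := by
  have hx : Continuous (b.x t) := (h.x_smooth.contDiff_slice ht).continuous
  rw [← continuousOn_univ]
  exact hF.continuousOn.comp (f := fun z => (t, y - b.x t z, z)) (by fun_prop)
    fun z _ => ⟨ht, trivial⟩

/-- The factor `e^{iΦ_m/ε} ϱ` of the beams, as a function of the starting point `z`. -/
def Coeffs.carrier (b : Coeffs n) (ρ : Pt n → ℝ) (m : ℕ) (ε t : ℝ) (y z : Pt n) : ℂ :=
  Complex.exp (Complex.I * b.phase m t (y - b.x t z) z / ε) * (ρ (y - b.x t z) : ℂ)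

lemma IsRegularMode.continuous_carrier {K₀ : Set (Pt n)} {b : Coeffs n} (h : IsRegularMode K₀ b)
    {ρ : Pt n → ℝ} (hρ : Continuous ρ) (m : ℕ) (ε : ℝ) {t : ℝ} (ht : 0 ≤ t) (y : Pt n) :
    Continuous (b.carrier ρ m ε t y) := by
  have hx : Continuous (b.x t) := (h.x_smooth.contDiff_slice ht).continuous
  have hΦ := IsRegularMode.continuous_comp_ray h (h.contDiffOn_phase m) ht y
  unfold Coeffs.carrier
  fun_prop

lemma IsRegularMode.continuous_amplitude {K₀ : Set (Pt n)} {b : Coeffs n} (h : IsRegularMode K₀ b)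
    (m : ℕ) (ε : ℝ) {t : ℝ} (ht : 0 ≤ t) (y : Pt n) :
    Continuous fun z => b.amplitude m ε t (y - b.x t z) z := by
  have hx : Continuous (b.x t) := (h.x_smooth.contDiff_slice ht).continuous
  refine continuous_finsetSum _ fun j _ => continuous_const.mul <|
    continuous_finsetSum _ fun m _ => continuous_finsetSum _ fun β _ => ?_
  have ha : Continuous (b.a j β t) := ((h.a_smooth j β).contDiff_slice ht).continuous
  have hm : Continuous fun z => mpow (y - b.x t z) β :=
    (contDiff_mpow β).continuous.comp (continuous_const.sub hx)
  fun_prop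

section

variable {ι : Type} {b : ι → Coeffs n} {K₀ : Set (Pt n)} {η : ℝ≥0∞} {ρ : Pt n → ℝ} {k p : ℕ}

/-- A single monomial gives a single oscillatory integral. The exponent `r` is an integer because
the phase difference brings in a factor `1/ε`. -/
lemma isOscSum_monomial (hK₀ : IsCompact K₀) (hρ : IsCutoff η ρ) (hk : 1 ≤ k)
    (hb : ∀ i, IsRegularMode K₀ (b i)) (s : ι) {m : ℕ} (hm : m = k ∨ m = k + p)
    {A : ℝ → Pt n → ℂ} (hA : IsRayAmplitude K₀ A) {H : ℂ → ℂ} (hH : IsWeight H) {β : MIdx n}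
    {N : ℕ} {r : ℤ} (hr : 2 * r + β.degree = k + N) :
    IsOscSum b K₀ η ρ k p fun ε t y z =>
      (ε : ℂ) ^ r * (A t z * H (Complex.I * (b s).phaseRest k p t (y - (b s).x t z) z / ε) *
        (mpow (y - (b s).x t z) β : ℂ) * (b s).carrier ρ m ε t y z) := by
  refine ⟨fun ε hε t ht y => ?_, [⟨s, m, (N : ℝ) / 2, β, oscWeight (b s) k p A H⟩], ?_,
    fun ε hε t ht y => ?_⟩
  · have hx : Continuous ((b s).x t) := ((hb s).x_smooth.contDiff_slice ht).continuous
    have hA' : Continuous (A t) := (hA.smooth.contDiff_slice ht).continuous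
    have hR := IsRegularMode.continuous_comp_ray (hb s) ((hb s).contDiffOn_phaseRest k p) ht y
    have hm : Continuous fun z => mpow (y - (b s).x t z) β :=
      (contDiff_mpow β).continuous.comp (continuous_const.sub hx)
    have hc := (hb s).continuous_carrier hρ.smooth.continuous m ε ht y
    have hW : Continuous fun z => H (Complex.I * (b s).phaseRest k p t (y - (b s).x t z) z / ε) :=
      hH.continuous.comp ((continuous_const.mul hR).div_const _)
    exact continuous_const.mul
      (((hA'.mul hW).mul (Complex.continuous_ofReal.comp hm)).mul hc)
  · intro τ hτ
    rw [List.mem_singleton.1 hτ]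
    exact OscTerm.isGood_oscWeight hK₀ hρ hk hb s hm hA hH hr
  · have hsc := congrArg (fun r : ℝ => (r : ℂ)) (superposition_scaling (n := n) hr hε)
    push_cast at hsc
    simp only [List.map_cons, List.map_nil, List.sum_cons, List.sum_nil, add_zero, OscTerm.eval,
      oscInt]
    rw [integral_const_mul, ← mul_assoc]
    have hosc : ∫ z in K₀, oscWeight (b s) k p A H t y z ε * (mpow (y - (b s).x t z) β : ℂ) *
          Complex.exp (Complex.I * (b s).phase m t (y - (b s).x t z) z / ε) *
          (ρ (y - (b s).x t z) : ℂ) =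
        (((1 / (2 * Real.pi)) ^ ((n : ℝ) / 2) : ℝ) : ℂ) * ∫ z in K₀, A t z *
          H (Complex.I * (b s).phaseRest k p t (y - (b s).x t z) z / ε) *
          (mpow (y - (b s).x t z) β : ℂ) * (b s).carrier ρ m ε t y z := by
      rw [← integral_const_mul]
      congr 1 with z
      simp only [oscWeight, Coeffs.carrier]
      ring
    rw [hosc]
    rw [hsc]
    ring

lemma IsRegularMode.isRayAmplitude_amp {b : Coeffs n} (h : IsRegularMode K₀ b) (c : ℂ) (j : ℕ)
    (β : MIdx n) : IsRayAmplitude K₀ fun t z => c * b.a j β t z := by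
  obtain ⟨S, hS, hSc, h0⟩ := h.supp
  exact ⟨contDiffOn_const.mul (h.a_smooth j β).contDiffOn, S, hS, hSc,
    fun t ht z hz => by rw [h0 j β t ht z hz, mul_zero]⟩

lemma IsRegularMode.isRayAmplitude_amp_mul_phase {b : Coeffs n} (h : IsRegularMode K₀ b) (c : ℂ)
    (j : ℕ) (β γ : MIdx n) : IsRayAmplitude K₀ fun t z => c * b.a j β t z * b.φ γ t z := by
  obtain ⟨S, hS, hSc, h0⟩ := h.supp
  exact ⟨(contDiffOn_const.mul (h.a_smooth j β).contDiffOn).mul (h.φ_smooth γ).contDiffOn,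
    S, hS, hSc, fun t ht z hz => by rw [h0 j β t ht z hz, mul_zero, zero_mul]⟩

lemma Coeffs.amplitude_eq_sum_range (b : Coeffs n) {k J : ℕ} (hJ : (k + 1) / 2 ≤ J) (ε t : ℝ)
    (y z : Pt n) :
    b.amplitude k ε t y z = ∑ j ∈ Finset.range J, (ε : ℂ) ^ j *
      ∑ m ∈ Finset.range (k - 2 * j), ∑ β ∈ ofDegree n m,
        1 / (mfact β : ℂ) * b.a j β t z * (mpow y β : ℂ) := by
  refine Finset.sum_subset (Finset.range_mono hJ) fun j _ hj => ?_
  -- For the added indices the truncated difference `k - 2 * j` is zero, so the inner sum is empty.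
  rw [Finset.mem_range, not_lt] at hj
  rw [show k - 2 * j = 0 by omega]
  simp

lemma Coeffs.amplitude_add_sub (b : Coeffs n) (k p : ℕ) (ε t : ℝ) (y z : Pt n) :
    b.amplitude (k + p) ε t y z - b.amplitude k ε t y z =
      ∑ j ∈ Finset.range ((k + p + 1) / 2), (ε : ℂ) ^ j *
        ∑ m ∈ Finset.Ico (k - 2 * j) (k + p - 2 * j), ∑ β ∈ ofDegree n m,
          1 / (mfact β : ℂ) * b.a j β t z * (mpow y β : ℂ) := by
  rw [b.amplitude_eq_sum_range (k := k) (J := (k + p + 1) / 2) (by omega), amplitude,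
    ← Finset.sum_sub_distrib]
  refine Finset.sum_congr rfl fun j _ => ?_
  rw [← mul_sub, Finset.sum_Ico_eq_sub _ (by omega)]

/-- The part of the difference of two beams that comes from the amplitudes. -/
lemma isOscSum_amplitude_sub (hK₀ : IsCompact K₀) (hρ : IsCutoff η ρ) (hk : 1 ≤ k)
    (hb : ∀ i, IsRegularMode K₀ (b i)) (s : ι) :
    IsOscSum b K₀ η ρ k p fun ε t y z =>
      ((b s).amplitude (k + p) ε t (y - (b s).x t z) z -
        (b s).amplitude k ε t (y - (b s).x t z) z) * (b s).carrier ρ (k + p) ε t y z := by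
  have key : IsOscSum b K₀ η ρ k p fun ε t y z =>
      ∑ j ∈ Finset.range ((k + p + 1) / 2), ∑ m ∈ Finset.Ico (k - 2 * j) (k + p - 2 * j),
        ∑ β ∈ ofDegree n m, (ε : ℂ) ^ (j : ℤ) * (1 / (mfact β : ℂ) * (b s).a j β t z * 1 *
          (mpow (y - (b s).x t z) β : ℂ) * (b s).carrier ρ (k + p) ε t y z) := by
    refine .sum hK₀ fun j _ => .sum hK₀ fun m hm => .sum hK₀ fun β hβ => ?_
    rw [Finset.mem_Ico] at hm
    rw [mem_ofDegree] at hβ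
    -- No truncation takes place in `N`, because the new monomials have degree at least `k - 2 * j`.
    exact isOscSum_monomial (N := 2 * j + β.degree - k) (r := (j : ℤ))
      hK₀ hρ hk hb s (.inr rfl) ((hb s).isRayAmplitude_amp _ j β) isWeight_one (by omega)
  refine key.congr fun ε hε t ht y z => ?_
  rw [Coeffs.amplitude_add_sub, Finset.sum_mul]
  refine Finset.sum_congr rfl fun j _ => ?_
  rw [Finset.mul_sum, Finset.sum_mul]
  refine Finset.sum_congr rfl fun m _ => ?_
  rw [Finset.mul_sum, Finset.sum_mul]
  refine Finset.sum_congr rfl fun β _ => ?_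
  rw [zpow_natCast]
  ring

/-- The part of the difference of two beams that comes from the phases. -/
lemma isOscSum_amplitude_mul_rest (hK₀ : IsCompact K₀) (hρ : IsCutoff η ρ) (hk : 1 ≤ k)
    (hb : ∀ i, IsRegularMode K₀ (b i)) (s : ι) {m : ℕ} (hm : m = k ∨ m = k + p) {H : ℂ → ℂ}
    (hH : IsWeight H) :
    IsOscSum b K₀ η ρ k p fun ε t y z =>
      (b s).amplitude k ε t (y - (b s).x t z) z *
        (Complex.I * (b s).phaseRest k p t (y - (b s).x t z) z / ε *
        (H (Complex.I * (b s).phaseRest k p t (y - (b s).x t z) z / ε) *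
          (b s).carrier ρ m ε t y z)) := by
  have key : IsOscSum b K₀ η ρ k p fun ε t y z =>
      ∑ j ∈ Finset.range ((k + 1) / 2), ∑ d ∈ Finset.range (k - 2 * j), ∑ γ ∈ ofDegree n d,
        ∑ d' ∈ Finset.Icc (k + 2) (k + p + 1), ∑ β ∈ ofDegree n d',
        (ε : ℂ) ^ ((j : ℤ) - 1) * (1 / (mfact γ : ℂ) * (1 / (mfact β : ℂ)) * Complex.I *
          (b s).a j γ t z * (b s).φ β t z *
          H (Complex.I * (b s).phaseRest k p t (y - (b s).x t z) z / ε) *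
          (mpow (y - (b s).x t z) (γ + β) : ℂ) * (b s).carrier ρ m ε t y z) := by
    refine .sum hK₀ fun j _ => .sum hK₀ fun d _ => .sum hK₀ fun γ _ => .sum hK₀ fun d' hd' =>
      .sum hK₀ fun β hβ => ?_
    rw [Finset.mem_Icc] at hd'
    rw [mem_ofDegree] at hβ
    -- The exponent `j - 1` comes from `ε^j` in the amplitude and `1/ε` in front of the phase rest;
    -- `N` is not truncated because `|β| ≥ k + 2`.
    refine isOscSum_monomial (N := 2 * j + γ.degree + β.degree - 2 - k) (r := (j : ℤ) - 1)
      (β := γ + β) hK₀ hρ hk hb s hm ((hb s).isRayAmplitude_amp_mul_phase _ j γ β) hH ?_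
    rw [map_add]
    push_cast
    omega
  refine key.congr fun ε hε t ht y z => ?_
  have hε0 : (ε : ℂ) ≠ 0 := Complex.ofReal_ne_zero.2 hε.ne'
  generalize hC : H (Complex.I * (b s).phaseRest k p t (y - (b s).x t z) z / ε) = C
  rw [Coeffs.amplitude, Finset.sum_mul]
  refine Finset.sum_congr rfl fun j _ => ?_
  rw [Finset.mul_sum, Finset.sum_mul]
  refine Finset.sum_congr rfl fun d _ => ?_
  rw [Finset.mul_sum, Finset.sum_mul]
  refine Finset.sum_congr rfl fun γ _ => ?_
  rw [Coeffs.phaseRest, Finset.mul_sum, Finset.sum_div, Finset.sum_mul, Finset.mul_sum]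
  refine Finset.sum_congr rfl fun d' _ => ?_
  rw [Finset.mul_sum, Finset.sum_div, Finset.sum_mul, Finset.mul_sum]
  refine Finset.sum_congr rfl fun β _ => ?_
  rw [zpow_sub₀ hε0, zpow_natCast, zpow_one, mpow_add]
  push_cast
  ring

lemma isOscSum_beam_sub (hK₀ : IsCompact K₀) (hρ : IsCutoff η ρ) (hk : 1 ≤ k)
    (hb : ∀ i, IsRegularMode K₀ (b i)) (s : ι) :
    IsOscSum b K₀ η ρ k p fun ε t y z =>
      (b s).beam (k + p) ε t y z * (ρ (y - (b s).x t z) : ℂ) -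
        (b s).beam k ε t y z * (ρ (y - (b s).x t z) : ℂ) := by
  -- The three parts are `A_{k+p} - A_k` on the phase `Φ_{k+p}`, the left weight on `Φ_k`, and the
  -- right weight on `Φ_{k+p}`, where the extra `e^w` has been absorbed.
  refine (((isOscSum_amplitude_sub hK₀ hρ hk hb s).add hK₀
    (isOscSum_amplitude_mul_rest hK₀ hρ hk hb s (.inl rfl) isWeight_expWeightLeft)).add hK₀
    (isOscSum_amplitude_mul_rest hK₀ hρ hk hb s (.inr rfl) isWeight_expWeightRight)).congr
    fun ε hε t ht y z => ?_
  have hexp : Complex.exp (Complex.I * (b s).phase (k + p) t (y - (b s).x t z) z / ε) =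
      Complex.exp (Complex.I * (b s).phase k t (y - (b s).x t z) z / ε) *
        Complex.exp (Complex.I * (b s).phaseRest k p t (y - (b s).x t z) z / ε) := by
    rw [(b s).phase_add hk, ← Complex.exp_add]
    ring_nf
  have hw := expWeight_add (Complex.I * (b s).phaseRest k p t (y - (b s).x t z) z / ε)
  simp only [Coeffs.beam, Coeffs.carrier, hexp]
  generalize Complex.I * (b s).phaseRest k p t (y - (b s).x t z) z / ε = w at hw ⊢
  linear_combination (-(b s).amplitude k ε t (y - (b s).x t z) z *
    Complex.exp (Complex.I * (b s).phase k t (y - (b s).x t z) z / ε) *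
    (ρ (y - (b s).x t z) : ℂ)) * hw

lemma diffRep_of_isRegularMode [Fintype ι] [Nonempty ι] (hK₀ : IsCompact K₀) (hρ : IsCutoff η ρ)
    (hk : 1 ≤ k) (hb : ∀ i, IsRegularMode K₀ (b i)) : DiffRep b K₀ η ρ k p := by
  obtain ⟨L, hL, hrep⟩ := (IsOscSum.sum (S := Finset.univ) hK₀ fun s _ =>
    isOscSum_beam_sub (p := p) hK₀ hρ hk hb s).rep
  have hzero : IsRayAmplitude K₀ fun _ _ => 0 :=
    ⟨contDiffOn_const, ∅, empty_subset _, isClosed_empty, fun _ _ _ _ => rfl⟩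
  obtain ⟨s₀⟩ := ‹Nonempty ι›
  -- The representation needs at least one integral, but the list may be empty, as for `p = 0`. A
  -- term with zero amplitude is put in front; its exponent `k / 2` is positive, so the parity
  -- condition does not concern it.
  let τ₀ : OscTerm n ι := ⟨s₀, k, (k : ℝ) / 2, 0, oscWeight (b s₀) k p (fun _ _ => 0) fun _ => 1⟩
  have hτ₀ : τ₀.IsGood b K₀ η ρ k p := OscTerm.isGood_oscWeight (r := (k : ℤ)) hK₀ hρ hk hb s₀
    (.inl rfl) hzero isWeight_one (by simp; ring)
  have hgood : ∀ j : Fin (L.length + 1), ((τ₀ :: L).get j).IsGood b K₀ η ρ k p := fun j => by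
    rcases List.mem_cons.1 (List.get_mem (τ₀ :: L) j) with h | h
    · rw [h]; exact hτ₀
    · exact hL _ h
  refine ⟨L.length, fun j => ((τ₀ :: L).get j).s, fun j => ((τ₀ :: L).get j).m,
    fun j => ((τ₀ :: L).get j).ℓ, fun j => ((τ₀ :: L).get j).β, fun j => ((τ₀ :: L).get j).g,
    fun j => (hgood j).order, fun j => (hgood j).exponent, fun j => (hgood j).parity,
    fun j => (hgood j).continuousOn, fun ε hε t ht y => ?_,
    fun T hT d hd had j => (hgood j).properties T hT d hd had⟩
  have hcont : ∀ m, IntegrableOn (fun z => ∑ s, (b s).beam m ε t y z *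
      (ρ (y - (b s).x t z) : ℂ)) K₀ := fun m => by
    refine (Continuous.continuousOn ?_).integrableOn_compact hK₀
    refine continuous_finsetSum _ fun s _ => ?_
    refine (((hb s).continuous_amplitude m ε ht y).mul
      ((hb s).continuous_carrier hρ.smooth.continuous m ε ht y)).congr fun z => ?_
    simp only [Pi.mul_apply, Coeffs.carrier, Coeffs.beam, mul_assoc]
  have hsum : ∑ j : Fin (L.length + 1), ((τ₀ :: L).get j).eval b K₀ ρ ε t y =
      (L.map fun τ => τ.eval b K₀ ρ ε t y).sum := by
    rw [Fin.sum_univ_succ]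
    have h0 : τ₀.eval b K₀ ρ ε t y = 0 := by simp [OscTerm.eval, oscInt, oscWeight, τ₀]
    simp only [List.get_eq_getElem, Fin.val_zero, List.getElem_cons_zero, Fin.val_succ,
      List.getElem_cons_succ, h0, zero_add]
    exact Fin.sum_univ_fun_getElem L fun τ => τ.eval b K₀ ρ ε t y
  rw [superposition, superposition, ← mul_sub, ← integral_sub (hcont _) (hcont _)]
  simp only [← Finset.sum_sub_distrib]
  rw [hrep ε hε t ht y, ← hsum]
  rfl

end

end GaussianBeam
end

/-! ### The theorem for the Schrödinger and the wave equation -/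

open GaussianBeam in
theorem mainTheorem4 {n : ℕ} (K₀ : Set (Pt n)) (hK₀ : IsCompact K₀)
    (φ₀ B₀ B₁ : Pt n → ℝ) (hφ₀ : ContDiff ℝ ∞ φ₀)
    (hB₀ : ContDiff ℝ ∞ B₀) (hB₀K : tsupport B₀ ⊆ K₀)
    (hB₁ : ContDiff ℝ ∞ B₁) (hB₁K : tsupport B₁ ⊆ K₀)
    (η : ℝ≥0∞) (hη : 0 < η) (ρ : Pt n → ℝ) (hρ : IsCutoff η ρ)
    (k p : ℕ) (hk : 1 ≤ k) :
    (∀ (V : Pt n → ℝ) (b : Coeffs n), SmoothBounded V → IsSchrodinger V φ₀ B₀ b →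
      DiffRep ![b] K₀ η ρ k p) ∧
    (∀ (c : Pt n → ℝ) (bp bm : Coeffs n), SmoothBounded c → (∃ c₀ > 0, ∀ y, c₀ ≤ c y) →
      (∃ δ > 0, ∀ y, δ ≤ ‖gradient φ₀ y‖) → IsWave c φ₀ B₀ B₁ bp bm →
      DiffRep ![bp, bm] K₀ η ρ k p) := by
  refine ⟨fun V b hV h => ?_, fun c bp bm hc hc₀ hδ h => ?_⟩
  · refine diffRep_of_isRegularMode hK₀ hρ hk fun i => ?_
    rw [Subsingleton.elim i 0]
    exact h.isRegularMode hV.1 hφ₀ hB₀ hB₀K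
  · obtain ⟨c₀, hc₀, hcl⟩ := hc₀
    obtain ⟨δ, hδ, hg⟩ := hδ
    obtain ⟨hp, hm⟩ := h.isRegularMode hc.1 (fun y => hc₀.trans_le (hcl y)) hφ₀
      (fun y => norm_pos_iff.1 (hδ.trans_le (hg y))) hB₀ hB₁ hB₀K hB₁K
    exact diffRep_of_isRegularMode hK₀ hρ hk (Fin.forall_fin_two.2 ⟨hp, hm⟩)
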